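/- **Conventions.** A map $f:X\to Y$ is a quasi-isometry if there are $K\ge 1$, $C\ge 0$ with $K^{-1}d(x,x')-C\le d(f(x),f(x'))\le Kd(x,x')+C$ for all $x,x'\in X$ and every point of $Y$ is within $C$ of $f(X)$. In a CAT(0) space $X$, let $\alpha:I\to X$ be a unit-speed geodesic on a closed interval $I\subseteq\mathbb R$, $\pi_\alpha$ the closest-point projection to $\alpha$, and $r$ such that $[r-\frac12,r+\frac12]\subset\operatorname{int} I$. The curtain dual to $\alpha$ at $r$ is $h=\pi_\alpha^{-1}(\alpha[r-\frac12,r+\frac12])$; it separates $A$ from $B$ if, for some such $\alpha$ and $r$ defining $h$, $\pi_\alpha(A)\subset\alpha(I\cap(-\infty,r-\frac12))$ and $\pi_\alpha(B)\subset\alpha(I\cap(r+\frac12,\infty))$. A chain is a sequence $(h_i)$ of pairwise disjoint curtains such that $h_i$ separates $h_{i-1}$ from $h_{i+1}$ for all $i$. Disjoint curtains $h,h'$ are $L$-separated if every chain all of whose members meet both $h$ and $h'$ has at most $L$ members; an $L$-chain is a chain whose members are pairwise $L$-separated. Put $d_L(x,x)=0$ and, for $x\ne y$, $d_L(x,y)=1+\max\{|c|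 : c \text{ an } L\text{-chain each of whose members separates } x \text{ from } y\}$. Fix $\lambda_L\in(0,1)$, $L\ge 1$, with $\sum\lambda_L<\sum L\lambda_L<\sum L^2\lambda_L<\infty$. The curtain model $\widehat X$ is the set $X$ with the distance $\hat d(x,y)=\sum_{L\ge1}\lambda_L d_L(x,y)$. **Theorem.** Let $X$ be the universal cover of $\{z\in\mathbb R^2: |z|\ge 1\}$ with the induced length metric, in polar coordinates $(t,r)\in\mathbb R\times[1,\infty)$ (covering map $(t,r)\mapsto re^{it}$). Let $W$, respectively $Z$, be obtained from $X$ by gluing the origin of a ray $[0,\infty)$ to each of the points $(i,2^i)$, respectively $(0,2^i)$, $i\in\mathbb N=\{0,1,2,\dots\}$. Then, for every choice of $(\lambda_L)$ as above: 1. $X$ is a CAT(0) space, the map $\phi(t,r)=(t-\log_2 r,\,r)$ is a quasi-isometry $X\to X$, and the same map $\phi$, regarded as a map $\widehat X\to\widehat X$, is not a quasi-isometry. 2. $W$ and $Z$ are CAT(0) spaces that are quasi-isometric to each other, but $\widehat W$ and $\widehat Z$ are not quasi-isometric. 3. $\widehat W$ is quasi-isometric to the real line with a ray glued at each positive integer,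 and $\widehat Z$ is quasi-isometric to the wedge of countably infinitely many rays. -/

import Mathlib

noncomputable section

namespace CurtainModels

open Set
open scoped ENNReal

/-! ## Quasi-isometries -/

/-- `f` is a quasi-isometry: a quasi-isometric embedding with coarsely dense image. -/
def IsQuasiIsometry {X Y : Type*} [Dist X] [Dist Y] (f : X → Y) : Prop :=
  ∃ K C : ℝ, 1 ≤ K ∧ 0 ≤ C ∧
    (∀ x x' : X, K⁻¹ * dist x x' - C ≤ dist (f x) (f x') ∧
      dist (f x) (f x') ≤ K * dist x x' + C) ∧
    ∀ y : Y, ∃ x : X, dist (f x) y ≤ C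

def QuasiIsometric (X Y : Type*) [Dist X] [Dist Y] : Prop :=
  ∃ f : X → Y, IsQuasiIsometry f

/-! ## CAT(0) spaces -/

/-- `c` restricted to `[0,1]` is a geodesic from `x` to `y`, parametrized proportionally to
arc length. -/
def IsGeodesicFromTo {X : Type*} [MetricSpace X] (c : ℝ → X) (x y : X) : Prop :=
  c 0 = x ∧ c 1 = y ∧
    ∀ s ∈ Icc (0 : ℝ) 1, ∀ t ∈ Icc (0 : ℝ) 1, dist (c s) (c t) = |s - t| * dist x y

/-- A CAT(0) space: any two points are joined by a geodesic, and geodesic triangles are no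
fatter than their comparison triangles in the Euclidean plane. Any two points on different
sides of a triangle lie on the two sides issuing from some vertex `p`. -/
def IsCAT0 (X : Type*) [MetricSpace X] : Prop :=
  (∀ x y : X, ∃ c : ℝ → X, IsGeodesicFromTo c x y) ∧
  ∀ (p q r : X) (c c' : ℝ → X), IsGeodesicFromTo c p q → IsGeodesicFromTo c' p r →
    ∀ p' q' r' : EuclideanSpace ℝ (Fin 2),
      dist p' q' = dist p q → dist p' r' = dist p r → dist q' r' = dist q r →
      ∀ s ∈ Icc (0 : ℝ) 1, ∀ t ∈ Icc (0 : ℝ) 1,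
        dist (c s) (c' t) ≤ dist (AffineMap.lineMap p' q' s) (AffineMap.lineMap p' r' t)

/-! ## Curtains, chains and the curtain model -/

section Curtains

variable {X : Type*} [MetricSpace X]

/-- A unit speed geodesic on the closed interval `I` (a segment, a ray or a line). -/
def IsGeodesicOn (I : Set ℝ) (α : ℝ → X) : Prop :=
  IsClosed I ∧ I.OrdConnected ∧ ∀ s ∈ I, ∀ t ∈ I, dist (α s) (α t) = |s - t|

/-- The preimage of `α '' J` under the closest point projection to the geodesic `α '' I`. -/
def projPreimage (I : Set ℝ) (α : ℝ → X) (J : Set ℝ) : Set X :=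
  {x | ∃ s ∈ I ∩ J, ∀ t ∈ I, dist x (α s) ≤ dist x (α t)}

/-- The curtain dual to `α` at `r`. -/
def curtain (I : Set ℝ) (α : ℝ → X) (r : ℝ) : Set X :=
  projPreimage I α (Icc (r - 1 / 2) (r + 1 / 2))

/-- The half-space `h⁻` of the curtain dual to `α` at `r`. -/
def halfMinus (I : Set ℝ) (α : ℝ → X) (r : ℝ) : Set X :=
  projPreimage I α (Iio (r - 1 / 2))

/-- The half-space `h⁺` of the curtain dual to `α` at `r`. -/
def halfPlus (I : Set ℝ) (α : ℝ → X) (r : ℝ) : Set X :=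
  projPreimage I α (Ioi (r + 1 / 2))

/-- `h` is the curtain dual to the geodesic `α : I → X` at `r`. -/
def IsCurtainAt (h : Set X) (I : Set ℝ) (α : ℝ → X) (r : ℝ) : Prop :=
  IsGeodesicOn I α ∧ Icc (r - 1 / 2) (r + 1 / 2) ⊆ interior I ∧ h = curtain I α r

def IsCurtain (h : Set X) : Prop :=
  ∃ (I : Set ℝ) (α : ℝ → X) (r : ℝ), IsCurtainAt h I α r

/-- The curtain `h` separates `A` from `B`. The relation is symmetric in `A` and `B`, since the
geodesic can be reversed. -/
def Separates (h A B : Set X) : Prop :=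
  ∃ (I : Set ℝ) (α : ℝ → X) (r : ℝ),
    IsCurtainAt h I α r ∧ A ⊆ halfMinus I α r ∧ B ⊆ halfPlus I α r

/-- A (finite) chain of `n` curtains. -/
def IsCurtainChain {n : ℕ} (c : Fin n → Set X) : Prop :=
  (∀ i, IsCurtain (c i)) ∧ (∀ i j, i ≠ j → Disjoint (c i) (c j)) ∧
    ∀ i j k : Fin n, (i : ℕ) + 1 = j → (j : ℕ) + 1 = k → Separates (c j) (c i) (c k)

/-- `h` and `h'` are `L`-separated: they are disjoint and every chain all of whose members meet
both `h` and `h'` has at most `L` members. (Bounding the finite chains bounds all chains.) -/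
def LSeparated (L : ℕ) (h h' : Set X) : Prop :=
  Disjoint h h' ∧ ∀ (n : ℕ) (c : Fin n → Set X), IsCurtainChain c →
    (∀ i, (c i ∩ h).Nonempty ∧ (c i ∩ h').Nonempty) → n ≤ L

def IsLChain (L : ℕ) {n : ℕ} (c : Fin n → Set X) : Prop :=
  IsCurtainChain c ∧ ∀ i j, i ≠ j → LSeparated L (c i) (c j)

open Classical in
/-- The metric `d_L`: one plus the maximal length of an `L`-chain separating `x` from `y`, for
`x ≠ y`. In a CAT(0) space such a chain has at most `dist x y` members. -/
def dL (L : ℕ) (x y : X) : ℝ :=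
  if x = y then 0
  else 1 + ((sSup {n : ℕ | ∃ c : Fin n → Set X,
    IsLChain L c ∧ ∀ i, Separates (c i) {x} {y}} : ℕ) : ℝ)

end Curtains

/-- The condition on the weights `λ_1, λ_2, …` used to form the curtain model. -/
def IsWeight (lam : ℕ+ → ℝ) : Prop :=
  (∀ L, lam L ∈ Ioo (0 : ℝ) 1) ∧ Summable (fun L : ℕ+ => (L : ℝ) ^ 2 * lam L) ∧
    ∑' L : ℕ+, lam L < ∑' L : ℕ+, (L : ℝ) * lam L ∧
    ∑' L : ℕ+, (L : ℝ) * lam L < ∑' L : ℕ+, (L : ℝ) ^ 2 * lam L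

/-- The curtain model of `X`: the set `X` with the distance `∑_{L ≥ 1} λ_L d_L`. -/
@[ext]
structure CurtainModel (lam : ℕ+ → ℝ) (X : Type*) where
  point : X

instance (lam : ℕ+ → ℝ) (X : Type*) [MetricSpace X] : Dist (CurtainModel lam X) where
  dist x y := ∑' L : ℕ+, lam L * dL (L : ℕ) x.point y.point

/-- The map of curtain models given by `f` on the underlying sets. -/
def curtainModelMap (lam : ℕ+ → ℝ) {X Y : Type*} (f : X → Y) (x : CurtainModel lam X) :
    CurtainModel lam Y := ⟨f x.point⟩

/-! ## The infinite parking lot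

Polar coordinates identify the universal cover of `{z : ℂ | 1 ≤ ‖z‖}` with `ℝ × [1, ∞)`; the
covering map is `(t, r) ↦ r e^{it}`, and the distance is the induced length metric. -/

/-- The set `ℝ × [1, ∞)` with its usual topology. -/
abbrev Strip : Type := {p : ℝ × ℝ // 1 ≤ p.2}

/-- The covering map `(t, r) ↦ r e^{it}`. -/
def cover (p : Strip) : ℂ := (p.1.2 : ℂ) * Complex.exp ((p.1.1 : ℂ) * Complex.I)

/-- The length of a path in the universal cover is the Euclidean length of its image in the
plane. -/
def pathLength {x y : Strip} (γ : Path x y) : ℝ≥0∞ :=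
  eVariationOn (fun s : unitInterval => cover (γ s)) univ

def lengthDist (x y : Strip) : ℝ≥0∞ := ⨅ γ : Path x y, pathLength γ

theorem lengthDist_self (x : Strip) : lengthDist x x = 0 := by
  refine le_antisymm ((iInf_le _ (Path.refl x)).trans ?_) zero_le
  refine (eVariationOn.constant_on ?_).le
  rintro _ ⟨a, -, rfl⟩ _ ⟨b, -, rfl⟩
  rfl

theorem lengthDist_comm_le (x y : Strip) : lengthDist x y ≤ lengthDist y x := by
  refine le_iInf fun γ => (iInf_le _ γ.symm).trans ?_
  exact eVariationOn.comp_le_of_antitoneOn (fun s : unitInterval => cover (γ s)) (s := univ) (t := univ)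
    unitInterval.symm (fun a _ b _ h => by simpa using h) (fun _ _ => mem_univ _)

theorem pathLength_trans_le {x y z : Strip} (γ : Path x y) (δ : Path y z) :
    pathLength (γ.trans δ) ≤ pathLength γ + pathLength δ := by
  let m : unitInterval := ⟨1 / 2, by norm_num, by norm_num⟩
  have hu : (univ : Set unitInterval) = Iic m ∪ Ici m := by
    ext s; simp
  unfold pathLength
  rw [hu, eVariationOn.union _ (x := m) isGreatest_Iic isLeast_Ici, ← hu]
  refine add_le_add ?_ ?_
  · have : EqOn (fun s : unitInterval => cover ((γ.trans δ) s))
        ((fun s : unitInterval => cover (γ s)) ∘ fun s : unitInterval => projIcc 0 1 zero_le_one (2 * (s : ℝ)))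
        (Iic m) := by
      intro s hs
      have hs' : (s : ℝ) ≤ 1 / 2 := hs
      simp only [Path.trans_apply, Function.comp_apply, hs', dif_pos]
      congr 2
      rw [projIcc_of_mem]
    rw [eVariationOn.congr this]
    exact eVariationOn.comp_le_of_monotoneOn _ _
      (fun a _ b _ h => monotone_projIcc _ (by
        have : (a : ℝ) ≤ b := h
        linarith)) (fun _ _ => mem_univ _)
  · have : EqOn (fun s : unitInterval => cover ((γ.trans δ) s))
        ((fun s : unitInterval => cover (δ s)) ∘ fun s : unitInterval => projIcc 0 1 zero_le_one (2 * (s : ℝ) - 1))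
        (Ici m) := by
      intro s hs
      have hs' : 1 / 2 ≤ (s : ℝ) := hs
      rcases hs'.eq_or_lt with h | h
      · have h1 : (s : ℝ) = 1 / 2 := h.symm
        simp [Path.trans_apply, h1]
      · simp only [Path.trans_apply, Function.comp_apply, not_le.2 h, dif_neg,
          not_false_eq_true]
        congr 2
        rw [projIcc_of_mem]
    rw [eVariationOn.congr this]
    exact eVariationOn.comp_le_of_monotoneOn _ _
      (fun a _ b _ h => monotone_projIcc _ (by
        have : (a : ℝ) ≤ b := h
        linarith)) (fun _ _ => mem_univ _)

theorem lengthDist_triangle (x y z : Strip) :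
    lengthDist x z ≤ lengthDist x y + lengthDist y z := by
  unfold lengthDist
  rw [ENNReal.iInf_add]
  refine le_iInf fun γ => ?_
  rw [ENNReal.add_iInf]
  exact le_iInf fun δ => (iInf_le _ (γ.trans δ)).trans (pathLength_trans_le γ δ)

theorem lengthDist_ne_top (x y : Strip) : lengthDist x y ≠ ⊤ := by
  let T : ℝ → ℝ := fun s => (1 - s) * x.1.1 + s * y.1.1
  let R : ℝ → ℝ := fun s => (1 - s) * x.1.2 + s * y.1.2
  have hR : ∀ s : unitInterval, 1 ≤ R s := fun s => by
    have h1 := s.2.1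
    have h2 := s.2.2
    have hx := x.2
    have hy := y.2
    simp only [R]
    nlinarith
  let γ : Path x y :=
    { toFun := fun s => ⟨(T s, R s), hR s⟩
      continuous_toFun := by
        simp only [T, R]
        fun_prop
      source' := by ext <;> simp [T, R]
      target' := by ext <;> simp [T, R] }
  let g : ℝ → ℂ := fun s => (R s : ℂ) * Complex.exp ((T s : ℂ) * Complex.I)
  have hlin : ∀ a b : ℝ, ContDiff ℝ 1 (fun s : ℝ => (1 - s) * a + s * b) := fun a b => by
    fun_prop
  have hRd : ContDiff ℝ 1 (fun s => (R s : ℂ)) :=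
    Complex.ofRealCLM.contDiff.comp (hlin _ _)
  have hTd : ContDiff ℝ 1 (fun s => (T s : ℂ)) :=
    Complex.ofRealCLM.contDiff.comp (hlin _ _)
  have hg : ContDiff ℝ 1 g := hRd.mul (hTd.mul contDiff_const).cexp
  obtain ⟨K, hK⟩ := hg.contDiffOn.exists_lipschitzOnWith one_ne_zero (convex_Icc (0 : ℝ) 1)
    isCompact_Icc
  have hbv : eVariationOn g (Icc 0 1) ≠ ⊤ := by
    have := hK.locallyBoundedVariationOn 0 1 (by simp) (by simp)
    rwa [inter_self] at this
  refine ne_top_of_le_ne_top hbv ((iInf_le _ γ).trans ?_)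
  exact eVariationOn.comp_le_of_monotoneOn g (t := univ) (fun s : unitInterval => (s : ℝ))
    (fun a _ b _ h => h) (fun s _ => s.2)

theorem eq_of_lengthDist_eq_zero {x y : Strip} (h : lengthDist x y = 0) : x = y := by
  by_contra hxy
  suffices H : ∃ e : ℝ≥0∞, 0 < e ∧ ∀ γ : Path x y, e ≤ pathLength γ by
    obtain ⟨e, he, H⟩ := H
    exact absurd (he.trans_le (le_iInf H)) (by rw [← lengthDist, h]; simp)
  by_cases hc : cover x = cover y
  · have hn : ∀ z : Strip, ‖cover z‖ = z.1.2 := fun z => by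
      rw [cover, norm_mul, Complex.norm_exp_ofReal_mul_I, mul_one, Complex.norm_real,
        Real.norm_of_nonneg (zero_le_one.trans z.2)]
    have hr : x.1.2 = y.1.2 := by rw [← hn, ← hn, hc]
    have hx0 : (x.1.2 : ℂ) ≠ 0 := by
      exact_mod_cast (zero_lt_one.trans_le x.2).ne'
    have he : Complex.exp ((x.1.1 : ℂ) * Complex.I) = Complex.exp ((y.1.1 : ℂ) * Complex.I) := by
      have := hc
      rw [cover, cover, ← hr] at this
      exact mul_left_cancel₀ hx0 this
    obtain ⟨n, hn'⟩ := Complex.exp_eq_exp_iff_exists_int.1 he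
    have ht : x.1.1 = y.1.1 + n * (2 * Real.pi) := by
      have := congrArg Complex.im hn'
      simpa using this
    have hn0 : n ≠ 0 := by
      rintro rfl
      exact hxy (Subtype.ext (Prod.ext (by simpa using ht) hr))
    have hpi := Real.pi_pos
    refine ⟨1, one_pos, fun γ => ?_⟩
    have hcont : Continuous fun s : unitInterval => (γ s).1.1 := by fun_prop
    have key : ∃ e : ℝ, (e = Real.pi ∨ e = -Real.pi) ∧ ∃ s, (γ s).1.1 = x.1.1 + e := by
      rcases lt_or_gt_of_ne hn0 with hneg | hpos
      · have : (n : ℝ) ≤ -1 := by exact_mod_cast Int.le_sub_one_of_lt hneg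
        obtain ⟨s, hs⟩ := mem_range_of_exists_le_of_exists_ge hcont
          (c := x.1.1 + Real.pi) ⟨0, by simp [hpi.le]⟩ ⟨1, by simp; nlinarith⟩
        exact ⟨_, Or.inl rfl, s, hs⟩
      · have : (1 : ℝ) ≤ n := by exact_mod_cast hpos
        obtain ⟨s, hs⟩ := mem_range_of_exists_le_of_exists_ge hcont
          (c := x.1.1 + -Real.pi) ⟨1, by simp; nlinarith⟩ ⟨0, by simp [hpi.le]⟩
        exact ⟨_, Or.inr rfl, s, hs⟩
    obtain ⟨e, he, s, hs⟩ := key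
    have hexp : Complex.exp ((e : ℂ) * Complex.I) = -1 := by
      rcases he with rfl | rfl
      · exact Complex.exp_pi_mul_I
      · push_cast
        rw [neg_mul, Complex.exp_neg, Complex.exp_pi_mul_I]
        norm_num
    have hcs : cover (γ s) = -(((γ s).1.2 : ℂ) * Complex.exp ((x.1.1 : ℂ) * Complex.I)) := by
      rw [cover, hs]
      push_cast
      rw [add_mul, Complex.exp_add, hexp]
      ring
    have hd : 1 ≤ dist (cover (γ 0)) (cover (γ s)) := by
      have h1 := (γ s).2
      have h2 := x.2
      rw [hcs, dist_eq_norm, γ.source, cover, sub_neg_eq_add, ← add_mul, norm_mul,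
        Complex.norm_exp_ofReal_mul_I, mul_one, ← Complex.ofReal_add, Complex.norm_real,
        Real.norm_of_nonneg (by linarith)]
      linarith
    have h3 := eVariationOn.edist_le (fun s : unitInterval => cover (γ s))
      (mem_univ (0 : unitInterval)) (mem_univ s)
    refine le_trans ?_ h3
    rw [edist_dist]
    exact ENNReal.one_le_ofReal.2 hd
  · refine ⟨edist (cover x) (cover y), edist_pos.2 hc, fun γ => ?_⟩
    have := eVariationOn.edist_le (fun s : unitInterval => cover (γ s))
      (mem_univ (0 : unitInterval)) (mem_univ (1 : unitInterval))
    rw [γ.source, γ.target] at this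
    exact this

/-- The infinite parking lot: the universal cover of the plane minus the open unit disc, in
polar coordinates and with its length metric. -/
@[ext]
structure ParkingLot where
  angle : ℝ
  radius : ℝ
  one_le_radius : 1 ≤ radius

def ParkingLot.toStrip (x : ParkingLot) : Strip := ⟨(x.angle, x.radius), x.one_le_radius⟩

instance : MetricSpace ParkingLot where
  dist x y := (lengthDist x.toStrip y.toStrip).toReal
  dist_self x := by simp [lengthDist_self]
  dist_comm x y := by
    rw [le_antisymm (lengthDist_comm_le x.toStrip y.toStrip) (lengthDist_comm_le _ _)]
  dist_triangle x y z := by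
    rw [← ENNReal.toReal_add (lengthDist_ne_top _ _) (lengthDist_ne_top _ _)]
    exact ENNReal.toReal_mono
      (ENNReal.add_ne_top.2 ⟨lengthDist_ne_top _ _, lengthDist_ne_top _ _⟩)
      (lengthDist_triangle _ _ _)
  eq_of_dist_eq_zero {x y} h := by
    have := eq_of_lengthDist_eq_zero
      (((ENNReal.toReal_eq_zero_iff _).1 h).resolve_right (lengthDist_ne_top _ _))
    simp only [ParkingLot.toStrip, Subtype.mk.injEq, Prod.mk.injEq] at this
    exact ParkingLot.ext this.1 this.2

/-- The logarithmic spiral map `(t, r) ↦ (t - log₂ r, r)`. -/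
def spiralMap (x : ParkingLot) : ParkingLot :=
  ⟨x.angle - Real.logb 2 x.radius, x.radius, x.one_le_radius⟩

/-! ## Gluing rays -/

/-- The space obtained from `X` by gluing, for each `i`, the origin of a ray `[0, ∞)` to the
point `p i`: its points are those of `X` and the points at distance `s > 0` from the origin of
the `i`-th ray. -/
inductive AttachRays {X ι : Type*} (p : ι → X)
  | base (x : X) : AttachRays p
  | ray (i : ι) (s : ℝ) (hs : 0 < s) : AttachRays p

namespace AttachRays

variable {X ι : Type*} [MetricSpace X] {p : ι → X}

open Classical in
/-- The gluing metric. -/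
def gdist : AttachRays p → AttachRays p → ℝ
  | base x, base y => dist x y
  | base x, ray j t _ => dist x (p j) + t
  | ray i s _, base y => s + dist (p i) y
  | ray i s _, ray j t _ => if i = j then |s - t| else s + dist (p i) (p j) + t

instance : MetricSpace (AttachRays p) where
  dist := gdist
  dist_self u := by cases u <;> simp [gdist]
  dist_comm u v := by
    rcases u with x | ⟨i, s, hs⟩ <;> rcases v with y | ⟨j, t, ht⟩
    · exact dist_comm x y
    · simp only [gdist, dist_comm x]; ring
    · simp only [gdist, dist_comm (p i)]; ring
    · by_cases h : i = j
      · simp [gdist, h, abs_sub_comm]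
      · simp only [gdist, h, Ne.symm h, if_false, dist_comm (p i)]; ring
  dist_triangle u v w := by
    have tri := fun a b c : X => dist_triangle a b c
    rcases u with x | ⟨i, s, hs⟩ <;> rcases v with y | ⟨j, t, ht⟩ <;>
      rcases w with z | ⟨k, r, hr⟩ <;> simp only [gdist]
    · exact tri x y z
    · linarith [tri x y (p k)]
    · linarith [tri x (p j) z]
    · split_ifs with h
      · subst h
        linarith [neg_abs_le (t - r)]
      · linarith [tri x (p j) (p k)]
    · linarith [tri (p i) y z]
    · split_ifs with h
      · subst h
        have := tri (p i) y (p i)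
        rw [dist_self] at this
        exact abs_le.2 ⟨by linarith, by linarith⟩
      · linarith [tri (p i) y (p k)]
    · split_ifs with h
      · subst h
        linarith [le_abs_self (s - t)]
      · linarith [tri (p i) (p j) z]
    · by_cases hij : i = j <;> by_cases hjk : j = k
      · subst hij hjk
        simpa using abs_sub_le s t r
      · subst hij
        simp only [hjk, if_true, if_false]
        linarith [le_abs_self (s - t)]
      · subst hjk
        simp only [hij, if_true, if_false]
        linarith [neg_abs_le (t - r)]
      · simp only [hij, hjk, if_false]
        have := tri (p i) (p j) (p k)
        split_ifs with hik
        · subst hik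
          rw [dist_self] at this
          exact abs_le.2 ⟨by linarith, by linarith⟩
        · linarith
  eq_of_dist_eq_zero {u v} h := by
    change gdist u v = 0 at h
    rcases u with x | ⟨i, s, hs⟩ <;> rcases v with y | ⟨j, t, ht⟩ <;> simp only [gdist] at h
    · rw [eq_of_dist_eq_zero h]
    · linarith [dist_nonneg (x := x) (y := p j)]
    · linarith [dist_nonneg (x := p i) (y := y)]
    · split_ifs at h with hij
      · subst hij
        have : s = t := sub_eq_zero.1 (abs_eq_zero.1 h)
        subst this
        rfl
      · linarith [dist_nonneg (x := p i) (y := p j)]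

end AttachRays

/-- The parking lot with a ray glued at each point `(i, 2^i)`, `i ∈ ℕ`. -/
abbrev SpaceW : Type :=
  AttachRays fun i : ℕ => ParkingLot.mk (i : ℝ) (2 ^ i) (one_le_pow₀ one_le_two)

/-- The parking lot with a ray glued at each point `(0, 2^i)`, `i ∈ ℕ`. -/
abbrev SpaceZ : Type :=
  AttachRays fun i : ℕ => ParkingLot.mk 0 (2 ^ i) (one_le_pow₀ one_le_two)

/-- The real line with a ray glued at each positive integer. -/
abbrev LineWithRays : Type := AttachRays fun n : ℕ+ => (n : ℝ)

/-- The wedge of countably infinitely many rays, glued at their origins. -/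
abbrev WedgeOfRays : Type := AttachRays fun _ : ℕ => PUnit.unit

end CurtainModels

end

noncomputable section

namespace CurtainModels

open Set
open scoped ENNReal

/-! ## The metric of the parking lot -/

namespace ParkingLot

/-! Call the segment `α '' Icc (r - 1 / 2) (r + 1 / 2)` the pole of the curtain dual to `α` at `r`.
Everything about curtain models rests on one estimate, `exists_dist_bounds`: for the parking lot
with any family of rays attached, the curtain distance agrees, up to multiplicative and additive
constants, with `treeDist`, the distance that survives when the radial coordinate of the parking lot
is forgotten. So the model of `SpaceW` is coarsely a line of angles with a ray at each `i`, and that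
of `SpaceZ` is a line with all rays at the angle 0, which is a wedge of rays. The spiral map is
bi-Lipschitz on the parking lot, but it moves points of equal angle, which are boundedly close in
the model, to points whose angles differ by arbitrarily much.

Lower bound in the estimate: a geodesic between points whose angles lie at least `π / 2` on either
side of `T` runs through the point of the unit circle at the angle `T` (`dist_add_circle`). Hence
every curtain meeting two curtains dual to the circle at distance 20 contains one of two fixed
points, and the two curtains are 2-separated (`lSeparated_circle`). The points of an attached ray
are cut points, which gives `lSeparated_ray`. Long 2-chains result, so `d_2` grows linearly with
`treeDist`.

Upper bound, uniform in `L`: a curtain whose pole lies in the parking lot contains a straight ray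
issuing from the middle of the pole at a right angle, hence goes to infinity in some integral
direction near its pole (`exists_hasEnd`). Two curtains with the same end are both crossed by
arbitrarily long chains dual to a radial ray, so they are not `L`-separated for any `L`
(`HasEnd.not_lSeparated`). A curtain whose pole touches an attached ray contains a point of
half-integral height on it. If the curtain separates `x` from `y`, then its pole cannot lie where
the distances to `x` and `y` differ by a constant (`Separates.exists_injOn`), which leaves only
boundedly many more than `treeDist x y` candidates, up to a factor; pigeonhole (`IsLChain.card_le`)
bounds the chain.

The CAT(0) property comes from logarithm maps: at each point between `x` and `y` there is a
non-expanding map to the plane that keeps distances to that point and the distance from `x` to `y`.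
Stewart's identity in the plane then yields the Bruhat–Tits inequality, first for the parking lot
and then with rays attached.

Finally the two models differ because a quasi-isometric embedding into a wedge must send every
branch point of the line with rays close to the wedge point: three legs cannot leave along a single
ray (`not_isQIEmbedding_line_wedge`). The branch points are unbounded, so this is impossible. -/

/-- The image of a point in the plane. -/
def pos (x : ParkingLot) : ℂ := cover x.toStrip

theorem pos_eq (x : ParkingLot) :
    x.pos = (x.radius : ℂ) * Complex.exp ((x.angle : ℂ) * Complex.I) := rfl

theorem radius_pos (x : ParkingLot) : 0 < x.radius := zero_lt_one.trans_le x.one_le_radius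

theorem norm_pos (x : ParkingLot) : ‖x.pos‖ = x.radius := by
  rw [pos_eq, norm_mul, Complex.norm_exp_ofReal_mul_I, mul_one, Complex.norm_real,
    Real.norm_of_nonneg x.radius_pos.le]

theorem ofReal_dist (x y : ParkingLot) :
    ENNReal.ofReal (dist x y) = lengthDist x.toStrip y.toStrip :=
  ENNReal.ofReal_toReal (lengthDist_ne_top _ _)

theorem dist_pos_le (x y : ParkingLot) : dist x.pos y.pos ≤ dist x y := by
  rw [← ENNReal.ofReal_le_ofReal_iff dist_nonneg, ofReal_dist, ← edist_dist]
  refine le_iInf fun γ => ?_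
  have := eVariationOn.edist_le (fun s : unitInterval => cover (γ s))
    (mem_univ (0 : unitInterval)) (mem_univ (1 : unitInterval))
  rwa [γ.source, γ.target] at this

theorem abs_radius_sub_le (x y : ParkingLot) : |x.radius - y.radius| ≤ dist x y := by
  rw [← norm_pos, ← norm_pos]
  exact (abs_norm_sub_norm_le _ _).trans ((dist_eq_norm x.pos y.pos).symm.le.trans (dist_pos_le x y))

/-- Cut an almost shortest path at a zero of `F`, found by the intermediate value theorem. This
replaces arguments along geodesics before geodesics are available; the price is the error `ε`. -/
theorem exists_crossing {F : Strip → ℝ} (hF : Continuous F) {x y : ParkingLot}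
    (hx : F x.toStrip ≤ 0) (hy : 0 ≤ F y.toStrip) {ε : ℝ} (hε : 0 < ε) :
    ∃ z : ParkingLot, F z.toStrip = 0 ∧ dist x z + dist z y ≤ dist x y + ε := by
  have hlt : lengthDist x.toStrip y.toStrip < ENNReal.ofReal (dist x y + ε) := by
    rw [← ofReal_dist]
    exact (ENNReal.ofReal_lt_ofReal_iff (by positivity)).2 (by linarith)
  obtain ⟨γ, hγ⟩ := iInf_lt_iff.1 hlt
  obtain ⟨τ, hτ⟩ := mem_range_of_exists_le_of_exists_ge (hF.comp γ.continuous)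
    (c := 0) ⟨0, by simpa using hx⟩ ⟨1, by simpa using hy⟩
  let z : ParkingLot := ⟨(γ τ).1.1, (γ τ).1.2, (γ τ).2⟩
  have hz : z.toStrip = γ τ := rfl
  let γ₁ : Path x.toStrip z.toStrip :=
    { toFun := fun s => γ (min s τ)
      continuous_toFun := by fun_prop
      source' := by simp
      target' := by simp [hz, unitInterval.le_one'] }
  let γ₂ : Path z.toStrip y.toStrip :=
    { toFun := fun s => γ (max s τ)
      continuous_toFun := by fun_prop
      source' := by simp [hz]
      target' := by simp [unitInterval.le_one'] }
  refine ⟨z, hτ, ?_⟩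
  have h₁ : lengthDist x.toStrip z.toStrip
      ≤ eVariationOn (fun s : unitInterval => cover (γ s)) (Iic τ) :=
    (iInf_le _ γ₁).trans (eVariationOn.comp_le_of_monotoneOn
      (fun s : unitInterval => cover (γ s)) (fun s => min s τ)
      (fun a _ b _ h => min_le_min_right _ h) (fun a _ => min_le_right a τ))
  have h₂ : lengthDist z.toStrip y.toStrip
      ≤ eVariationOn (fun s : unitInterval => cover (γ s)) (Ici τ) :=
    (iInf_le _ γ₂).trans (eVariationOn.comp_le_of_monotoneOn
      (fun s : unitInterval => cover (γ s)) (fun s => max s τ)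
      (fun a _ b _ h => max_le_max_right _ h) (fun a _ => le_max_right a τ))
  have h₃ : pathLength γ = eVariationOn (fun s : unitInterval => cover (γ s)) (Iic τ)
      + eVariationOn (fun s : unitInterval => cover (γ s)) (Ici τ) := by
    rw [← eVariationOn.union _ (x := τ) isGreatest_Iic isLeast_Ici, Iic_union_Ici]
    rfl
  have h₄ : ENNReal.ofReal (dist x z + dist z y) ≤ ENNReal.ofReal (dist x y + ε) := by
    rw [ENNReal.ofReal_add dist_nonneg dist_nonneg, ofReal_dist, ofReal_dist]
    exact (add_le_add h₁ h₂).trans (h₃ ▸ hγ.le)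
  exact (ENNReal.ofReal_le_ofReal_iff (by positivity)).1 h₄

theorem dist_le_of_path {x y : ParkingLot} (γ : Path x.toStrip y.toStrip) {C : ℝ} (hC : 0 ≤ C)
    (h : ∀ s s' : unitInterval, dist (cover (γ s)) (cover (γ s')) ≤ C * |(s : ℝ) - s'|) :
    dist x y ≤ C := by
  have hL : LipschitzWith C.toNNReal (fun s : unitInterval => cover (γ s)) :=
    LipschitzWith.of_dist_le_mul fun s s' => by
      rw [Real.coe_toNNReal _ hC]; exact h s s'
  have h1 := hL.lipschitzOnWith.comp_eVariationOn_le (s := univ) (t := univ)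
    (g := (id : unitInterval → unitInterval)) (fun _ _ => mem_univ _)
  have h2 : eVariationOn (id : unitInterval → unitInterval) univ ≤ 1 := by
    have hm : MonotoneOn (fun s : unitInterval => (s : ℝ)) univ := fun a _ b _ h => h
    have h3 := hm.eVariationOn_eq (a := 0) (b := 1) (mem_univ _) (mem_univ _)
    have h4 : (univ : Set unitInterval) ∩ Icc 0 1 = univ := by
      ext s; simp [unitInterval.le_one']
    rw [h4] at h3
    exact (show eVariationOn (id : unitInterval → unitInterval) univ
      = eVariationOn (fun s : unitInterval => (s : ℝ)) univ from rfl).trans_le (by simp [h3])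
  rw [← ENNReal.ofReal_le_ofReal_iff hC, ofReal_dist]
  refine (iInf_le _ γ).trans (h1.trans ?_)
  calc _ ≤ (C.toNNReal : ℝ≥0∞) * 1 := by gcongr
    _ = ENNReal.ofReal C := by rw [mul_one]; rfl

/-- Path from `x` to `y` along the circle of the radius of `x`, when the radii agree. -/
theorem dist_le_of_radius_eq {x y : ParkingLot} (h : x.radius = y.radius) :
    dist x y ≤ x.radius * |x.angle - y.angle| := by
  let γ : Path x.toStrip y.toStrip :=
    { toFun := fun s => ⟨(x.angle + s * (y.angle - x.angle), x.radius), x.one_le_radius⟩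
      continuous_toFun := by fun_prop
      source' := by simp [toStrip]
      target' := by simp [toStrip, h] }
  refine dist_le_of_path γ (mul_nonneg x.radius_pos.le (abs_nonneg _)) fun s s' => ?_
  have key : ∀ a b : ℝ, ‖Complex.exp ((a : ℂ) * Complex.I) - Complex.exp ((b : ℂ) * Complex.I)‖
      ≤ |a - b| := fun a b => by
    have h1 : Complex.exp ((a : ℂ) * Complex.I) - Complex.exp ((b : ℂ) * Complex.I)
        = Complex.exp ((b : ℂ) * Complex.I) * (Complex.exp (Complex.I * ((a - b : ℝ) : ℂ)) - 1) := by
      rw [mul_sub, ← Complex.exp_add, mul_one]; push_cast; ring_nf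
    rw [h1, norm_mul, Complex.norm_exp_ofReal_mul_I, one_mul]
    exact Real.norm_exp_I_mul_ofReal_sub_one_le
  have e : cover (γ s) - cover (γ s') = (x.radius : ℂ) *
      (Complex.exp (((x.angle + s * (y.angle - x.angle) : ℝ) : ℂ) * Complex.I)
        - Complex.exp (((x.angle + s' * (y.angle - x.angle) : ℝ) : ℂ) * Complex.I)) := by
    rw [mul_sub]; rfl
  rw [dist_eq_norm, e, norm_mul, Complex.norm_real, Real.norm_of_nonneg x.radius_pos.le, mul_assoc]
  refine mul_le_mul_of_nonneg_left ((key _ _).trans_eq ?_) x.radius_pos.le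
  rw [← abs_mul, ← abs_neg]
  congr 1; ring

/-! ### Half-planes embedded isometrically, tangent lengths and visibility -/

/-- The half-plane beyond the tangent line to the unit circle at the angle `β`. -/
def ofHalfPlane (β : ℝ) (w : ℂ) (hw : 1 ≤ w.re) : ParkingLot :=
  ⟨β + w.arg, ‖w‖, hw.trans (Complex.re_le_norm w)⟩

theorem pos_ofHalfPlane (β : ℝ) (w : ℂ) (hw : 1 ≤ w.re) :
    (ofHalfPlane β w hw).pos = Complex.exp ((β : ℂ) * Complex.I) * w := by
  rw [pos_eq]
  conv_rhs => rw [← Complex.norm_mul_exp_arg_mul_I w]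
  simp only [ofHalfPlane]
  push_cast
  rw [add_mul, Complex.exp_add]; ring

/-- The half-plane is convex, so the straight segment lifts to a path of the right length;
conversely the covering map does not increase distances. -/
theorem dist_ofHalfPlane (β : ℝ) (w w' : ℂ) (hw : 1 ≤ w.re) (hw' : 1 ≤ w'.re) :
    dist (ofHalfPlane β w hw) (ofHalfPlane β w' hw') = dist w w' := by
  apply le_antisymm
  · have hre : ∀ s : unitInterval, 1 ≤ (AffineMap.lineMap w w' (s : ℝ) : ℂ).re := fun s => by
      have h1 := s.2.1
      have h2 := s.2.2
      simp only [AffineMap.lineMap_apply_module, Complex.add_re, Complex.real_smul,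
        Complex.re_ofReal_mul]
      nlinarith
    let γ : Path (ofHalfPlane β w hw).toStrip (ofHalfPlane β w' hw').toStrip :=
      { toFun := fun s => (ofHalfPlane β (AffineMap.lineMap w w' (s : ℝ)) (hre s)).toStrip
        continuous_toFun := by
          have hc : Continuous fun s : unitInterval => (AffineMap.lineMap w w' (s : ℝ) : ℂ) := by
            simp only [AffineMap.lineMap_apply_module]; fun_prop
          refine Continuous.subtype_mk (Continuous.prodMk ?_ hc.norm) _
          refine continuous_const.add (continuous_iff_continuousAt.2 fun s => ?_)
          exact (Complex.continuousAt_arg (Or.inl (by linarith [hre s]))).comp hc.continuousAt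
        source' := by simp
        target' := by simp }
    refine dist_le_of_path γ dist_nonneg fun s s' => ?_
    have e : ∀ s, cover (γ s) = Complex.exp ((β : ℂ) * Complex.I) * AffineMap.lineMap w w' (s : ℝ) :=
      fun s => pos_ofHalfPlane β _ (hre s)
    rw [e, e, dist_eq_norm, ← mul_sub, norm_mul, Complex.norm_exp_ofReal_mul_I, one_mul,
      ← dist_eq_norm, dist_lineMap_lineMap, mul_comm, Real.dist_eq]
  · refine le_trans ?_ (dist_pos_le _ _)
    rw [pos_ofHalfPlane, pos_ofHalfPlane, dist_eq_norm, dist_eq_norm, ← mul_sub, norm_mul,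
      Complex.norm_exp_ofReal_mul_I, one_mul]

/-- The length of the tangent segments from `x` to the unit circle. -/
def tlen (x : ParkingLot) : ℝ := √(x.radius ^ 2 - 1)

/-- Half the angle under which the tangent points from `x` to the unit circle are seen from the
centre. -/
def tang (x : ParkingLot) : ℝ := Real.arctan x.tlen

theorem tlen_nonneg (x : ParkingLot) : 0 ≤ x.tlen := Real.sqrt_nonneg _

theorem tlen_sq (x : ParkingLot) : x.tlen ^ 2 = x.radius ^ 2 - 1 :=
  Real.sq_sqrt (by nlinarith [x.one_le_radius])

theorem sqrt_one_add_tlen_sq (x : ParkingLot) : √(1 + x.tlen ^ 2) = x.radius := by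
  rw [tlen_sq, add_sub_cancel, Real.sqrt_sq x.radius_pos.le]

theorem tang_nonneg (x : ParkingLot) : 0 ≤ x.tang := Real.arctan_nonneg.2 x.tlen_nonneg

theorem tang_lt (x : ParkingLot) : x.tang < Real.pi / 2 := Real.arctan_lt_pi_div_two _

theorem radius_mul_cos_tang (x : ParkingLot) : x.radius * Real.cos x.tang = 1 := by
  rw [tang, Real.cos_arctan, sqrt_one_add_tlen_sq, mul_one_div_cancel x.radius_pos.ne']

theorem radius_mul_sin_tang (x : ParkingLot) : x.radius * Real.sin x.tang = x.tlen := by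
  rw [tang, Real.sin_arctan, sqrt_one_add_tlen_sq, mul_div_cancel₀ _ x.radius_pos.ne']

theorem radius_mul_exp_tang (x : ParkingLot) :
    (x.radius : ℂ) * Complex.exp ((x.tang : ℂ) * Complex.I) = 1 + x.tlen * Complex.I := by
  rw [Complex.exp_mul_I, ← Complex.ofReal_cos, ← Complex.ofReal_sin, mul_add, ← mul_assoc,
    ← Complex.ofReal_mul, ← Complex.ofReal_mul, radius_mul_cos_tang, radius_mul_sin_tang,
    Complex.ofReal_one]

theorem radius_mul_exp_neg_tang (x : ParkingLot) :
    (x.radius : ℂ) * Complex.exp (-(x.tang : ℂ) * Complex.I) = 1 - x.tlen * Complex.I := by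
  rw [Complex.exp_mul_I, Complex.cos_neg, Complex.sin_neg, ← Complex.ofReal_cos,
    ← Complex.ofReal_sin, mul_add, ← mul_assoc, mul_neg, neg_mul,
    ← Complex.ofReal_mul, ← Complex.ofReal_mul, radius_mul_cos_tang, radius_mul_sin_tang,
    Complex.ofReal_one, sub_eq_add_neg]

theorem one_le_radius_mul_cos {x : ParkingLot} {β : ℝ} (h : |x.angle - β| ≤ x.tang) :
    1 ≤ x.radius * Real.cos (x.angle - β) := by
  rw [← x.radius_mul_cos_tang, ← Real.cos_abs (x.angle - β)]
  exact mul_le_mul_of_nonneg_left (Real.cos_le_cos_of_nonneg_of_le_pi (abs_nonneg _)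
    (by linarith [x.tang_lt, Real.pi_pos]) h) x.radius_pos.le

theorem re_radius_mul_exp (r θ : ℝ) :
    ((r : ℂ) * Complex.exp ((θ : ℂ) * Complex.I)).re = r * Real.cos θ := by
  rw [Complex.re_ofReal_mul, Complex.exp_ofReal_mul_I_re]

theorem eq_ofHalfPlane {x : ParkingLot} {β : ℝ} (h : |x.angle - β| ≤ x.tang) :
    ∃ hw, x = ofHalfPlane β ((x.radius : ℂ) * Complex.exp (((x.angle - β : ℝ) : ℂ) * Complex.I))
      hw := by
  refine ⟨by rw [re_radius_mul_exp]; exact one_le_radius_mul_cos h, ?_⟩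
  have h1 := abs_le.1 h
  have h2 := x.tang_lt
  have h3 := Real.pi_pos
  ext
  · simp only [ofHalfPlane]
    rw [Complex.exp_mul_I, Complex.arg_mul_cos_add_sin_mul_I x.radius_pos
      ⟨by linarith, by linarith⟩]
    ring
  · simp only [ofHalfPlane]
    rw [norm_mul, Complex.norm_exp_ofReal_mul_I, mul_one, Complex.norm_real,
      Real.norm_of_nonneg x.radius_pos.le]

/-- The tangent of the angular offset is `w.im / w.re`, and `1 ≤ w.re` makes its square at most `‖w‖
^ 2 - 1`, the square of the tangent length. With `eq_ofHalfPlane` this identifies the half-plane at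
`β` with the set `|angle - β| ≤ tang`. -/
theorem abs_angle_sub_le_tang_ofHalfPlane (β : ℝ) (w : ℂ) (hw : 1 ≤ w.re) :
    |(ofHalfPlane β w hw).angle - β| ≤ (ofHalfPlane β w hw).tang := by
  have h0 : 0 < w.re := by linarith
  have h1 : (ofHalfPlane β w hw).angle - β = Real.arctan (w.im / w.re) := by
    simp only [ofHalfPlane, add_sub_cancel_left]
    rw [← Complex.tan_arg, Real.arctan_tan]
    · linarith [(abs_lt.1 (Complex.abs_arg_lt_pi_div_two_iff.2 (Or.inl h0))).1]
    · exact (abs_lt.1 (Complex.abs_arg_lt_pi_div_two_iff.2 (Or.inl h0))).2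
  have h2 : |w.im / w.re| ≤ (ofHalfPlane β w hw).tlen := by
    apply Real.abs_le_sqrt
    rw [div_pow, div_le_iff₀ (by positivity)]
    simp only [ofHalfPlane]
    rw [Complex.sq_norm, Complex.normSq_apply]
    nlinarith [mul_nonneg (by nlinarith : 0 ≤ w.re ^ 2 - 1) (sq_nonneg w.re),
      mul_nonneg (by nlinarith : 0 ≤ w.re ^ 2 - 1) (sq_nonneg w.im)]
  rw [h1, tang]
  have h3 := abs_le.1 h2
  rw [abs_le, ← Real.arctan_neg]
  exact ⟨Real.arctan_mono h3.1, Real.arctan_mono h3.2⟩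

theorem dist_eq_of_halfPlane {x y : ParkingLot} {β : ℝ} (hx : |x.angle - β| ≤ x.tang)
    (hy : |y.angle - β| ≤ y.tang) : dist x y = dist x.pos y.pos := by
  obtain ⟨hw, hx'⟩ := eq_ofHalfPlane hx
  obtain ⟨hw', hy'⟩ := eq_ofHalfPlane hy
  rw [hx', hy', dist_ofHalfPlane, pos_ofHalfPlane, pos_ofHalfPlane, dist_eq_norm, dist_eq_norm,
    ← mul_sub, norm_mul, Complex.norm_exp_ofReal_mul_I, one_mul]

/-- The intervals of radius `tang` around the two angles overlap, and any common point serves as the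
direction of the half-plane. -/
theorem exists_halfPlane {x y : ParkingLot} (h : |y.angle - x.angle| ≤ x.tang + y.tang) :
    ∃ β, |x.angle - β| ≤ x.tang ∧ |y.angle - β| ≤ y.tang := by
  have hx := x.tang_nonneg
  have hy := y.tang_nonneg
  obtain ⟨h1, h2⟩ := abs_le.1 h
  refine ⟨max (x.angle - x.tang) (y.angle - y.tang), abs_le.2 ⟨?_, ?_⟩, abs_le.2 ⟨?_, ?_⟩⟩
  · rw [neg_le_sub_iff_le_add]; exact max_le (by linarith) (by linarith)
  · linarith [le_max_left (x.angle - x.tang) (y.angle - y.tang)]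
  · rw [neg_le_sub_iff_le_add]; exact max_le (by linarith) (by linarith)
  · linarith [le_max_right (x.angle - x.tang) (y.angle - y.tang)]

theorem dist_eq_of_visible {x y : ParkingLot} (h : |y.angle - x.angle| ≤ x.tang + y.tang) :
    dist x y = dist x.pos y.pos := by
  obtain ⟨β, h1, h2⟩ := exists_halfPlane h
  exact dist_eq_of_halfPlane h1 h2

theorem dist_eq_of_angle_eq {x y : ParkingLot} (h : x.angle = y.angle) :
    dist x y = |x.radius - y.radius| := by
  rw [dist_eq_of_visible (by rw [h, sub_self, abs_zero]; linarith [x.tang_nonneg, y.tang_nonneg]),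
    pos_eq, pos_eq, h, dist_eq_norm, ← sub_mul, norm_mul, Complex.norm_exp_ofReal_mul_I, mul_one,
    ← Complex.ofReal_sub, Complex.norm_real, Real.norm_eq_abs]

/-! ### Lower bounds for lengths, and points in each other's shadow -/

theorem sq_dist_pos (x y : ParkingLot) : dist x.pos y.pos ^ 2 =
    (x.radius - y.radius) ^ 2 + 4 * x.radius * y.radius * Real.sin ((x.angle - y.angle) / 2) ^ 2 := by
  rw [dist_eq_norm, Complex.sq_norm, Complex.normSq_apply, pos_eq, pos_eq]
  simp only [Complex.sub_re, Complex.sub_im, Complex.re_ofReal_mul, Complex.im_ofReal_mul,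
    Complex.exp_ofReal_mul_I_re, Complex.exp_ofReal_mul_I_im]
  have h1 : Real.cos (x.angle - y.angle) = 1 - 2 * Real.sin ((x.angle - y.angle) / 2) ^ 2 := by
    rw [Real.sin_sq_eq_half_sub, mul_div_cancel₀ _ two_ne_zero]; ring
  rw [Real.cos_sub] at h1
  linear_combination x.radius ^ 2 * Real.sin_sq_add_cos_sq x.angle
    + y.radius ^ 2 * Real.sin_sq_add_cos_sq y.angle - 2 * x.radius * y.radius * h1

theorem two_mul_sin_le_dist (x y : ParkingLot) :
    2 * Real.sin (|x.angle - y.angle| / 2) ≤ dist x y := by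
  refine le_trans ?_ (dist_pos_le x y)
  apply le_of_sq_le_sq _ dist_nonneg
  rw [sq_dist_pos, mul_pow]
  have h1 : Real.sin (|x.angle - y.angle| / 2) ^ 2 = Real.sin ((x.angle - y.angle) / 2) ^ 2 := by
    rcases abs_cases (x.angle - y.angle) with ⟨h, -⟩ | ⟨h, -⟩ <;> rw [h]
    rw [neg_div, Real.sin_neg, neg_sq]
  rw [h1]
  have hx := x.one_le_radius
  have hy := y.one_le_radius
  have h2 : 1 ≤ x.radius * y.radius := by nlinarith
  nlinarith [sq_nonneg (x.radius - y.radius), sq_nonneg (Real.sin ((x.angle - y.angle) / 2))]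

/-- Outside the unit disc a chord over the angle `D` has length at least `2 sin (D / 2)`. Bisecting
the angle `n` times along almost shortest paths improves this to `2 ^ n * (2 sin (D / 2 ^ (n +
1)))`, which tends to `D`. -/
theorem abs_angle_sub_le (x y : ParkingLot) : |x.angle - y.angle| ≤ dist x y := by
  have key : ∀ n : ℕ, ∀ x y : ParkingLot, x.angle ≤ y.angle →
      2 ^ n * (2 * Real.sin ((y.angle - x.angle) / 2 ^ n / 2)) ≤ dist x y := by
    intro n
    induction n with
    | zero =>
      intro x y h
      have := two_mul_sin_le_dist x y
      rw [abs_sub_comm, abs_of_nonneg (by linarith)] at this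
      simpa using this
    | succ n ih =>
      intro x y h
      refine le_of_forall_pos_le_add fun ε hε => ?_
      obtain ⟨z, hz, hd⟩ := exists_crossing
        (F := fun p : Strip => p.1.1 - (x.angle + y.angle) / 2) (by fun_prop) (x := x) (y := y)
        (by simp only [toStrip]; linarith) (by simp only [toStrip]; linarith) hε
      have hz' : z.angle = (x.angle + y.angle) / 2 := by
        simp only [toStrip] at hz; linarith
      have h1 := ih x z (by linarith)
      have h2 := ih z y (by linarith)
      have e1 : (z.angle - x.angle) / 2 ^ n / 2 = (y.angle - x.angle) / 2 ^ (n + 1) / 2 := by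
        rw [hz', pow_succ]; field_simp; ring
      have e2 : (y.angle - z.angle) / 2 ^ n / 2 = (y.angle - x.angle) / 2 ^ (n + 1) / 2 := by
        rw [hz', pow_succ]; field_simp; ring
      rw [e1] at h1
      rw [e2] at h2
      have e3 : (2 : ℝ) ^ (n + 1) * (2 * Real.sin ((y.angle - x.angle) / 2 ^ (n + 1) / 2))
          = 2 * (2 ^ n * (2 * Real.sin ((y.angle - x.angle) / 2 ^ (n + 1) / 2))) := by ring
      linarith
  wlog h : x.angle ≤ y.angle generalizing x y
  · rw [abs_sub_comm, dist_comm]; exact this y x (by linarith)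
  rw [abs_sub_comm, abs_of_nonneg (by linarith)]
  set D := y.angle - x.angle with hD
  have hD0 : 0 ≤ D := by linarith
  -- The cubic bound for the sine gives the error `D ^ 3 / 24 * (1 / 4) ^ n`, weakened to `(1 / 2) ^
  -- n`.
  have hlim : Filter.Tendsto (fun n : ℕ => D - D ^ 3 / 24 * (1 / 2) ^ n) Filter.atTop (nhds D) := by
    have := (tendsto_pow_atTop_nhds_zero_of_lt_one (r := (1 / 2 : ℝ)) (by norm_num)
      (by norm_num)).const_mul (D ^ 3 / 24)
    simpa using this.const_sub D
  refine le_of_tendsto hlim ?_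
  refine Filter.Eventually.of_forall fun n => ?_
  refine le_trans ?_ (key n x y h)
  rw [← hD]
  have h2n : (0 : ℝ) < 2 ^ n := by positivity
  have hu0 : 0 ≤ D / 2 ^ n / 2 := by positivity
  have hs : D / 2 ^ n / 2 - (D / 2 ^ n / 2) ^ 3 / 6 ≤ Real.sin (D / 2 ^ n / 2) := by
    rcases hu0.eq_or_lt with h0 | h0
    · rw [← h0]; simp
    · exact (Real.sin_gt_sub_cube h0).le
  calc D - D ^ 3 / 24 * (1 / 2) ^ n ≤ D - D ^ 3 / 24 * ((1 / 2) ^ n) ^ 2 := by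
        have : ((1 / 2 : ℝ) ^ n) ^ 2 ≤ (1 / 2) ^ n := by
          have : ((1 / 2 : ℝ) ^ n) ≤ 1 := pow_le_one₀ (by norm_num) (by norm_num)
          nlinarith [pow_nonneg (by norm_num : (0:ℝ) ≤ 1 / 2) n]
        nlinarith [pow_nonneg hD0 3]
    _ = 2 ^ n * (2 * (D / 2 ^ n / 2 - (D / 2 ^ n / 2) ^ 3 / 6)) := by
        rw [one_div, inv_pow]; field_simp; ring
    _ ≤ _ := by gcongr

/-- The point of the unit circle with angle `T`. -/
def circ (T : ℝ) : ParkingLot := ⟨T, 1, le_rfl⟩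

@[simp] theorem circ_tlen (T : ℝ) : (circ T).tlen = 0 := by simp [tlen, circ]

@[simp] theorem circ_tang (T : ℝ) : (circ T).tang = 0 := by simp [tang]

@[simp] theorem circ_angle (T : ℝ) : (circ T).angle = T := rfl

theorem dist_circ (S T : ℝ) : dist (circ S) (circ T) = |S - T| := by
  refine le_antisymm ?_ (abs_angle_sub_le (circ S) (circ T))
  simpa [circ] using dist_le_of_radius_eq (x := circ S) (y := circ T) rfl

theorem pos_eq_exp_add (x : ParkingLot) :
    x.pos = Complex.exp (((x.angle + x.tang : ℝ) : ℂ) * Complex.I) * (1 - x.tlen * Complex.I) := by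
  rw [← radius_mul_exp_neg_tang, pos_eq, mul_left_comm, ← Complex.exp_add]
  congr 2; push_cast; ring

theorem pos_eq_exp_sub (x : ParkingLot) :
    x.pos = Complex.exp (((x.angle - x.tang : ℝ) : ℂ) * Complex.I) * (1 + x.tlen * Complex.I) := by
  rw [← radius_mul_exp_tang, pos_eq, mul_left_comm, ← Complex.exp_add]
  congr 2; push_cast; ring

theorem dist_circ_angle_add_tang (x : ParkingLot) :
    dist x (circ (x.angle + x.tang)) = x.tlen := by
  rw [dist_eq_of_visible (by simp [abs_of_nonneg x.tang_nonneg]), pos_eq_exp_add,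
    pos_eq_exp_add (circ _)]
  rw [circ_angle, circ_tang, circ_tlen, add_zero, dist_eq_norm, ← mul_sub, norm_mul,
    Complex.norm_exp_ofReal_mul_I]
  simp [abs_of_nonneg x.tlen_nonneg]

theorem dist_circ_angle_sub_tang (x : ParkingLot) :
    dist x (circ (x.angle - x.tang)) = x.tlen := by
  rw [dist_eq_of_visible (by simp [abs_of_nonneg x.tang_nonneg]), pos_eq_exp_sub,
    pos_eq_exp_sub (circ _)]
  rw [circ_angle, circ_tang, circ_tlen, sub_zero, dist_eq_norm, ← mul_sub, norm_mul,
    Complex.norm_exp_ofReal_mul_I]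
  simp [abs_of_nonneg x.tlen_nonneg]

/-- The tangent from `x` meets the radial line through the tangent point at a right angle, so the
tangent point is the closest point of that line to `x`. -/
theorem tlen_le_dist_of_angle_eq {x z : ParkingLot} (h : |z.angle - x.angle| = x.tang) :
    x.tlen ≤ dist x z := by
  refine le_trans ?_ (dist_pos_le x z)
  apply le_of_sq_le_sq _ dist_nonneg
  rw [sq_dist_pos, tlen_sq]
  have h1 : Real.cos (x.angle - z.angle) = 1 - 2 * Real.sin ((x.angle - z.angle) / 2) ^ 2 := by
    rw [Real.sin_sq_eq_half_sub, mul_div_cancel₀ _ two_ne_zero]; ring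
  have h2 : x.radius * Real.cos (x.angle - z.angle) = 1 := by
    rw [← Real.cos_abs, abs_sub_comm, h, radius_mul_cos_tang]
  rw [h1] at h2
  linear_combination sq_nonneg (z.radius - 1) + 2 * z.radius * h2

/-- The distance between points which do not see each other. -/
theorem dist_eq_of_shadow {x y : ParkingLot} (h : x.tang + y.tang ≤ y.angle - x.angle) :
    dist x y = x.tlen + y.tlen + (y.angle - x.angle - x.tang - y.tang) := by
  have hx := x.tang_nonneg
  have hy := y.tang_nonneg
  apply le_antisymm
  · have h1 := dist_triangle4 x (circ (x.angle + x.tang)) (circ (y.angle - y.tang)) y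
    rw [dist_circ_angle_add_tang, dist_circ, dist_comm (circ _) y, dist_circ_angle_sub_tang,
      abs_sub_comm, abs_of_nonneg (by linarith)] at h1
    linarith
  · refine le_of_forall_pos_le_add fun ε hε => ?_
    obtain ⟨z, hz, hd⟩ := exists_crossing
      (F := fun p : Strip => p.1.1 - (x.angle + x.tang)) (by fun_prop) (x := x) (y := y)
      (by simp only [toStrip]; linarith) (by simp only [toStrip]; linarith) (half_pos hε)
    have hz' : z.angle = x.angle + x.tang := by simp only [toStrip] at hz; linarith
    obtain ⟨z₂, hz₂, hd₂⟩ := exists_crossing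
      (F := fun p : Strip => p.1.1 - (y.angle - y.tang)) (by fun_prop) (x := z) (y := y)
      (by simp only [toStrip]; linarith) (by simp only [toStrip]; linarith) (half_pos hε)
    have hz₂' : z₂.angle = y.angle - y.tang := by simp only [toStrip] at hz₂; linarith
    have h1 := tlen_le_dist_of_angle_eq (x := x) (z := z)
      (by rw [hz', add_sub_cancel_left, abs_of_nonneg hx])
    have h2 := tlen_le_dist_of_angle_eq (x := y) (z := z₂)
      (by rw [hz₂', sub_sub_cancel_left, abs_neg, abs_of_nonneg hy])
    have h3 := (le_abs_self _).trans (abs_angle_sub_le z₂ z)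
    rw [dist_comm z₂] at h3
    rw [dist_comm y] at h2
    linarith

/-- This is the bottleneck of the parking lot: since `tang` is always below `π / 2`, neither point
sees past the angle `T`, and the shadow formula for the distance is additive there. -/
theorem dist_add_circ {x y : ParkingLot} {T : ℝ} (hx : x.angle + Real.pi / 2 ≤ T)
    (hy : T + Real.pi / 2 ≤ y.angle) : dist x (circ T) + dist (circ T) y = dist x y := by
  have h1 := x.tang_lt
  have h2 := y.tang_lt
  rw [dist_eq_of_shadow (y := y) (x := x) (by linarith),
    dist_eq_of_shadow (x := x) (y := circ T) (by simp; linarith),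
    dist_eq_of_shadow (x := circ T) (y := y) (by simp; linarith)]
  simp; ring

end ParkingLot

/-! ## Logarithm maps and the CAT(0) inequality -/

/-- The Bruhat–Tits inequality at all points of geodesics. -/
def CN (X : Type*) [MetricSpace X] : Prop :=
  ∀ (x y z p : X) (s : ℝ), s ∈ Icc (0 : ℝ) 1 → dist x z = s * dist x y →
    dist z y = (1 - s) * dist x y →
    dist p z ^ 2 ≤ (1 - s) * dist p x ^ 2 + s * dist p y ^ 2 - s * (1 - s) * dist x y ^ 2

/-- `L` is a non-expanding map to the plane which preserves the distance to `z` and the distance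
between `x` and `y`. -/
def IsLogMap {X : Type*} [MetricSpace X] (L : X → ℂ) (x z y : X) : Prop :=
  (∀ u v, dist (L u) (L v) ≤ dist u v) ∧ (∀ u, ‖L u‖ = dist z u) ∧ dist (L x) (L y) = dist x y

/-- Every point between `x` and `y` has a logarithm map adapted to `x` and `y`. -/
def HasLogMaps (X : Type*) [MetricSpace X] : Prop :=
  ∀ x z y : X, dist x z + dist z y = dist x y → ∃ L : X → ℂ, IsLogMap L x z y

theorem stewart (P A B : ℂ) (s : ℝ) :
    ‖P - ((1 - s) • A + s • B)‖ ^ 2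
      = (1 - s) * ‖P - A‖ ^ 2 + s * ‖P - B‖ ^ 2 - s * (1 - s) * ‖A - B‖ ^ 2 := by
  simp only [Complex.sq_norm, Complex.normSq_apply, Complex.sub_re, Complex.sub_im, Complex.add_re,
    Complex.add_im, Complex.real_smul, Complex.re_ofReal_mul, Complex.im_ofReal_mul]
  ring

/-- The distances among the images of `x`, `z`, `y` are those of a degenerate triangle, so the
origin, which is the image of `z`, is the point dividing the segment from `L x` to `L y` in the
ratio given by `s`. Stewart's identity for `L p` is exact; `‖L p‖` is the true distance from `p` to
`z`, while the distances to `L x` and `L y` have only become smaller. -/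
theorem IsLogMap.cn {X : Type*} [MetricSpace X] {L : X → ℂ} {x y z : X} (hL : IsLogMap L x z y)
    (p : X) {s : ℝ} (hs : s ∈ Icc (0 : ℝ) 1) (h1 : dist x z = s * dist x y)
    (h2 : dist z y = (1 - s) * dist x y) :
    dist p z ^ 2 ≤ (1 - s) * dist p x ^ 2 + s * dist p y ^ 2 - s * (1 - s) * dist x y ^ 2 := by
  obtain ⟨hL1, hL2, hL3⟩ := hL
  have e0 := stewart 0 (L x) (L y) s
  have e1 := stewart (L p) (L x) (L y) s
  rw [← dist_eq_norm (L x), hL3] at e0 e1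
  rw [zero_sub, zero_sub, zero_sub, norm_neg, norm_neg, norm_neg, hL2, hL2, dist_comm z x, h1, h2] at e0
  have e2 : (1 - s) • L x + s • L y = 0 := by
    rw [← norm_eq_zero, ← sq_eq_zero_iff, e0]; ring
  rw [e2, sub_zero, hL2, dist_comm, ← dist_eq_norm, ← dist_eq_norm] at e1
  rw [e1]
  have a1 := pow_le_pow_left₀ dist_nonneg (hL1 p x) 2
  have a2 := pow_le_pow_left₀ dist_nonneg (hL1 p y) 2
  have b1 := mul_le_mul_of_nonneg_left a1 (sub_nonneg.2 hs.2)
  have b2 := mul_le_mul_of_nonneg_left a2 hs.1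
  linarith

theorem HasLogMaps.cn {X : Type*} [MetricSpace X] (h : HasLogMaps X) : CN X := by
  intro x y z p s hs h1 h2
  obtain ⟨L, hL⟩ := h x z y (by rw [h1, h2]; ring)
  exact hL.cn p hs h1 h2

/-- Apply the inequality to the point `c s` against the side `c'`, and to the vertex `r` against the
side `c`. In the comparison triangle both are equalities, so the combined bound is the squared
comparison distance. -/
theorem CN.isCAT0 {X : Type*} [MetricSpace X] (h : CN X)
    (hg : ∀ x y : X, ∃ c : ℝ → X, IsGeodesicFromTo c x y) : IsCAT0 X := by
  refine ⟨hg, fun p q r c c' hc hc' p' q' r' h1 h2 h3 s hs t ht => ?_⟩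
  have key : ∀ {a b : X} {γ : ℝ → X}, IsGeodesicFromTo γ a b → ∀ u ∈ Icc (0 : ℝ) 1, ∀ z : X,
      dist z (γ u) ^ 2 ≤ (1 - u) * dist z a ^ 2 + u * dist z b ^ 2 - u * (1 - u) * dist a b ^ 2 := by
    intro a b γ hγ u hu z
    obtain ⟨g0, g1, g⟩ := hγ
    refine h a b (γ u) z u hu ?_ ?_
    · rw [← g0, g 0 (by simp) u hu, zero_sub, abs_neg, abs_of_nonneg hu.1, g0]
    · conv_lhs => rw [← g1]
      rw [g u hu 1 (by simp), abs_sub_comm, abs_of_nonneg (by linarith [hu.2])]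
  have a1 := key hc' t ht (c s)
  have a2 := key hc s hs r
  have a3 : dist (c s) p = s * dist p q := by
    obtain ⟨g0, g1, g⟩ := hc
    conv_lhs => rw [← g0]
    rw [g s hs 0 (by simp), sub_zero, abs_of_nonneg hs.1]
  have e1 : dist (AffineMap.lineMap p' q' s : EuclideanSpace ℝ (Fin 2)) (AffineMap.lineMap p' r' t) ^ 2
      = (1 - t) * (s * dist p q) ^ 2 + t * ((1 - s) * dist p r ^ 2 + s * dist q r ^ 2
        - s * (1 - s) * dist p q ^ 2) - t * (1 - t) * dist p r ^ 2 := by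
    rw [← h1, ← h2, ← h3]
    simp only [EuclideanSpace.dist_eq, Fin.sum_univ_two, Real.dist_eq, sq_abs,
      AffineMap.lineMap_apply_module, PiLp.add_apply, PiLp.smul_apply, smul_eq_mul, mul_pow]
    rw [Real.sq_sqrt (by positivity), Real.sq_sqrt (by positivity), Real.sq_sqrt (by positivity),
      Real.sq_sqrt (by positivity)]
    ring
  apply le_of_sq_le_sq _ dist_nonneg
  rw [e1]
  rw [a3] at a1
  rw [dist_comm r (c s), dist_comm r p, dist_comm r q] at a2
  have := mul_le_mul_of_nonneg_left a2 ht.1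
  linarith

/-- In a space with the Bruhat–Tits inequality a point between `x` and `y` is determined by its
distances to `x` and `y`. -/
theorem CN.eq_of_dist {X : Type*} [MetricSpace X] (h : CN X) {x y z z' : X} {s : ℝ}
    (hs : s ∈ Icc (0 : ℝ) 1) (h1 : dist x z = s * dist x y) (h2 : dist z y = (1 - s) * dist x y)
    (h1' : dist x z' = s * dist x y) (h2' : dist z' y = (1 - s) * dist x y) : z = z' := by
  have := h x y z' z s hs h1' h2'
  rw [dist_comm z x, h1, h2] at this
  have h0 : dist z z' ^ 2 ≤ 0 := this.trans (by nlinarith)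
  exact dist_eq_zero.1 (pow_eq_zero_iff two_ne_zero |>.1 (le_antisymm h0 (sq_nonneg _)))

theorem CN.eq_of_between {X : Type*} [MetricSpace X] (h : CN X) {x y z z' : X}
    (hz : dist x z + dist z y = dist x y) (hz' : dist x z' + dist z' y = dist x y)
    (e : dist x z = dist x z') : z = z' := by
  rcases eq_or_ne (dist x y) 0 with h0 | h0
  · have a1 := dist_nonneg (x := x) (y := z)
    have a2 := dist_nonneg (x := z) (y := y)
    have a3 := dist_nonneg (x := z') (y := y)
    have e1 : x = z := dist_eq_zero.1 (by linarith)
    have e2 : x = z' := dist_eq_zero.1 (by linarith)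
    rw [← e1, ← e2]
  · have hp : 0 < dist x y := lt_of_le_of_ne dist_nonneg (Ne.symm h0)
    refine h.eq_of_dist (x := x) (y := y) (s := dist x z / dist x y) ⟨by positivity, ?_⟩ ?_ ?_ ?_ ?_
    · rw [div_le_one hp]; linarith [dist_nonneg (x := z) (y := y)]
    · field_simp
    · field_simp; linarith
    · rw [← e]; field_simp
    · field_simp; linarith

/-! ### The logarithm map of the parking lot and its geodesics -/

namespace ParkingLot

/-- The logarithm map at `z`: the tangent vector at `z` of length `dist z y` pointing to `y`,
in the frame where the radial direction is real. -/
def logAt (z y : ParkingLot) : ℂ :=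
  if |y.angle - z.angle| ≤ z.tang + y.tang then
    Complex.exp (-(z.angle : ℂ) * Complex.I) * (y.pos - z.pos)
  else if z.angle < y.angle then
    dist z y * (Complex.I * Complex.exp ((z.tang : ℂ) * Complex.I))
  else -(dist z y * (Complex.I * Complex.exp (-(z.tang : ℂ) * Complex.I)))

theorem norm_exp_neg (t : ℝ) : ‖Complex.exp (-(t : ℂ) * Complex.I)‖ = 1 := by
  rw [← Complex.ofReal_neg, Complex.norm_exp_ofReal_mul_I]

theorem logAt_visible {z y : ParkingLot} (h : |y.angle - z.angle| ≤ z.tang + y.tang) :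
    logAt z y = Complex.exp (-(z.angle : ℂ) * Complex.I) * (y.pos - z.pos) := if_pos h

theorem logAt_tangent_pos {z y : ParkingLot} (h : z.angle + z.tang = y.angle + y.tang) :
    logAt z y = ((z.tlen - y.tlen : ℝ) : ℂ) *
      (Complex.I * Complex.exp ((z.tang : ℂ) * Complex.I)) := by
  have h1 := z.tang_nonneg
  have h2 := y.tang_nonneg
  rw [logAt_visible (abs_le.2 ⟨by linarith, by linarith⟩), pos_eq_exp_add, pos_eq_exp_add z, h,
    ← mul_sub, ← mul_assoc, ← Complex.exp_add, ← h,
    show -(z.angle : ℂ) * Complex.I + ((z.angle + z.tang : ℝ) : ℂ) * Complex.I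
      = (z.tang : ℂ) * Complex.I by push_cast; ring]
  push_cast; ring

theorem logAt_tangent_neg {z y : ParkingLot} (h : z.angle - z.tang = y.angle - y.tang) :
    logAt z y = ((y.tlen - z.tlen : ℝ) : ℂ) *
      (Complex.I * Complex.exp (-(z.tang : ℂ) * Complex.I)) := by
  have h1 := z.tang_nonneg
  have h2 := y.tang_nonneg
  rw [logAt_visible (abs_le.2 ⟨by linarith, by linarith⟩), pos_eq_exp_sub, pos_eq_exp_sub z, h,
    ← mul_sub, ← mul_assoc, ← Complex.exp_add, ← h,
    show -(z.angle : ℂ) * Complex.I + ((z.angle - z.tang : ℝ) : ℂ) * Complex.I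
      = -(z.tang : ℂ) * Complex.I by push_cast; ring]
  push_cast; ring

theorem logAt_shadow_pos {z y : ParkingLot} (h : z.tang + y.tang ≤ y.angle - z.angle) :
    logAt z y = dist z y * (Complex.I * Complex.exp ((z.tang : ℂ) * Complex.I)) := by
  have h1 := z.tang_nonneg
  have h2 := y.tang_nonneg
  -- On the boundary of the visible region `logAt` is given by the visible branch. The two formulas
  -- agree there because `y` lies on the tangent line from `z`.
  rcases h.eq_or_lt with h' | h'
  · rw [logAt_visible (by rw [abs_of_nonneg (by linarith)]; linarith), pos_eq_exp_sub,
      pos_eq_exp_add z, dist_eq_of_shadow h,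
      show y.angle - y.tang = z.angle + z.tang by linarith,
      show y.angle - z.angle - z.tang - y.tang = 0 by linarith,
      ← mul_sub, ← mul_assoc, ← Complex.exp_add,
      show -(z.angle : ℂ) * Complex.I + ((z.angle + z.tang : ℝ) : ℂ) * Complex.I
        = (z.tang : ℂ) * Complex.I by push_cast; ring]
    push_cast; ring
  · rw [logAt, if_neg (by rw [abs_of_nonneg (by linarith)]; linarith), if_pos (by linarith)]

theorem logAt_shadow_neg {z y : ParkingLot} (h : z.tang + y.tang ≤ z.angle - y.angle) :
    logAt z y = -(dist z y * (Complex.I * Complex.exp (-(z.tang : ℂ) * Complex.I))) := by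
  have h1 := z.tang_nonneg
  have h2 := y.tang_nonneg
  rcases h.eq_or_lt with h' | h'
  · rw [logAt_visible (by rw [abs_of_nonpos (by linarith)]; linarith), pos_eq_exp_add,
      pos_eq_exp_sub z, dist_comm, dist_eq_of_shadow (x := y) (y := z) (by linarith),
      show y.angle + y.tang = z.angle - z.tang by linarith,
      show z.angle - y.angle - y.tang - z.tang = 0 by linarith,
      ← mul_sub, ← mul_assoc, ← Complex.exp_add,
      show -(z.angle : ℂ) * Complex.I + ((z.angle - z.tang : ℝ) : ℂ) * Complex.I
        = -(z.tang : ℂ) * Complex.I by push_cast; ring]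
    push_cast; ring
  · rw [logAt, if_neg (by rw [abs_of_nonpos (by linarith)]; linarith), if_neg (by linarith)]

theorem norm_logAt (z y : ParkingLot) : ‖logAt z y‖ = dist z y := by
  unfold logAt
  split_ifs with h1 h2
  · rw [norm_mul, norm_exp_neg, one_mul, ← dist_eq_norm, dist_eq_of_visible h1, dist_comm]
  · simp
  · rw [norm_neg, norm_mul, norm_mul, norm_exp_neg]; simp

theorem dist_logAt_le_of_visible {z u v : ParkingLot} (hu : |u.angle - z.angle| ≤ z.tang + u.tang)
    (hv : |v.angle - z.angle| ≤ z.tang + v.tang) : dist (logAt z u) (logAt z v) = dist u.pos v.pos := by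
  rw [logAt_visible hu, logAt_visible hv, dist_eq_norm, ← mul_sub, norm_mul, norm_exp_neg, one_mul,
    dist_eq_norm, sub_sub_sub_cancel_right]

theorem dist_mul_le {z u v : ParkingLot} {τ : ℂ} (hτ : ‖τ‖ = 1) (hu : logAt z u = dist z u * τ)
    (hv : logAt z v = dist z v * τ) : dist (logAt z u) (logAt z v) ≤ dist u v := by
  rw [hu, hv, dist_eq_norm, ← sub_mul, norm_mul, hτ, mul_one, ← Complex.ofReal_sub, Complex.norm_real,
    Real.norm_eq_abs]
  rw [dist_comm z u, dist_comm z v]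
  exact abs_dist_sub_le u v z

/-- On the visible region the map is a rigid motion of the planar image. Each of the two shadows is
sent to a single ray by the distance to `z`, so there the triangle inequality suffices. For points
in different regions, an almost shortest path crosses the boundary of a shadow, where both formulas
hold, and the bounds for the two pieces add up. -/
theorem dist_logAt_le (z u v : ParkingLot) : dist (logAt z u) (logAt z v) ≤ dist u v := by
  have hz := z.tang_nonneg
  have τp : ‖Complex.I * Complex.exp ((z.tang : ℂ) * Complex.I)‖ = 1 := by
    rw [norm_mul, Complex.norm_exp_ofReal_mul_I]; simp
  have τn : ‖-(Complex.I * Complex.exp (-(z.tang : ℂ) * Complex.I))‖ = 1 := by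
    rw [norm_neg, norm_mul, norm_exp_neg]; simp
  have spos : ∀ {u v : ParkingLot}, z.tang + u.tang ≤ u.angle - z.angle →
      z.tang + v.tang ≤ v.angle - z.angle → dist (logAt z u) (logAt z v) ≤ dist u v :=
    fun hu hv => dist_mul_le τp (logAt_shadow_pos hu) (logAt_shadow_pos hv)
  have sneg : ∀ {u v : ParkingLot}, z.tang + u.tang ≤ z.angle - u.angle →
      z.tang + v.tang ≤ z.angle - v.angle → dist (logAt z u) (logAt z v) ≤ dist u v :=
    fun hu hv => dist_mul_le τn ((logAt_shadow_neg hu).trans (by ring))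
      ((logAt_shadow_neg hv).trans (by ring))
  have vv : ∀ {u v : ParkingLot}, |u.angle - z.angle| ≤ z.tang + u.tang →
      |v.angle - z.angle| ≤ z.tang + v.tang → dist (logAt z u) (logAt z v) ≤ dist u v :=
    fun hu hv => (dist_logAt_le_of_visible hu hv).trans_le (dist_pos_le _ _)
  have crossP : ∀ {u v : ParkingLot} {ε : ℝ}, u.angle - z.angle ≤ z.tang + u.tang →
      z.tang + v.tang ≤ v.angle - z.angle → 0 < ε →
      ∃ w : ParkingLot, w.angle - z.angle = z.tang + w.tang ∧ dist u w + dist w v ≤ dist u v + ε := by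
    intro u v ε hu hv hε
    obtain ⟨w, hw, hd⟩ := exists_crossing
      (F := fun p : Strip => p.1.1 - z.angle - z.tang - Real.arctan √(p.1.2 ^ 2 - 1))
      (by fun_prop) (x := u) (y := v) (by change u.angle - z.angle - z.tang - u.tang ≤ 0; linarith)
      (by change 0 ≤ v.angle - z.angle - z.tang - v.tang; linarith) hε
    change w.angle - z.angle - z.tang - w.tang = 0 at hw
    exact ⟨w, by linarith, hd⟩
  have crossN : ∀ {u v : ParkingLot} {ε : ℝ}, z.angle - u.angle ≤ z.tang + u.tang →
      z.tang + v.tang ≤ z.angle - v.angle → 0 < ε →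
      ∃ w : ParkingLot, z.angle - w.angle = z.tang + w.tang ∧ dist u w + dist w v ≤ dist u v + ε := by
    intro u v ε hu hv hε
    obtain ⟨w, hw, hd⟩ := exists_crossing
      (F := fun p : Strip => z.angle - p.1.1 - z.tang - Real.arctan √(p.1.2 ^ 2 - 1))
      (by fun_prop) (x := u) (y := v) (by change z.angle - u.angle - z.tang - u.tang ≤ 0; linarith)
      (by change 0 ≤ z.angle - v.angle - z.tang - v.tang; linarith) hε
    change z.angle - w.angle - z.tang - w.tang = 0 at hw
    exact ⟨w, by linarith, hd⟩
  have vp : ∀ {u v : ParkingLot}, |u.angle - z.angle| ≤ z.tang + u.tang →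
      z.tang + v.tang ≤ v.angle - z.angle → dist (logAt z u) (logAt z v) ≤ dist u v := by
    intro u v hu hv
    refine le_of_forall_pos_le_add fun ε hε => ?_
    obtain ⟨w, hw, hd⟩ := crossP (abs_le.1 hu).2 hv hε
    have hw0 := w.tang_nonneg
    have h1 := vv hu (v := w) (by rw [abs_of_nonneg (by linarith)]; linarith)
    have h2 := spos (u := w) hw.ge hv
    linarith [dist_triangle (logAt z u) (logAt z w) (logAt z v)]
  have vn : ∀ {u v : ParkingLot}, |u.angle - z.angle| ≤ z.tang + u.tang →
      z.tang + v.tang ≤ z.angle - v.angle → dist (logAt z u) (logAt z v) ≤ dist u v := by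
    intro u v hu hv
    refine le_of_forall_pos_le_add fun ε hε => ?_
    obtain ⟨w, hw, hd⟩ := crossN (u := u) (by linarith [(abs_le.1 hu).1]) hv hε
    have hw0 := w.tang_nonneg
    have h1 := vv hu (v := w) (by rw [abs_of_nonpos (by linarith)]; linarith)
    have h2 := sneg (u := w) hw.ge hv
    linarith [dist_triangle (logAt z u) (logAt z w) (logAt z v)]
  have np : ∀ {u v : ParkingLot}, z.tang + u.tang ≤ z.angle - u.angle →
      z.tang + v.tang ≤ v.angle - z.angle → dist (logAt z u) (logAt z v) ≤ dist u v := by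
    intro u v hu hv
    refine le_of_forall_pos_le_add fun ε hε => ?_
    have hu0 := u.tang_nonneg
    obtain ⟨w, hw, hd⟩ := crossP (u := u) (by linarith) hv hε
    have hw0 := w.tang_nonneg
    have h1 := vn (u := w) (by rw [abs_of_nonneg (by linarith)]; linarith) hu
    have h2 := spos (u := w) hw.ge hv
    rw [dist_comm, dist_comm w] at h1
    linarith [dist_triangle (logAt z u) (logAt z w) (logAt z v)]
  have tri : ∀ u : ParkingLot, |u.angle - z.angle| ≤ z.tang + u.tang ∨
      z.tang + u.tang ≤ u.angle - z.angle ∨ z.tang + u.tang ≤ z.angle - u.angle := by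
    intro u
    rcases le_total |u.angle - z.angle| (z.tang + u.tang) with h | h
    · exact Or.inl h
    · rcases abs_cases (u.angle - z.angle) with ⟨h', -⟩ | ⟨h', -⟩ <;> rw [h'] at h
      · exact Or.inr (Or.inl h)
      · exact Or.inr (Or.inr (by linarith))
  rcases tri u with hu | hu | hu <;> rcases tri v with hv | hv | hv
  · exact vv hu hv
  · exact vp hu hv
  · exact vn hu hv
  · rw [dist_comm, dist_comm u]; exact vp hv hu
  · exact spos hu hv
  · rw [dist_comm, dist_comm u]; exact np hv hu
  · rw [dist_comm, dist_comm u]; exact vn hv hu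
  · exact np hu hv
  · exact sneg hu hv

/-- The point at signed distance `e` from the tangent point on the line which is tangent to the
unit circle at the angle `T`. -/
def tpt (T e : ℝ) : ParkingLot := ofHalfPlane T (1 + e * Complex.I) (by simp)

theorem dist_tpt (T e e' : ℝ) : dist (tpt T e) (tpt T e') = |e - e'| := by
  rw [tpt, tpt, dist_ofHalfPlane, dist_eq_norm, add_sub_add_left_eq_sub, ← sub_mul, norm_mul,
    Complex.norm_I, mul_one, ← Complex.ofReal_sub, Complex.norm_real, Real.norm_eq_abs]

theorem tpt_radius (T e : ℝ) : (tpt T e).radius = √(1 + e ^ 2) := by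
  simp only [tpt, ofHalfPlane, Complex.norm_def, Complex.normSq_apply]
  simp [sq]

theorem tpt_angle (T e : ℝ) : (tpt T e).angle = T + Real.arctan e := by
  simp only [tpt, ofHalfPlane]
  have h0 : 0 < (1 + (e : ℂ) * Complex.I).re := by simp
  have h1 := abs_lt.1 (Complex.abs_arg_lt_pi_div_two_iff.2 (Or.inl h0))
  rw [← Real.arctan_tan h1.1 h1.2, Complex.tan_arg]
  simp

theorem tpt_tlen (T e : ℝ) : (tpt T e).tlen = |e| := by
  rw [tlen, tpt_radius, Real.sq_sqrt (by positivity), add_sub_cancel_left, Real.sqrt_sq_eq_abs]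

theorem tpt_tang (T e : ℝ) : (tpt T e).tang = Real.arctan |e| := by rw [tang, tpt_tlen]

theorem tpt_zero (T : ℝ) : tpt T 0 = circ T := by
  ext
  · rw [tpt_angle]; simp
  · rw [tpt_radius]; simp [circ]

theorem eq_tpt_neg (x : ParkingLot) : x = tpt (x.angle + x.tang) (-x.tlen) := by
  ext
  · rw [tpt_angle, Real.arctan_neg, tang]; ring
  · rw [tpt_radius, neg_sq, sqrt_one_add_tlen_sq]

theorem eq_tpt_pos (x : ParkingLot) : x = tpt (x.angle - x.tang) x.tlen := by
  ext
  · rw [tpt_angle, tang]; ring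
  · rw [tpt_radius, sqrt_one_add_tlen_sq]

/-- The geodesic line which follows the unit circle from the angle `T` to the angle `T'` and is
straight elsewhere. -/
def wrap (T T' σ : ℝ) : ParkingLot := tpt (max T (min σ T')) (σ - max T (min σ T'))

/-- Either both points are on the same tangent line, or the contact point has moved. In the second
case `σ` is not past the contact angle and `σ'` is not before it, so two tangent pieces and an arc
add up to exactly `σ' - σ`. -/
theorem dist_wrap_le (T T' : ℝ) {σ σ' : ℝ} (h : σ ≤ σ') :
    dist (wrap T T' σ) (wrap T T' σ') ≤ σ' - σ := by
  have hmono : max T (min σ T') ≤ max T (min σ' T') := by gcongr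
  rcases hmono.eq_or_lt with e | e
  · rw [wrap, wrap, ← e, dist_tpt, abs_sub_comm, abs_of_nonneg (by linarith)]; linarith
  · have h1 : σ ≤ max T (min σ T') := by
      by_contra! hc
      have : T' ≤ σ := by
        by_contra! h'
        rw [min_eq_left h'.le] at hc
        exact absurd hc (not_lt.2 (le_max_right _ _))
      rw [min_eq_right this] at e
      exact absurd e (not_lt.2 (max_le_max_left _ (min_le_right _ _)))
    have h2 : max T (min σ' T') ≤ σ' := by
      by_contra! hc
      have h' : min σ' T' ≤ T := by
        by_contra! h'
        rw [max_eq_right h'.le] at hc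
        exact absurd hc (not_lt.2 (min_le_left _ _))
      rw [max_eq_left h'] at e
      exact absurd e (not_lt.2 (le_max_left _ _))
    have h3 := dist_triangle4 (wrap T T' σ) (circ (max T (min σ T'))) (circ (max T (min σ' T')))
      (wrap T T' σ')
    rw [dist_circ, ← tpt_zero, ← tpt_zero, wrap, wrap, dist_tpt, dist_tpt,
      abs_of_nonpos (by linarith), abs_of_nonpos (by linarith), abs_of_nonpos (by linarith)] at h3
    rw [wrap, wrap]
    linarith

theorem dist_logAt_eq {x z y : ParkingLot} {v : ℂ} (hv : ‖v‖ = 1) {a b : ℝ} (ha : 0 ≤ a)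
    (hb : 0 ≤ b) (hx : logAt z x = -(a * v)) (hy : logAt z y = b * v)
    (h : dist x z + dist z y = dist x y) : dist (logAt z x) (logAt z y) = dist x y := by
  have e1 : dist z x = a := by
    rw [← norm_logAt, hx, norm_neg, norm_mul, hv, mul_one, Complex.norm_real, Real.norm_of_nonneg ha]
  have e2 : dist z y = b := by
    rw [← norm_logAt, hy, norm_mul, hv, mul_one, Complex.norm_real, Real.norm_of_nonneg hb]
  rw [← h, dist_comm x z, e1, e2, hx, hy, dist_eq_norm,
    show -(a * v) - b * v = -(((a + b : ℝ) : ℂ) * v) by push_cast; ring, norm_neg, norm_mul, hv,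
    mul_one, Complex.norm_real, Real.norm_of_nonneg (by linarith)]

theorem ofHalfPlane_congr {β : ℝ} {w w' : ℂ} (h : w = w') {hw : 1 ≤ w.re} (hw' : 1 ≤ w'.re) :
    ofHalfPlane β w hw = ofHalfPlane β w' hw' := by subst h; rfl

/-- A straight segment if the points see each other, otherwise a path wrapping around the disc. The
logarithm maps are examined along this particular geodesic because its uniqueness is not yet known;
it follows from them in `dist_logAt_of_between`. -/
theorem exists_geodesic_logAt (x y : ParkingLot) : ∃ c : ℝ → ParkingLot, IsGeodesicFromTo c x y ∧
    ∀ s ∈ Icc (0 : ℝ) 1, dist (logAt (c s) x) (logAt (c s) y) = dist x y := by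
  wlog hxy : x.angle ≤ y.angle generalizing x y
  · obtain ⟨c, ⟨h0, h1, hc⟩, hl⟩ := this y x (by linarith)
    refine ⟨fun s => c (1 - s), ⟨by simpa using h1, by simpa using h0, fun s hs t ht => ?_⟩,
      fun s hs => ?_⟩
    · rw [hc _ ⟨by linarith [hs.2], by linarith [hs.1]⟩ _ ⟨by linarith [ht.2], by linarith [ht.1]⟩,
        dist_comm y, abs_sub_comm]
      congr 2; ring
    · rw [dist_comm, hl _ ⟨by linarith [hs.2], by linarith [hs.1]⟩, dist_comm]
  rcases le_or_gt (y.angle - x.angle) (x.tang + y.tang) with hv | hv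
  · obtain ⟨β, hx, hy⟩ := exists_halfPlane (x := x) (y := y)
      (by rwa [abs_of_nonneg (by linarith)])
    obtain ⟨hw, ex⟩ := eq_ofHalfPlane hx
    obtain ⟨hw', ey⟩ := eq_ofHalfPlane hy
    set w := (x.radius : ℂ) * Complex.exp (((x.angle - β : ℝ) : ℂ) * Complex.I)
    set w' := (y.radius : ℂ) * Complex.exp (((y.angle - β : ℝ) : ℂ) * Complex.I)
    have hre : ∀ s ∈ Icc (0 : ℝ) 1, 1 ≤ (AffineMap.lineMap w w' s : ℂ).re := fun s hs => by
      simp only [AffineMap.lineMap_apply_module, Complex.add_re, Complex.real_smul,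
        Complex.re_ofReal_mul]
      nlinarith [hs.1, hs.2]
    classical
    let c : ℝ → ParkingLot := fun s =>
      if h : 1 ≤ (AffineMap.lineMap w w' s : ℂ).re then ofHalfPlane β _ h else x
    have hc : ∀ s (hs : s ∈ Icc (0 : ℝ) 1), c s = ofHalfPlane β _ (hre s hs) :=
      fun s hs => dif_pos (hre s hs)
    refine ⟨c, ⟨?_, ?_, fun s hs t ht => ?_⟩, fun s hs => ?_⟩
    · exact (hc 0 (by simp)).trans ((ofHalfPlane_congr (by simp) hw).trans ex.symm)
    · exact (hc 1 (by simp)).trans ((ofHalfPlane_congr (by simp) hw').trans ey.symm)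
    · conv_rhs => rw [ex, ey]
      rw [hc s hs, hc t ht, dist_ofHalfPlane, dist_ofHalfPlane, dist_lineMap_lineMap, Real.dist_eq]
    · have hz := abs_le.1 (abs_angle_sub_le_tang_ofHalfPlane β _ (hre s hs))
      rw [← hc s hs] at hz
      have hx' := abs_le.1 hx
      have hy' := abs_le.1 hy
      rw [dist_logAt_le_of_visible (abs_le.2 ⟨by linarith, by linarith⟩)
        (abs_le.2 ⟨by linarith, by linarith⟩), dist_eq_of_halfPlane hx hy]
  · set T := x.angle + x.tang with hT
    set T' := y.angle - y.tang with hT'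
    have hTT : T ≤ T' := by linarith
    have wx := x.tlen_nonneg
    have wy := y.tlen_nonneg
    have hD : dist x y = (T' + y.tlen) - (T - x.tlen) := by
      rw [dist_eq_of_shadow hv.le]; ring
    have gx : wrap T T' (T - x.tlen) = x := by
      conv_rhs => rw [eq_tpt_neg x]
      rw [wrap, max_eq_left ((min_le_left _ _).trans (by linarith)), ← hT]; congr 1; ring
    have gy : wrap T T' (T' + y.tlen) = y := by
      conv_rhs => rw [eq_tpt_pos y]
      rw [wrap, min_eq_right (by linarith), max_eq_right hTT, ← hT']; congr 1; ring
    -- A non-expanding curve whose parameter interval is as long as the distance of its endpoints is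
    -- a geodesic.
    have iso : ∀ σ σ', T - x.tlen ≤ σ → σ ≤ σ' → σ' ≤ T' + y.tlen →
        dist (wrap T T' σ) (wrap T T' σ') = σ' - σ := by
      intro σ σ' h1 h2 h3
      refine le_antisymm (dist_wrap_le T T' h2) ?_
      have a1 := dist_wrap_le T T' h1
      have a2 := dist_wrap_le T T' h3
      have a3 := dist_triangle4 x (wrap T T' σ) (wrap T T' σ') y
      rw [gx] at a1
      rw [gy] at a2
      linarith
    have hσ : ∀ s ∈ Icc (0 : ℝ) 1, T - x.tlen ≤ T - x.tlen + s * dist x y ∧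
        T - x.tlen + s * dist x y ≤ T' + y.tlen := fun s hs => by
      have h1 := mul_le_mul_of_nonneg_right hs.2 (dist_nonneg (x := x) (y := y))
      have h2 := mul_nonneg hs.1 (dist_nonneg (x := x) (y := y))
      constructor <;> linarith
    have hbet : ∀ σ, T - x.tlen ≤ σ → σ ≤ T' + y.tlen →
        dist x (wrap T T' σ) = σ - (T - x.tlen) ∧ dist (wrap T T' σ) y = T' + y.tlen - σ :=
      fun σ h1 h2 => ⟨by rw [← iso _ _ le_rfl h1 h2, gx], by rw [← iso _ _ h1 h2 le_rfl, gy]⟩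
    refine ⟨fun s => wrap T T' (T - x.tlen + s * dist x y), ⟨?_, ?_, fun s hs t ht => ?_⟩,
      fun s hs => ?_⟩
    · simpa using gx
    · have : T - x.tlen + 1 * dist x y = T' + y.tlen := by rw [hD]; ring
      simp only [this, gy]
    · wlog hst : s ≤ t generalizing s t
      · rw [dist_comm, abs_sub_comm]; exact this t ht s hs (by linarith)
      rw [iso _ _ (hσ s hs).1 (by nlinarith [dist_nonneg (x := x) (y := y)]) (hσ t ht).2,
        abs_sub_comm, abs_of_nonneg (by linarith)]
      ring
    · obtain ⟨h1, h2⟩ := hσ s hs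
      beta_reduce
      generalize T - x.tlen + s * dist x y = σ at h1 h2
      obtain ⟨hb1, hb2⟩ := hbet σ h1 h2
      have hb : dist x (wrap T T' σ) + dist (wrap T T' σ) y = dist x y := by
        rw [hb1, hb2, hD]; ring
      rcases le_or_gt σ T with hc | hc
      · have ez : wrap T T' σ = tpt T (σ - T) := by
          rw [wrap, max_eq_left ((min_le_left _ _).trans hc)]
        simp only [ez] at hb hb1 hb2 ⊢
        have e1 : (tpt T (σ - T)).angle + (tpt T (σ - T)).tang = T := by
          rw [tpt_angle, tpt_tang, abs_of_nonpos (by linarith), Real.arctan_neg]; ring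
        have e2 : (tpt T (σ - T)).tlen = T - σ := by
          rw [tpt_tlen, abs_of_nonpos (by linarith)]; ring
        refine dist_logAt_eq (v := Complex.I * Complex.exp (((tpt T (σ - T)).tang : ℂ) * Complex.I))
          (by rw [norm_mul, Complex.norm_exp_ofReal_mul_I]; simp)
          (a := x.tlen - (tpt T (σ - T)).tlen) (by linarith) dist_nonneg ?_
          (logAt_shadow_pos (by linarith)) hb
        rw [logAt_tangent_pos (by rw [e1])]
        push_cast; ring
      rcases le_or_gt σ T' with hc' | hc'
      · have ez : wrap T T' σ = circ σ := by
          rw [wrap, min_eq_left hc', max_eq_right hc.le, sub_self, tpt_zero]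
        simp only [ez] at hb hb1 hb2 ⊢
        refine dist_logAt_eq (v := Complex.I) (by simp) dist_nonneg dist_nonneg
          (a := dist (circ σ) x) (b := dist (circ σ) y) ?_ ?_ hb
        · rw [logAt_shadow_neg (by simp; linarith)]; simp
        · rw [logAt_shadow_pos (by simp; linarith)]; simp
      · have ez : wrap T T' σ = tpt T' (σ - T') := by
          rw [wrap, min_eq_right hc'.le, max_eq_right hTT]
        simp only [ez] at hb hb1 hb2 ⊢
        have e1 : (tpt T' (σ - T')).angle - (tpt T' (σ - T')).tang = T' := by
          rw [tpt_angle, tpt_tang, abs_of_nonneg (by linarith)]; ring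
        have e2 : (tpt T' (σ - T')).tlen = σ - T' := by
          rw [tpt_tlen, abs_of_nonneg (by linarith)]
        refine dist_logAt_eq
          (v := Complex.I * Complex.exp (-((tpt T' (σ - T')).tang : ℂ) * Complex.I))
          (by rw [norm_mul, norm_exp_neg]; simp) (b := y.tlen - (tpt T' (σ - T')).tlen)
          dist_nonneg (by linarith) (logAt_shadow_neg (by linarith)) ?_ hb
        rw [logAt_tangent_neg (by rw [e1])]

/-- Let `c s` be the point of the constructed geodesic at the same distance from `x` as `z`. Its
logarithm map yields the Bruhat–Tits inequality at `c s`, and this forces `z = c s`. -/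
theorem dist_logAt_of_between {x z y : ParkingLot} (h : dist x z + dist z y = dist x y) :
    dist (logAt z x) (logAt z y) = dist x y := by
  obtain ⟨c, ⟨h0, h1, hc⟩, hl⟩ := exists_geodesic_logAt x y
  rcases eq_or_ne (dist x y) 0 with hD | hD
  · refine le_antisymm (dist_logAt_le z x y) (hD ▸ dist_nonneg)
  have hp : 0 < dist x y := lt_of_le_of_ne dist_nonneg (Ne.symm hD)
  set s := dist x z / dist x y with hs
  have hsI : s ∈ Icc (0 : ℝ) 1 :=
    ⟨by positivity, by rw [hs, div_le_one hp]; linarith [dist_nonneg (x := z) (y := y)]⟩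
  have d1 : dist x (c s) = s * dist x y := by
    conv_lhs => rw [← h0]
    rw [hc 0 (by simp) s hsI, zero_sub, abs_neg, abs_of_nonneg hsI.1]
  have d2 : dist (c s) y = (1 - s) * dist x y := by
    conv_lhs => rw [← h1]
    rw [hc s hsI 1 (by simp), abs_sub_comm, abs_of_nonneg (by linarith [hsI.2])]
  have e1 : dist x z = s * dist x y := by rw [hs]; field_simp
  have e2 : dist z y = (1 - s) * dist x y := by rw [sub_mul, ← e1]; linarith
  have hL : IsLogMap (logAt (c s)) x (c s) y :=
    ⟨dist_logAt_le _, norm_logAt _, hl s hsI⟩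
  have := hL.cn z hsI d1 d2
  rw [dist_comm z x, e1, e2] at this
  have h0 : dist z (c s) ^ 2 ≤ 0 := this.trans (by nlinarith)
  have e : z = c s := dist_eq_zero.1 (pow_eq_zero_iff two_ne_zero |>.1 (le_antisymm h0 (sq_nonneg _)))
  rw [e]
  exact hl s hsI

theorem isLogMap_logAt {x z y : ParkingLot} (h : dist x z + dist z y = dist x y) :
    IsLogMap (logAt z) x z y :=
  ⟨dist_logAt_le _, norm_logAt _, dist_logAt_of_between h⟩

theorem hasLogMaps : HasLogMaps ParkingLot := fun _ _ _ h => ⟨_, isLogMap_logAt h⟩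

theorem exists_geodesic (x y : ParkingLot) : ∃ c : ℝ → ParkingLot, IsGeodesicFromTo c x y :=
  (exists_geodesic_logAt x y).imp fun _ h => h.1

theorem isCAT0 : IsCAT0 ParkingLot := hasLogMaps.cn.isCAT0 exists_geodesic

end ParkingLot

/-! ## Gluing rays to CAT(0) spaces -/

theorem exists_geodesic_of_nonexpanding {X : Type*} [MetricSpace X] {x y : X} (g : ℝ → X)
    (h0 : g 0 = x) (h1 : g (dist x y) = y)
    (hg : ∀ s t, 0 ≤ s → s ≤ t → t ≤ dist x y → dist (g s) (g t) ≤ t - s) :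
    ∃ c : ℝ → X, IsGeodesicFromTo c x y := by
  have hD : 0 ≤ dist x y := dist_nonneg
  refine ⟨fun s => g (s * dist x y), by simpa using h0, by simpa using h1, fun s hs t ht => ?_⟩
  wlog hst : s ≤ t generalizing s t
  · rw [dist_comm, abs_sub_comm]; exact this t ht s hs (by linarith)
  have b1 := mul_nonneg hs.1 hD
  have b2 := mul_le_mul_of_nonneg_right hst hD
  have b3 := mul_le_mul_of_nonneg_right ht.2 hD
  rw [abs_sub_comm, abs_of_nonneg (by linarith)]
  have a1 := hg 0 _ le_rfl b1 (by linarith)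
  have a2 := hg _ _ b1 b2 (by linarith)
  have a3 := hg _ _ (b1.trans b2) (by linarith) le_rfl
  have a4 := dist_triangle4 x (g (s * dist x y)) (g (t * dist x y)) y
  rw [h0] at a1
  rw [h1] at a3
  linarith

theorem exists_geodesic_concat {X : Type*} [MetricSpace X] {x m y : X}
    (hm : dist x m + dist m y = dist x y) (h1 : ∃ c : ℝ → X, IsGeodesicFromTo c x m)
    (h2 : ∃ c : ℝ → X, IsGeodesicFromTo c m y) : ∃ c : ℝ → X, IsGeodesicFromTo c x y := by
  have unit : ∀ {a b : X}, (∃ c : ℝ → X, IsGeodesicFromTo c a b) → ∃ g : ℝ → X, g 0 = a ∧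
      g (dist a b) = b ∧ ∀ s t, 0 ≤ s → s ≤ t → t ≤ dist a b → dist (g s) (g t) ≤ t - s := by
    rintro a b ⟨c, c0, c1, hc⟩
    rcases eq_or_ne (dist a b) 0 with h0 | h0
    · refine ⟨fun _ => a, rfl, dist_eq_zero.1 h0, fun s t _ h _ => ?_⟩
      simpa using h
    · have hp : 0 < dist a b := lt_of_le_of_ne dist_nonneg (Ne.symm h0)
      refine ⟨fun s => c (s / dist a b), by simpa using c0, by simpa [h0] using c1,
        fun s t h1 h2 h3 => ?_⟩
      rw [hc _ ⟨by positivity, (div_le_one hp).2 (by linarith)⟩ _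
        ⟨div_nonneg (by linarith) hp.le, (div_le_one hp).2 h3⟩, ← sub_div, abs_div, abs_of_pos hp,
        div_mul_cancel₀ _ h0, abs_sub_comm, abs_of_nonneg (by linarith)]
  obtain ⟨g, g0, g1, hg⟩ := unit h1
  obtain ⟨k, k0, k1, hk⟩ := unit h2
  have d1 := dist_nonneg (x := x) (y := m)
  have d2 := dist_nonneg (x := m) (y := y)
  refine exists_geodesic_of_nonexpanding
    (fun s => if s ≤ dist x m then g s else k (s - dist x m)) (by simp [g0]) ?_ ?_
  · by_cases h : dist x y ≤ dist x m
    · have e : m = y := dist_eq_zero.1 (by linarith)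
      subst e
      simp [g1]
    · rw [if_neg h, show dist x y - dist x m = dist m y by linarith, k1]
  · intro s t h1 h2 h3
    by_cases ht : t ≤ dist x m
    · simp only [ht, h2.trans ht, if_true]; exact hg s t h1 h2 ht
    · by_cases hs : s ≤ dist x m
      · simp only [ht, hs, if_true, if_false]
        have a1 := hg s _ h1 hs le_rfl
        have a2 := hk 0 (t - dist x m) le_rfl (by linarith) (by linarith)
        rw [g1] at a1
        rw [k0] at a2
        linarith [dist_triangle (g s) m (k (t - dist x m))]
      · simp only [ht, hs, if_false]
        have := hk (s - dist x m) (t - dist x m) (by linarith) (by linarith) (by linarith)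
        linarith

theorem exists_geodesic_symm {X : Type*} [MetricSpace X] {x y : X}
    (h : ∃ c : ℝ → X, IsGeodesicFromTo c x y) : ∃ c : ℝ → X, IsGeodesicFromTo c y x := by
  obtain ⟨c, c0, c1, hc⟩ := h
  refine ⟨fun s => c (1 - s), by simpa using c1, by simpa using c0, fun s hs t ht => ?_⟩
  rw [hc _ ⟨by linarith [hs.2], by linarith [hs.1]⟩ _ ⟨by linarith [ht.2], by linarith [ht.1]⟩,
    dist_comm y, abs_sub_comm]
  congr 2; ring

theorem exists_unit_of_norm_sub_eq {A B : ℂ} (h : ‖A - B‖ = ‖A‖ + ‖B‖) :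
    ∃ v : ℂ, ‖v‖ = 1 ∧ A = -(‖A‖ * v) ∧ B = ‖B‖ * v := by
  have hs : SameRay ℝ (-A) B := by
    rw [sameRay_iff_norm_add, norm_neg, ← h, ← norm_neg]; congr 1; ring
  obtain ⟨u, a, b, ha, hb, -, eA, eB⟩ := hs.exists_eq_smul
  have eA' : A = -(a • u) := by rw [← eA, neg_neg]
  rcases eq_or_ne u 0 with hu | hu
  · exact ⟨1, by simp, by simp [eA', hu], by simp [eB, hu]⟩
  · have hu' : (‖u‖ : ℂ) ≠ 0 := by exact_mod_cast norm_ne_zero_iff.2 hu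
    refine ⟨u / ‖u‖, ?_, ?_, ?_⟩
    · rw [norm_div, Complex.norm_real, norm_norm, div_self (norm_ne_zero_iff.2 hu)]
    · rw [eA', norm_neg, norm_smul, Real.norm_of_nonneg ha, Complex.real_smul]
      push_cast; field_simp
    · rw [eB, norm_smul, Real.norm_of_nonneg hb, Complex.real_smul]
      push_cast; field_simp

/-! ### Logarithm maps and geodesics in the presence of rays -/

namespace AttachRays

variable {X ι : Type*} {p : ι → X}

/-- The point of the base space from which the ray of `u` issues. -/
def foot : AttachRays p → X
  | base x => x
  | ray i _ _ => p i

/-- The distance to the base space. -/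
def height : AttachRays p → ℝ
  | base _ => 0
  | ray _ s _ => s

theorem height_nonneg (u : AttachRays p) : 0 ≤ u.height := by
  cases u with
  | base x => exact le_rfl
  | ray i s hs => exact hs.le

/-- The point at distance `t` from the origin on the `i`-th ray. -/
def pt (p : ι → X) (i : ι) (t : ℝ) : AttachRays p := if h : 0 < t then ray i t h else base (p i)

theorem pt_of_pos (i : ι) {t : ℝ} (h : 0 < t) : pt p i t = ray i t h := dif_pos h

theorem pt_zero (i : ι) : pt p i 0 = base (p i) := dif_neg (lt_irrefl _)

/-- `u` and `v` lie on the same ray. -/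
def OnSameRay (u v : AttachRays p) : Prop :=
  ∃ (i : ι) (s t : ℝ) (hs : 0 < s) (ht : 0 < t), u = ray i s hs ∧ v = ray i t ht

variable [MetricSpace X]

theorem dist_base_base (x y : X) : dist (base x : AttachRays p) (base y) = dist x y := rfl

theorem dist_base_ray (x : X) (i : ι) (s : ℝ) (hs : 0 < s) :
    dist (base x : AttachRays p) (ray i s hs) = dist x (p i) + s := rfl

theorem dist_ray_base (x : X) (i : ι) (s : ℝ) (hs : 0 < s) :
    dist (ray i s hs : AttachRays p) (base x) = s + dist (p i) x := rfl

theorem dist_ray_same (i : ι) (s t : ℝ) (hs : 0 < s) (ht : 0 < t) :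
    dist (ray i s hs : AttachRays p) (ray i t ht) = |s - t| := by
  change gdist _ _ = _
  simp [gdist]

theorem dist_ray_ray {i j : ι} (h : i ≠ j) (s t : ℝ) (hs : 0 < s) (ht : 0 < t) :
    dist (ray i s hs : AttachRays p) (ray j t ht) = s + dist (p i) (p j) + t := by
  change gdist _ _ = _
  simp [gdist, h]

theorem dist_pt_pt (i : ι) {s t : ℝ} (hs : 0 ≤ s) (ht : 0 ≤ t) :
    dist (pt p i s) (pt p i t) = |s - t| := by
  rcases hs.eq_or_lt with rfl | hs' <;> rcases ht.eq_or_lt with rfl | ht'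
  · simp
  · rw [pt_zero, pt_of_pos i ht', dist_base_ray, dist_self, abs_sub_comm, sub_zero, zero_add,
      abs_of_nonneg ht]
  · rw [pt_zero, pt_of_pos i hs', dist_ray_base, dist_self, sub_zero, add_zero, abs_of_nonneg hs]
  · rw [pt_of_pos i hs', pt_of_pos i ht', dist_ray_same]

theorem dist_eq_of_not_sameRay {u v : AttachRays p} (h : ¬ OnSameRay u v) :
    dist u v = u.height + dist u.foot v.foot + v.height := by
  rcases u with x | ⟨i, s, hs⟩ <;> rcases v with y | ⟨j, t, ht⟩
  · simp [dist_base_base, height, foot]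
  · simp [dist_base_ray, height, foot]
  · simp [dist_ray_base, height, foot]
  · have hij : i ≠ j := by
      rintro rfl
      exact h ⟨i, s, t, hs, ht, rfl, rfl⟩
    rw [dist_ray_ray hij]; rfl

theorem dist_base (z : X) (u : AttachRays p) : dist (base z) u = dist z u.foot + u.height := by
  cases u with
  | base x => simp [dist_base_base, height, foot]
  | ray i s hs => rfl

theorem dist_ray_of_ne {i : ι} {u : AttachRays p} (h : ∀ t ht, u ≠ ray i t ht) (s : ℝ) (hs : 0 < s) :
    dist (ray i s hs) u = s + dist (base (p i)) u := by
  rcases u with x | ⟨j, t, ht⟩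
  · rfl
  · rw [dist_ray_ray, dist_base_ray, add_assoc]
    rintro rfl
    exact h t ht rfl

/-- At a point of the base space, extend a logarithm map adapted to the feet of `x` and `y` by
sending each ray to a straight ray that leads away from the origin. At a point of a ray the space
may simply be folded onto a line. -/
theorem hasLogMaps (hX : HasLogMaps X) : HasLogMaps (AttachRays p) := by
  classical
  intro x z y hxy
  rcases z with z | ⟨i, s, hs⟩
  · have hns : ¬ OnSameRay x y := by
      rintro ⟨i, s, t, hs, ht, rfl, rfl⟩
      rw [dist_ray_same, dist_ray_base, dist_base_ray, dist_comm z] at hxy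
      have h1 := abs_sub_comm s t
      have := dist_nonneg (x := p i) (y := z)
      rcases abs_cases (s - t) with ⟨h, -⟩ | ⟨h, -⟩ <;> linarith
    have hd := dist_eq_of_not_sameRay hns
    have hxy' : dist x.foot z + dist z y.foot = dist x.foot y.foot := by
      rw [hd, dist_comm x, dist_base, dist_base, dist_comm z] at hxy; linarith
    obtain ⟨L, hL1, hL2, hL3⟩ := hX x.foot z y.foot hxy'
    obtain ⟨v, hv, ex, ey⟩ := exists_unit_of_norm_sub_eq (A := L x.foot) (B := L y.foot)
      (by rw [← dist_eq_norm, hL3, hL2, hL2, dist_comm z x.foot, hxy'])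
    -- Direction of the image of each ray. A ray glued at `z` itself has no preferred direction;
    -- there the direction `v` of `y` is used, except that a ray containing `x` must point the
    -- opposite way so that the distance from `x` to `y` is kept.
    let e : ι → ℂ := fun i => if p i = z then (if ∃ t ht, x = ray i t ht then -v else v)
      else L (p i) / ‖L (p i)‖
    have he : ∀ i, ‖e i‖ = 1 := fun i => by
      simp only [e]
      split_ifs with h1 h2
      · rw [norm_neg, hv]
      · exact hv
      · have : ‖L (p i)‖ ≠ 0 := by rw [hL2]; exact fun h => h1 (dist_eq_zero.1 h).symm
        rw [norm_div, Complex.norm_real, norm_norm, div_self this]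
    have hLz : ∀ i, p i = z → L (p i) = 0 := fun i h => by
      rw [← norm_eq_zero, hL2, h, dist_self]
    let E : AttachRays p → ℂ := fun u => match u with
      | base _ => 0
      | ray i _ _ => e i
    have hE : ∀ u, ‖E u‖ ≤ 1 := by
      rintro (u | ⟨i, s, hs⟩)
      · simp [E]
      · exact (he i).le
    refine ⟨fun u => L u.foot + u.height * E u, fun a b => ?_, fun u => ?_, ?_⟩
    · by_cases hs : OnSameRay a b
      · obtain ⟨i, s, t, hs, ht, rfl, rfl⟩ := hs
        simp only [foot, height, E]
        rw [dist_ray_same, dist_eq_norm, add_sub_add_left_eq_sub, ← sub_mul, norm_mul, he, mul_one,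
          ← Complex.ofReal_sub, Complex.norm_real, Real.norm_eq_abs]
      · rw [dist_eq_of_not_sameRay hs]
        have t1 : ∀ u : AttachRays p, ‖(u.height : ℂ) * E u‖ ≤ u.height := fun u => by
          rw [norm_mul, Complex.norm_real, Real.norm_of_nonneg u.height_nonneg]
          exact mul_le_of_le_one_right u.height_nonneg (hE u)
        have t2 := hL1 a.foot b.foot
        rw [dist_eq_norm] at t2 ⊢
        have e1 : L a.foot + a.height * E a - (L b.foot + b.height * E b)
            = (a.height * E a + (L a.foot - L b.foot)) + -(b.height * E b) := by ring
        rw [e1]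
        refine (norm_add_le _ _).trans (add_le_add ((norm_add_le _ _).trans
          (add_le_add (t1 a) t2)) ?_)
        rw [norm_neg]; exact t1 b
    · rw [dist_base]
      rcases u with u | ⟨i, s, hs⟩
      · simp [foot, height, hL2]
      · simp only [foot, height, E]
        by_cases h : p i = z
        · rw [hLz i h, zero_add, norm_mul, he, mul_one, Complex.norm_real, Real.norm_of_nonneg hs.le,
            h, dist_self, zero_add]
        · have h0 : ‖L (p i)‖ ≠ 0 := by rw [hL2]; exact fun h' => h (dist_eq_zero.1 h').symm
          have h0' : (‖L (p i)‖ : ℂ) ≠ 0 := by exact_mod_cast h0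
          have e2 : L (p i) + s * (L (p i) / ‖L (p i)‖)
              = ((‖L (p i)‖ + s : ℝ) : ℂ) * (L (p i) / ‖L (p i)‖) := by
            push_cast; field_simp
          simp only [e, if_neg h]
          rw [e2, norm_mul, norm_div, Complex.norm_real, Complex.norm_real, norm_norm, div_self h0,
            mul_one, hL2, Real.norm_of_nonneg (by positivity)]
    · have hX1 : L x.foot + x.height * E x = -(((‖L x.foot‖ + x.height : ℝ) : ℂ) * v) := by
        rcases x with x | ⟨i, s, hs⟩
        · simp only [foot, height] at ex ⊢
          conv_lhs => rw [ex]
          simp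
        · simp only [foot, height, E, e] at ex ⊢
          by_cases h : p i = z
          · rw [if_pos h, if_pos ⟨s, hs, rfl⟩, hLz i h]; simp
          · have h0 : ‖L (p i)‖ ≠ 0 := by rw [hL2]; exact fun h' => h (dist_eq_zero.1 h').symm
            have h0' : (‖L (p i)‖ : ℂ) ≠ 0 := by exact_mod_cast h0
            rw [if_neg h]
            nth_rewrite 1 2 [ex]
            push_cast; field_simp; ring
      have hY1 : L y.foot + y.height * E y = ((‖L y.foot‖ + y.height : ℝ) : ℂ) * v := by
        rcases y with y | ⟨i, s, hs⟩
        · simp only [foot, height] at ey ⊢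
          conv_lhs => rw [ey]
          simp
        · simp only [foot, height, E, e] at ey ⊢
          by_cases h : p i = z
          · rw [if_pos h, if_neg, hLz i h]
            · simp
            · rintro ⟨t, ht, rfl⟩
              exact hns ⟨i, t, s, ht, hs, rfl, rfl⟩
          · have h0 : ‖L (p i)‖ ≠ 0 := by rw [hL2]; exact fun h' => h (dist_eq_zero.1 h').symm
            have h0' : (‖L (p i)‖ : ℂ) ≠ 0 := by exact_mod_cast h0
            rw [if_neg h]
            nth_rewrite 1 2 [ey]
            push_cast; field_simp
      beta_reduce
      rw [hX1, hY1, dist_eq_norm, ← neg_add', ← add_mul, norm_neg, norm_mul, hv, mul_one,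
        ← Complex.ofReal_add, Complex.norm_real, Real.norm_of_nonneg (by
          have := x.height_nonneg
          have := y.height_nonneg
          positivity), hL2, hL2, hd, ← hxy', dist_comm z x.foot]
      ring
  -- Signed distance to `z`: negative on the side of the base space, and increasing along the ray.
  · let L : AttachRays p → ℝ := fun u => match u with
      | base x => -dist (ray i s hs : AttachRays p) (base x)
      | ray j t ht => if j = i then t - s else -dist (ray i s hs : AttachRays p) (ray j t ht)
    have L1 : ∀ t ht, L (ray i t ht) = t - s := fun t ht => by simp [L]
    have L2 : ∀ u : AttachRays p, (∀ t ht, u ≠ ray i t ht) → L u = -dist (ray i s hs) u := by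
      rintro (u | ⟨j, t, ht⟩) h
      · rfl
      · simp only [L]
        rw [if_neg]
        rintro rfl
        exact h t ht rfl
    have case : ∀ u : AttachRays p, (∃ t ht, u = ray i t ht) ∨ ∀ t ht, u ≠ ray i t ht := fun u => by
      by_cases h : ∃ t ht, u = ray i t ht
      · exact Or.inl h
      · exact Or.inr fun t ht e => h ⟨t, ht, e⟩
    have mixed : ∀ (t : ℝ) (ht : 0 < t) (u : AttachRays p), (∀ t ht, u ≠ ray i t ht) →
        |L (ray i t ht) - L u| = dist (ray i t ht) u := fun t ht u h => by
      rw [L1, L2 u h, dist_ray_of_ne h, dist_ray_of_ne h]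
      have := dist_nonneg (x := base (p i)) (y := u)
      rw [abs_of_nonneg (by linarith)]; ring
    have cplx : ∀ a b : ℝ, dist (a : ℂ) (b : ℂ) = |a - b| := fun a b => by
      rw [dist_eq_norm, ← Complex.ofReal_sub, Complex.norm_real, Real.norm_eq_abs]
    refine ⟨fun u => (L u : ℂ), fun a b => ?_, fun u => ?_, ?_⟩
    · rw [cplx]
      rcases case a with ⟨t, ht, rfl⟩ | ha <;> rcases case b with ⟨t', ht', rfl⟩ | hb
      · rw [L1, L1, dist_ray_same, sub_sub_sub_cancel_right]
      · exact (mixed t ht b hb).le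
      · rw [abs_sub_comm, dist_comm]; exact (mixed t' ht' a ha).le
      · rw [L2 a ha, L2 b hb, neg_sub_neg, abs_sub_comm, dist_comm _ a, dist_comm _ b]
        exact abs_dist_sub_le _ _ _
    · rw [Complex.norm_real, Real.norm_eq_abs]
      rcases case u with ⟨t, ht, rfl⟩ | hu
      · rw [L1, dist_ray_same, abs_sub_comm]
      · rw [L2 u hu, abs_neg, abs_of_nonneg dist_nonneg]
    · rw [cplx]
      rcases case x with ⟨t, ht, rfl⟩ | ha <;> rcases case y with ⟨t', ht', rfl⟩ | hb
      · rw [L1, L1, dist_ray_same, sub_sub_sub_cancel_right]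
      · exact mixed t ht y hb
      · rw [abs_sub_comm, dist_comm]; exact mixed t' ht' x ha
      · exfalso
        rw [dist_comm x, dist_ray_of_ne ha, dist_ray_of_ne hb] at hxy
        have := dist_triangle x (base (p i)) y
        rw [dist_comm x (base (p i))] at this
        linarith

theorem exists_geodesic (hX : ∀ x y : X, ∃ c : ℝ → X, IsGeodesicFromTo c x y) (u v : AttachRays p) :
    ∃ c : ℝ → AttachRays p, IsGeodesicFromTo c u v := by
  have hray : ∀ (i : ι) {s t : ℝ}, 0 ≤ s → 0 ≤ t →
      ∃ c : ℝ → AttachRays p, IsGeodesicFromTo c (pt p i s) (pt p i t) := by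
    intro i s t hs ht
    refine ⟨fun r => pt p i ((1 - r) * s + r * t), by simp, by simp, fun r hr r' hr' => ?_⟩
    rw [dist_pt_pt i (by nlinarith [hr.1, hr.2, mul_nonneg hr.1 ht])
      (by nlinarith [hr'.1, hr'.2, mul_nonneg hr'.1 ht]), dist_pt_pt i hs ht, ← abs_mul,
      ← abs_neg]
    congr 1; ring
  have hbase : ∀ x y : X, ∃ c : ℝ → AttachRays p, IsGeodesicFromTo c (base x) (base y) := by
    intro x y
    obtain ⟨c, c0, c1, hc⟩ := hX x y
    exact ⟨fun s => base (c s), congrArg base c0, congrArg base c1, hc⟩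
  have hfoot : ∀ u : AttachRays p, ∃ c : ℝ → AttachRays p, IsGeodesicFromTo c (base u.foot) u := by
    rintro (u | ⟨i, s, hs⟩)
    · exact hbase u u
    · have := hray i le_rfl hs.le
      rwa [pt_zero, pt_of_pos i hs] at this
  by_cases h : OnSameRay u v
  · obtain ⟨i, s, t, hs, ht, rfl, rfl⟩ := h
    have := hray i hs.le ht.le
    rwa [pt_of_pos i hs, pt_of_pos i ht] at this
  · have hd := dist_eq_of_not_sameRay h
    refine exists_geodesic_concat (m := base u.foot) ?_ (exists_geodesic_symm (hfoot u))
      (exists_geodesic_concat (m := base v.foot) ?_ (hbase _ _) (hfoot v))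
    · rw [hd, dist_comm u, dist_base, dist_base, dist_self]; ring
    · rw [dist_base, dist_base, dist_base, dist_self]; simp [foot, height]

end AttachRays

/-! ## The spiral map -/

namespace ParkingLot

/-- The map `(t, r) ↦ (t + a log r, r)`. -/
def shear (a : ℝ) (x : ParkingLot) : ParkingLot :=
  ⟨x.angle + a * Real.log x.radius, x.radius, x.one_le_radius⟩

theorem dist_le_radial_add_angular (x y : ParkingLot) :
    dist x y ≤ |x.radius - y.radius| + x.radius * |x.angle - y.angle| := by
  have h1 := dist_triangle x ⟨y.angle, x.radius, x.one_le_radius⟩ y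
  have h2 := dist_le_of_radius_eq (x := x) (y := ⟨y.angle, x.radius, x.one_le_radius⟩) rfl
  have h3 := dist_eq_of_angle_eq (x := ⟨y.angle, x.radius, x.one_le_radius⟩) (y := y) rfl
  simp only at h2 h3
  linarith

/-- The chord at the smaller radius bounds the distance from below, and Jordan's inequality compares
the chord with the arc. The bound on the distance keeps half the angle within `π / 2`, where
Jordan's inequality is valid. -/
theorem radius_mul_angle_le {x y : ParkingLot} (hr : x.radius ≤ y.radius)
    (h : dist x y ≤ Real.pi) : x.radius * |x.angle - y.angle| ≤ Real.pi / 2 * dist x y := by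
  have hD : |x.angle - y.angle| ≤ Real.pi := (abs_angle_sub_le x y).trans h
  have hs := Real.mul_le_sin (x := |x.angle - y.angle| / 2) (by positivity) (by linarith)
  have hpi := Real.pi_pos
  have hx := x.radius_pos
  have h1 : 2 * x.radius * Real.sin (|x.angle - y.angle| / 2) ≤ dist x y := by
    refine le_trans ?_ (dist_pos_le x y)
    apply le_of_sq_le_sq _ dist_nonneg
    rw [sq_dist_pos]
    have e : Real.sin (|x.angle - y.angle| / 2) ^ 2 = Real.sin ((x.angle - y.angle) / 2) ^ 2 := by
      rcases abs_cases (x.angle - y.angle) with ⟨h, -⟩ | ⟨h, -⟩ <;> rw [h]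
      rw [neg_div, Real.sin_neg, neg_sq]
    rw [mul_pow, e]
    have := mul_nonneg (mul_nonneg hx.le (sub_nonneg.2 hr)) (sq_nonneg (Real.sin ((x.angle - y.angle) / 2)))
    nlinarith [sq_nonneg (x.radius - y.radius)]
  have h2 : 2 * x.radius * (2 / Real.pi * (|x.angle - y.angle| / 2)) ≤ dist x y :=
    (mul_le_mul_of_nonneg_left hs (by positivity)).trans h1
  calc x.radius * |x.angle - y.angle|
      = Real.pi / 2 * (2 * x.radius * (2 / Real.pi * (|x.angle - y.angle| / 2))) := by
        field_simp
    _ ≤ _ := by gcongr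

/-- The derivative `a / r` of `a log r` is cancelled by the factor `r` in the length `r dθ` of arcs,
so the map is uniformly Lipschitz at scales up to `π`. Subdividing a geodesic extends this to all
distances. -/
theorem dist_shear_le (a : ℝ) (x y : ParkingLot) :
    dist (shear a x) (shear a y) ≤ (1 + |a| + Real.pi / 2) * dist x y := by
  have hpi := Real.pi_pos
  have loc : ∀ x y : ParkingLot, dist x y ≤ Real.pi →
      dist (shear a x) (shear a y) ≤ (1 + |a| + Real.pi / 2) * dist x y := by
    intro x y h
    wlog hr : x.radius ≤ y.radius generalizing x y
    · rw [dist_comm, dist_comm x]; exact this y x (by rwa [dist_comm]) (by linarith)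
    have hx := x.radius_pos
    have hy := y.radius_pos
    have h1 := dist_le_radial_add_angular (shear a x) (shear a y)
    have h2 := radius_mul_angle_le hr h
    have h3 := abs_radius_sub_le x y
    have h4 : x.radius * |Real.log x.radius - Real.log y.radius| ≤ |x.radius - y.radius| := by
      have hl := Real.log_le_log hx hr
      rw [abs_sub_comm, abs_sub_comm x.radius, abs_of_nonneg (by linarith), abs_of_nonneg (by linarith),
        ← Real.log_div hy.ne' hx.ne']
      have := Real.log_le_sub_one_of_pos (div_pos hy hx)
      calc x.radius * Real.log (y.radius / x.radius) ≤ x.radius * (y.radius / x.radius - 1) := by gcongr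
        _ = _ := by field_simp
    have h5 : |(shear a x).angle - (shear a y).angle|
        ≤ |x.angle - y.angle| + |a| * |Real.log x.radius - Real.log y.radius| := by
      rw [← abs_mul]
      refine le_trans (le_of_eq ?_) (abs_add_le _ _)
      simp only [shear]; congr 1; ring
    have h6 := mul_le_mul_of_nonneg_left h5 hx.le
    have h7 := mul_le_mul_of_nonneg_left h4 (abs_nonneg a)
    have h8 := mul_le_mul_of_nonneg_left h3 (abs_nonneg a)
    change dist (shear a x) (shear a y) ≤ |x.radius - y.radius|
      + x.radius * |(shear a x).angle - (shear a y).angle| at h1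
    nlinarith
  obtain ⟨c, c0, c1, hc⟩ := exists_geodesic x y
  obtain ⟨N, hN⟩ := exists_nat_gt (dist x y / Real.pi)
  have hN0 : (0 : ℝ) < N := lt_of_le_of_lt (by positivity) hN
  rw [div_lt_iff₀ hpi] at hN
  have step : ∀ k < N, dist (shear a (c (k / N))) (shear a (c ((k + 1 : ℕ) / N)))
      ≤ (1 + |a| + Real.pi / 2) * (dist x y / N) := by
    intro k hk
    have hk' : (k : ℝ) + 1 ≤ N := by exact_mod_cast hk
    have e : dist (c (k / N)) (c ((k + 1 : ℕ) / N)) = dist x y / N := by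
      rw [hc _ ⟨by positivity, (div_le_one hN0).2 (by linarith)⟩ _
        ⟨by positivity, (div_le_one hN0).2 (by push_cast; linarith)⟩, ← sub_div, abs_div,
        abs_of_pos hN0]
      push_cast
      rw [sub_add_cancel_left, abs_neg, abs_one]; ring
    rw [← e]
    refine loc _ _ ?_
    rw [e, div_le_iff₀ hN0]; linarith
  have := dist_le_range_sum_of_dist_le (f := fun k : ℕ => shear a (c (k / N))) N
    (d := fun _ => (1 + |a| + Real.pi / 2) * (dist x y / N)) (fun {k} hk => step k hk)
  simp only [Finset.sum_const, Finset.card_range, nsmul_eq_mul, CharP.cast_eq_zero, zero_div,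
    div_self hN0.ne', c0, c1] at this
  refine this.trans_eq ?_
  field_simp

theorem shear_shear_neg (a : ℝ) (x : ParkingLot) : shear a (shear (-a) x) = x := by
  ext
  · simp [shear]
  · rfl

theorem spiralMap_eq_shear : spiralMap = shear (-(Real.log 2)⁻¹) := by
  funext x
  ext
  · simp only [spiralMap, shear, Real.logb, div_eq_inv_mul]; ring
  · rfl

theorem exists_biLipschitz_spiralMap : ∃ K : ℝ, 1 ≤ K ∧ ∀ x y : ParkingLot,
    dist (spiralMap x) (spiralMap y) ≤ K * dist x y ∧
      dist x y ≤ K * dist (spiralMap x) (spiralMap y) := by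
  have hpi := Real.pi_pos
  refine ⟨1 + |(Real.log 2)⁻¹| + Real.pi / 2, by linarith [abs_nonneg (Real.log 2)⁻¹], fun x y => ?_⟩
  rw [spiralMap_eq_shear]
  constructor
  · have := dist_shear_le (-(Real.log 2)⁻¹) x y
    rwa [abs_neg] at this
  · have := dist_shear_le (Real.log 2)⁻¹ (shear (-(Real.log 2)⁻¹) x) (shear (-(Real.log 2)⁻¹) y)
    rwa [shear_shear_neg, shear_shear_neg] at this

theorem spiralMap_surjective : Function.Surjective spiralMap := by
  rw [spiralMap_eq_shear]
  intro y
  refine ⟨shear (Real.log 2)⁻¹ y, ?_⟩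
  have := shear_shear_neg (-(Real.log 2)⁻¹) y
  rwa [neg_neg] at this

end ParkingLot

theorem isQuasiIsometry_of_biLipschitz {X Y : Type*} [MetricSpace X] [MetricSpace Y] {f : X → Y}
    {K : ℝ} (hK : 1 ≤ K) (hf : ∀ x y, dist (f x) (f y) ≤ K * dist x y ∧ dist x y ≤ K * dist (f x) (f y))
    (hs : Function.Surjective f) : IsQuasiIsometry f := by
  refine ⟨K, 0, hK, le_rfl, fun x y => ⟨?_, by simpa using (hf x y).1⟩, fun y => ?_⟩
  · rw [sub_zero, inv_mul_le_iff₀ (by linarith)]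
    exact (hf x y).2
  · obtain ⟨x, rfl⟩ := hs y
    exact ⟨x, by simp⟩

theorem isQuasiIsometry_spiralMap : IsQuasiIsometry spiralMap := by
  obtain ⟨K, hK, h⟩ := ParkingLot.exists_biLipschitz_spiralMap
  exact isQuasiIsometry_of_biLipschitz hK h ParkingLot.spiralMap_surjective

/-- A bi-Lipschitz surjection of base spaces which matches the gluing points extends to the rays. -/
theorem AttachRays.quasiIsometric_of_biLipschitz {X Y ι : Type*} [MetricSpace X] [MetricSpace Y]
    {p : ι → X} {q : ι → Y} {f : X → Y} {K : ℝ} (hK : 1 ≤ K)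
    (hf : ∀ x y, dist (f x) (f y) ≤ K * dist x y ∧ dist x y ≤ K * dist (f x) (f y))
    (hs : Function.Surjective f) (hp : ∀ i, f (p i) = q i) :
    QuasiIsometric (AttachRays p) (AttachRays q) := by
  let F : AttachRays p → AttachRays q := fun u => match u with
    | base x => base (f x)
    | ray i s hs => ray i s hs
  have hscale : ∀ s : ℝ, 0 ≤ s → s ≤ K * s := fun s h => by nlinarith
  refine ⟨F, isQuasiIsometry_of_biLipschitz hK ?_ ?_⟩
  · rintro (x | ⟨i, s, hs⟩) (y | ⟨j, t, ht⟩)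
    · exact hf x y
    · simp only [F, dist_base_ray, ← hp]
      have := hf x (p j)
      have := hscale t ht.le
      constructor <;> linarith
    · simp only [F, dist_ray_base, ← hp]
      have := hf (p i) y
      have := hscale s hs.le
      constructor <;> linarith
    · simp only [F]
      by_cases hij : i = j
      · subst hij
        simp only [dist_ray_same]
        exact ⟨hscale _ (abs_nonneg _), hscale _ (abs_nonneg _)⟩
      · simp only [dist_ray_ray hij, ← hp]
        have := hf (p i) (p j)
        have := hscale s hs.le
        have := hscale t ht.le
        constructor <;> linarith
  · rintro (y | ⟨i, s, hs'⟩)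
    · obtain ⟨x, rfl⟩ := hs y
      exact ⟨base x, rfl⟩
    · exact ⟨ray i s hs', rfl⟩

/-- The spiral map carries `(i, 2 ^ i)` to `(0, 2 ^ i)`. -/
theorem quasiIsometric_spaceW_spaceZ : QuasiIsometric SpaceW SpaceZ := by
  obtain ⟨K, hK, h⟩ := ParkingLot.exists_biLipschitz_spiralMap
  refine AttachRays.quasiIsometric_of_biLipschitz hK h ParkingLot.spiralMap_surjective fun i => ?_
  ext
  · simp [spiralMap, Real.logb_pow]
  · rfl

/-! ## Curtains in spaces with the Bruhat–Tits inequality -/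

section Curtains

variable {X : Type*} [MetricSpace X] {I : Set ℝ} {α : ℝ → X}

theorem CN.sq_dist_geodesic_le (hX : CN X) (hα : IsGeodesicOn I α) (p : X) {s₁ s₂ l : ℝ}
    (h₁ : s₁ ∈ I) (h₂ : s₂ ∈ I) (hl : l ∈ Icc (0 : ℝ) 1) :
    (1 - l) * s₁ + l * s₂ ∈ I ∧ dist p (α ((1 - l) * s₁ + l * s₂)) ^ 2 ≤
      (1 - l) * dist p (α s₁) ^ 2 + l * dist p (α s₂) ^ 2 - l * (1 - l) * (s₁ - s₂) ^ 2 := by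
  obtain ⟨-, hI, hd⟩ := hα
  have hm : (1 - l) * s₁ + l * s₂ ∈ I :=
    hI.convex h₁ h₂ (by linarith [hl.2]) hl.1 (by ring)
  refine ⟨hm, ?_⟩
  have := hX (α s₁) (α s₂) (α ((1 - l) * s₁ + l * s₂)) p l hl
    (by rw [hd _ h₁ _ hm, hd _ h₁ _ h₂, ← abs_of_nonneg hl.1, ← abs_mul, abs_of_nonneg hl.1]
        congr 1; ring)
    (by rw [hd _ hm _ h₂, hd _ h₁ _ h₂, ← abs_of_nonneg (by linarith [hl.2] : 0 ≤ 1 - l), ← abs_mul,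
          abs_of_nonneg (by linarith [hl.2] : 0 ≤ 1 - l)]
        congr 1; ring)
  rwa [hd _ h₁ _ h₂, sq_abs] at this

/-- `α s` is a closest point to `x` on the geodesic `α`. -/
def IsProj (I : Set ℝ) (α : ℝ → X) (x : X) (s : ℝ) : Prop :=
  s ∈ I ∧ ∀ t ∈ I, dist x (α s) ≤ dist x (α t)

theorem mem_projPreimage {J : Set ℝ} {x : X} :
    x ∈ projPreimage I α J ↔ ∃ s ∈ J, IsProj I α x s :=
  ⟨fun ⟨s, hs, h⟩ => ⟨s, hs.2, hs.1, h⟩, fun ⟨s, hJ, hs, h⟩ => ⟨s, ⟨hs, hJ⟩, h⟩⟩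

theorem isProj_self {s : ℝ} (hs : s ∈ I) : IsProj I α (α s) s :=
  ⟨hs, fun t _ => by rw [dist_self]; exact dist_nonneg⟩

/-- Curtains therefore contain every point between a member and its projection. This is how curtains
are forced through bottlenecks and cut points. -/
theorem IsProj.of_between {x z : X} {s : ℝ} (h : IsProj I α x s)
    (hz : dist x z + dist z (α s) = dist x (α s)) : IsProj I α z s :=
  ⟨h.1, fun t ht => by linarith [h.2 t ht, dist_triangle x z (α t)]⟩

/-- Strict convexity of the squared distance along the geodesic: beyond the closest point the
distance strictly increases. -/
theorem IsProj.dist_lt (hX : CN X) (hα : IsGeodesicOn I α) {x : X} {s₀ s₁ s₂ l : ℝ}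
    (h : IsProj I α x s₀) (h₂ : s₂ ∈ I) (hne : s₀ ≠ s₂) (hl : l ∈ Ioo (0 : ℝ) 1)
    (e : s₁ = (1 - l) * s₀ + l * s₂) : dist x (α s₁) < dist x (α s₂) := by
  obtain ⟨-, h1⟩ := hX.sq_dist_geodesic_le hα x h.1 h₂ ⟨hl.1.le, hl.2.le⟩
  rw [← e] at h1
  have h2 := pow_le_pow_left₀ dist_nonneg (h.2 s₂ h₂) 2
  have h3 := mul_le_mul_of_nonneg_left h2 (sub_nonneg.2 hl.2.le)
  have h4 : 0 < l * (1 - l) * (s₀ - s₂) ^ 2 :=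
    mul_pos (mul_pos hl.1 (sub_pos.2 hl.2)) (sq_pos_iff.2 (sub_ne_zero.2 hne))
  exact lt_of_pow_lt_pow_left₀ 2 dist_nonneg (by nlinarith)

theorem IsProj.dist_lt_right (hX : CN X) (hα : IsGeodesicOn I α) {x : X} {s₀ s₁ s₂ : ℝ}
    (h : IsProj I α x s₀) (h₂ : s₂ ∈ I) (h01 : s₀ < s₁) (h12 : s₁ < s₂) :
    dist x (α s₁) < dist x (α s₂) := by
  have hp : 0 < s₂ - s₀ := by linarith
  refine h.dist_lt hX hα h₂ (by linarith) (l := (s₁ - s₀) / (s₂ - s₀))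
    ⟨div_pos (by linarith) hp, (div_lt_one hp).2 (by linarith)⟩ ?_
  field_simp; ring

theorem IsProj.dist_lt_left (hX : CN X) (hα : IsGeodesicOn I α) {x : X} {s₀ s₁ s₂ : ℝ}
    (h : IsProj I α x s₀) (h₂ : s₂ ∈ I) (h01 : s₁ < s₀) (h12 : s₂ < s₁) :
    dist x (α s₁) < dist x (α s₂) := by
  have hp : 0 < s₀ - s₂ := by linarith
  refine h.dist_lt hX hα h₂ (by linarith) (l := (s₀ - s₁) / (s₀ - s₂))
    ⟨div_pos (by linarith) hp, (div_lt_one hp).2 (by linarith)⟩ ?_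
  field_simp; ring

theorem IsProj.unique (hX : CN X) (hα : IsGeodesicOn I α) {x : X} {s s' : ℝ}
    (h : IsProj I α x s) (h' : IsProj I α x s') : s = s' := by
  by_contra hne
  have h1 := h.dist_lt hX hα h'.1 hne (l := 1 / 2) (by norm_num) rfl
  have h2 := (hX.sq_dist_geodesic_le hα x h.1 h'.1 (l := 1 / 2) (by norm_num)).1
  exact absurd (h'.2 _ h2) (not_le.2 h1)

theorem isProj_of_local (hX : CN X) (hα : IsGeodesicOn I α) {x : X} {r δ : ℝ} (hδ : 0 < δ)
    (hr : r ∈ I) (h : ∀ s ∈ Icc (r - δ) (r + δ), dist x (α r) ≤ dist x (α s)) :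
    IsProj I α x r := by
  refine ⟨hr, fun t ht => ?_⟩
  rcases eq_or_ne t r with rfl | hne
  · exact le_rfl
  have hp : 0 < |t - r| := abs_pos.2 (sub_ne_zero.2 hne)
  -- The point at parameter `l` between `r` and `t` stays within `δ` of `r`; convexity transfers the
  -- local inequality there to `t`.
  set l := min 1 (δ / |t - r|) with hl
  have hl0 : 0 < l := lt_min one_pos (div_pos hδ hp)
  have hl1 : l ≤ 1 := min_le_left _ _
  have h1 := (hX.sq_dist_geodesic_le hα x hr ht ⟨hl0.le, hl1⟩).2
  have h2 : |l * (t - r)| ≤ δ := by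
    rw [abs_mul, abs_of_pos hl0, ← le_div_iff₀ hp]; exact min_le_right _ _
  have h3 := h ((1 - l) * r + l * t) (by
    have := abs_le.1 h2
    constructor <;> nlinarith)
  have h4 := pow_le_pow_left₀ dist_nonneg h3 2
  have h5 : 0 ≤ l * (1 - l) * (r - t) ^ 2 :=
    mul_nonneg (mul_nonneg hl0.le (sub_nonneg.2 hl1)) (sq_nonneg _)
  apply le_of_sq_le_sq _ dist_nonneg
  have h6 : l * dist x (α r) ^ 2 ≤ l * dist x (α t) ^ 2 := by linarith
  exact le_of_mul_le_mul_left h6 hl0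

theorem IsCurtainAt.mem_iff {h : Set X} {r : ℝ} (hc : IsCurtainAt h I α r) {x : X} :
    x ∈ h ↔ ∃ s ∈ Icc (r - 1 / 2) (r + 1 / 2), IsProj I α x s := by
  rw [hc.2.2, curtain, mem_projPreimage]

theorem IsCurtainAt.Icc_subset {h : Set X} {r : ℝ} (hc : IsCurtainAt h I α r) :
    Icc (r - 1 / 2) (r + 1 / 2) ⊆ I := hc.2.1.trans interior_subset

theorem IsCurtainAt.apply_mem {h : Set X} {r s : ℝ} (hc : IsCurtainAt h I α r)
    (hs : s ∈ Icc (r - 1 / 2) (r + 1 / 2)) : α s ∈ h :=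
  hc.mem_iff.2 ⟨s, hs, isProj_self (hc.Icc_subset hs)⟩

/-- The projections of `x` and `y` lie beyond opposite ends of the pole, so along the pole one
distance strictly increases and the other strictly decreases. Injectivity is all that the upper
bounds need: no two points of the pole can have the same difference of distances to `x` and `y`. -/
theorem Separates.exists_injOn (hX : CN X) {h : Set X} {x y : X} (hs : Separates h {x} {y}) :
    ∃ (I : Set ℝ) (α : ℝ → X) (r : ℝ), IsCurtainAt h I α r ∧
      InjOn (fun s => dist x (α s) - dist y (α s)) (Icc (r - 1 / 2) (r + 1 / 2)) := by
  obtain ⟨I, α, r, hc, hx, hy⟩ := hs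
  refine ⟨I, α, r, hc, StrictMonoOn.injOn fun s₁ h₁ s₂ h₂ hlt => ?_⟩
  obtain ⟨sx, hsx, hx⟩ := mem_projPreimage.1 (hx rfl)
  obtain ⟨sy, hsy, hy⟩ := mem_projPreimage.1 (hy rfl)
  have a1 := hx.dist_lt_right hX hc.1 (hc.Icc_subset h₂) (lt_of_lt_of_le hsx h₁.1) hlt
  have a2 := hy.dist_lt_left hX hc.1 (hc.Icc_subset h₁) (lt_of_le_of_lt h₂.2 hsy) hlt
  linarith

/-- A curtain which meets both sides of a cut point contains it. -/
theorem IsCurtain.mem_of_cut (hX : CN X) {h : Set X} (hc : IsCurtain h) {A B : Set X} {g : X}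
    (hAB : A ∪ B = univ) (hg : ∀ a ∈ A, ∀ b ∈ B, dist a g + dist g b = dist a b)
    (hA : (h ∩ A).Nonempty) (hB : (h ∩ B).Nonempty) : g ∈ h := by
  obtain ⟨I, α, r, hc⟩ := hc
  obtain ⟨z, hz, hzA⟩ := hA
  obtain ⟨z', hz', hzB⟩ := hB
  obtain ⟨s, hs, hp⟩ := hc.mem_iff.1 hz
  obtain ⟨s', hs', hp'⟩ := hc.mem_iff.1 hz'
  have side : ∀ u : X, u ∈ A ∨ u ∈ B := fun u => by
    have : u ∈ A ∪ B := hAB ▸ mem_univ u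
    exact this
  have middle : ∀ s s', s ∈ Icc (r - 1 / 2) (r + 1 / 2) → s' ∈ Icc (r - 1 / 2) (r + 1 / 2) →
      s ≤ s' → dist (α s) g + dist g (α s') = dist (α s) (α s') → g ∈ h := by
    intro s s' hs hs' hle hd
    have hd' := hc.1.2.2
    have e1 := hd' s (hc.Icc_subset hs) s' (hc.Icc_subset hs')
    rw [abs_sub_comm, abs_of_nonneg (by linarith)] at e1
    have n1 := dist_nonneg (x := α s) (y := g)
    have n2 := dist_nonneg (x := g) (y := α s')
    have hσ : s + dist (α s) g ∈ Icc (r - 1 / 2) (r + 1 / 2) :=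
      ⟨by linarith [hs.1], by linarith [hs'.2]⟩
    have e2 := hd' s (hc.Icc_subset hs) _ (hc.Icc_subset hσ)
    have e3 := hd' _ (hc.Icc_subset hσ) s' (hc.Icc_subset hs')
    rw [abs_sub_comm, abs_of_nonneg (by linarith)] at e2 e3
    have : g = α (s + dist (α s) g) := hX.eq_of_between hd (by linarith) (by linarith)
    rw [this]
    exact hc.apply_mem hσ
  -- If the two projections lie on different sides, the cut point is on the pole. Otherwise one of
  -- the two given points is separated by `g` from its own projection, and `IsProj.of_between`
  -- applies.
  rcases side (α s) with h1 | h1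
  · rcases side (α s') with h2 | h2
    · have := hg _ h2 _ hzB
      exact hc.mem_iff.2 ⟨s', hs', hp'.of_between (by
        rw [dist_comm z' g, dist_comm g (α s'), dist_comm z' (α s')]; linarith)⟩
    · have hd := hg _ h1 _ h2
      rcases le_total s s' with hle | hle
      · exact middle s s' hs hs' hle hd
      · exact middle s' s hs' hs hle (by
          rw [dist_comm (α s') g, dist_comm g (α s), dist_comm (α s') (α s)]; linarith)
  · exact hc.mem_iff.2 ⟨s, hs, hp.of_between (hg _ hzA _ h1)⟩

theorem isCurtainAt_curtain (hα : IsGeodesicOn I α) {r : ℝ}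
    (hr : Icc (r - 1 / 2) (r + 1 / 2) ⊆ interior I) : IsCurtainAt (curtain I α r) I α r :=
  ⟨hα, hr, rfl⟩

theorem disjoint_curtain (hX : CN X) (hα : IsGeodesicOn I α) {r r' : ℝ} (h : 1 < |r - r'|) :
    Disjoint (curtain I α r) (curtain I α r') := by
  rw [disjoint_left]
  intro x hx hx'
  obtain ⟨s, hs, hp⟩ := mem_projPreimage.1 hx
  obtain ⟨s', hs', hp'⟩ := mem_projPreimage.1 hx'
  have e := hp.unique hX hα hp'
  subst e
  refine absurd h (not_lt.2 (abs_le.2 ⟨?_, ?_⟩)) <;> linarith [hs.1, hs.2, hs'.1, hs'.2]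

theorem isCurtainChain_curtain (hX : CN X) (hα : IsGeodesicOn I α) {r D : ℝ} (hD : 2 ≤ D) {n : ℕ}
    (hr : ∀ j : Fin n, Icc (r + D * (j : ℕ) - 1 / 2) (r + D * (j : ℕ) + 1 / 2) ⊆ interior I) :
    IsCurtainChain (fun j : Fin n => curtain I α (r + D * (j : ℕ))) := by
  refine ⟨fun j => ⟨_, _, _, isCurtainAt_curtain hα (hr j)⟩, fun i j hij => ?_,
    fun i j k hij hjk => ⟨_, _, _, isCurtainAt_curtain hα (hr j), fun x hx => ?_, fun x hx => ?_⟩⟩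
  · apply disjoint_curtain hX hα
    rw [add_sub_add_left_eq_sub, ← mul_sub, abs_mul, abs_of_pos (by linarith)]
    have : (1 : ℝ) ≤ |((i : ℕ) : ℝ) - ((j : ℕ) : ℝ)| := by
      have h1 : (1 : ℤ) ≤ |((i : ℕ) : ℤ) - ((j : ℕ) : ℤ)| := by
        apply Int.one_le_abs
        intro h
        exact hij (Fin.ext (by omega))
      exact_mod_cast h1
    nlinarith
  · obtain ⟨s, hs, hp⟩ := mem_projPreimage.1 hx
    refine mem_projPreimage.2 ⟨s, ?_, hp⟩
    have : ((j : ℕ) : ℝ) = (i : ℕ) + 1 := by exact_mod_cast hij.symm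
    rw [mem_Iio, this]
    linarith [hs.2]
  · obtain ⟨s, hs, hp⟩ := mem_projPreimage.1 hx
    refine mem_projPreimage.2 ⟨s, ?_, hp⟩
    have : ((k : ℕ) : ℝ) = (j : ℕ) + 1 := by exact_mod_cast hjk.symm
    have h1 := hs.1
    rw [this] at h1
    rw [mem_Ioi]
    linarith

/-! ### Bounds for `d_L` -/

/-- Every `L`-chain separating `x` from `y` has at most `B` members. -/
def ChainBound (L : ℕ) (x y : X) (B : ℝ) : Prop :=
  ∀ (n : ℕ) (c : Fin n → Set X), IsLChain L c → (∀ i, Separates (c i) {x} {y}) → (n : ℝ) ≤ B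

theorem ChainBound.dL_le {L : ℕ} {x y : X} {B : ℝ} (hB : 0 ≤ B) (h : ChainBound L x y B) :
    dL L x y ≤ 1 + B := by
  unfold dL
  split_ifs
  · linarith
  · have : sSup {n : ℕ | ∃ c : Fin n → Set X, IsLChain L c ∧ ∀ i, Separates (c i) {x} {y}}
        ≤ ⌊B⌋₊ := csSup_le' fun n ⟨c, hc, hs⟩ => Nat.le_floor (h n c hc hs)
    have h2 : ((sSup {n : ℕ | ∃ c : Fin n → Set X, IsLChain L c ∧
        ∀ i, Separates (c i) {x} {y}} : ℕ) : ℝ) ≤ B :=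
      (Nat.cast_le.2 this).trans (Nat.floor_le hB)
    linarith

theorem dL_nonneg (L : ℕ) (x y : X) : 0 ≤ dL L x y := by
  unfold dL
  split_ifs
  · exact le_rfl
  · positivity

/-- An a priori bound is needed because the supremum of an unbounded set of natural numbers is 0 by
convention; a long chain by itself says nothing about `dL`. -/
theorem ChainBound.le_dL {L : ℕ} {x y : X} {B : ℝ} (h : ChainBound L x y B) (hxy : x ≠ y) {n : ℕ}
    {c : Fin n → Set X} (hc : IsLChain L c) (hs : ∀ i, Separates (c i) {x} {y}) :
    1 + (n : ℝ) ≤ dL L x y := by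
  rw [dL, if_neg hxy]
  have : n ≤ sSup {n : ℕ | ∃ c : Fin n → Set X, IsLChain L c ∧ ∀ i, Separates (c i) {x} {y}} :=
    le_csSup ⟨⌊B⌋₊, fun n ⟨c, hc, hs⟩ => Nat.le_floor (h n c hc hs)⟩ ⟨c, hc, hs⟩
  have h2 : (n : ℝ) ≤ (sSup {n : ℕ | ∃ c : Fin n → Set X, IsLChain L c ∧
      ∀ i, Separates (c i) {x} {y}} : ℕ) := Nat.cast_le.2 this
  linarith

/-! ### Symmetries -/

theorem Separates.symm {h A B : Set X} (hs : Separates h A B) : Separates h B A := by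
  obtain ⟨I, α, r, ⟨⟨hI1, hI2, hd⟩, hr, rfl⟩, hA, hB⟩ := hs
  have pre : ∀ J : Set ℝ, projPreimage (Neg.neg ⁻¹' I) (fun s => α (-s)) (Neg.neg ⁻¹' J)
      = projPreimage I α J := by
    intro J
    ext x
    constructor
    · rintro ⟨s, hs, h⟩
      exact ⟨-s, hs, fun t ht => by simpa using h (-t) (by simpa using ht)⟩
    · rintro ⟨s, hs, h⟩
      exact ⟨-s, by simpa using hs, fun t ht => by simpa using h (-t) ht⟩
  have p1 : Neg.neg ⁻¹' Icc (r - 1 / 2) (r + 1 / 2) = Icc (-r - 1 / 2) (-r + 1 / 2) := by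
    ext s; simp only [mem_preimage, mem_Icc]; constructor <;> rintro ⟨h1, h2⟩ <;> constructor <;> linarith
  have p2 : Neg.neg ⁻¹' Iio (r - 1 / 2) = Ioi (-r + 1 / 2) := by
    ext s; simp only [mem_preimage, mem_Iio, mem_Ioi]; constructor <;> intro h <;> linarith
  have p3 : Neg.neg ⁻¹' Ioi (r + 1 / 2) = Iio (-r - 1 / 2) := by
    ext s; simp only [mem_preimage, mem_Iio, mem_Ioi]; constructor <;> intro h <;> linarith
  refine ⟨Neg.neg ⁻¹' I, fun s => α (-s), -r, ⟨⟨hI1.preimage continuous_neg, ?_, ?_⟩, ?_, ?_⟩, ?_, ?_⟩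
  · exact ⟨fun a ha b hb s hs => hI2.out hb ha ⟨neg_le_neg hs.2, neg_le_neg hs.1⟩⟩
  · intro s hs t ht
    rw [hd _ hs _ ht, abs_sub_comm]; congr 1; ring
  · rw [← p1]
    exact (preimage_mono hr).trans (preimage_interior_subset_interior_preimage continuous_neg)
  · rw [curtain, curtain, ← p1, pre]
  · rwa [halfMinus, ← p3, pre]
  · rwa [halfPlus, ← p2, pre]

theorem dL_comm (L : ℕ) (x y : X) : dL L x y = dL L y x := by
  unfold dL
  have : {n : ℕ | ∃ c : Fin n → Set X, IsLChain L c ∧ ∀ i, Separates (c i) {x} {y}}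
      = {n : ℕ | ∃ c : Fin n → Set X, IsLChain L c ∧ ∀ i, Separates (c i) {y} {x}} := by
    ext n
    exact exists_congr fun c => and_congr_right fun _ =>
      ⟨fun h i => (h i).symm, fun h i => (h i).symm⟩
  rw [this]
  congr 1
  exact propext eq_comm

variable {Y : Type*} [MetricSpace Y]

theorem image_projPreimage (e : X ≃ᵢ Y) (I : Set ℝ) (α : ℝ → X) (J : Set ℝ) :
    e '' projPreimage I α J = projPreimage I (e ∘ α) J := by
  ext y
  constructor
  · rintro ⟨x, ⟨s, hs, h⟩, rfl⟩
    exact ⟨s, hs, fun t ht => by simpa only [Function.comp_apply, e.dist_eq] using h t ht⟩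
  · rintro ⟨s, hs, h⟩
    refine ⟨e.symm y, ⟨s, hs, fun t ht => ?_⟩, by simp⟩
    rw [← e.dist_eq, ← e.dist_eq (e.symm y) (α t)]
    simpa using h t ht

theorem IsCurtainAt.image (e : X ≃ᵢ Y) {h : Set X} {r : ℝ} (hc : IsCurtainAt h I α r) :
    IsCurtainAt (e '' h) I (e ∘ α) r := by
  obtain ⟨⟨h1, h2, h3⟩, h4, rfl⟩ := hc
  exact ⟨⟨h1, h2, fun s hs t ht => by simpa only [Function.comp_apply, e.dist_eq] using h3 s hs t ht⟩, h4, image_projPreimage e _ _ _⟩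

theorem Separates.image (e : X ≃ᵢ Y) {h A B : Set X} (hs : Separates h A B) :
    Separates (e '' h) (e '' A) (e '' B) := by
  obtain ⟨I, α, r, hc, hA, hB⟩ := hs
  refine ⟨I, e ∘ α, r, hc.image e, ?_, ?_⟩
  · rw [halfMinus, ← image_projPreimage]; exact image_mono hA
  · rw [halfPlus, ← image_projPreimage]; exact image_mono hB

theorem IsCurtainChain.image (e : X ≃ᵢ Y) {n : ℕ} {c : Fin n → Set X} (hc : IsCurtainChain c) :
    IsCurtainChain (fun i => e '' c i) := by
  refine ⟨fun i => ?_, fun i j hij => ?_, fun i j k h1 h2 => (hc.2.2 i j k h1 h2).image e⟩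
  · obtain ⟨I, α, r, h⟩ := hc.1 i
    exact ⟨I, e ∘ α, r, h.image e⟩
  · exact (disjoint_image_iff e.injective).2 (hc.2.1 i j hij)

theorem LSeparated.image (e : X ≃ᵢ Y) {L : ℕ} {h h' : Set X} (hs : LSeparated L h h') :
    LSeparated L (e '' h) (e '' h') := by
  refine ⟨(disjoint_image_iff e.injective).2 hs.1, fun n c hc hm => ?_⟩
  refine hs.2 n (fun i => e.symm '' c i) (hc.image e.symm) fun i => ?_
  obtain ⟨⟨_, h1, x, hx, rfl⟩, ⟨_, h2, x', hx', rfl⟩⟩ := hm i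
  exact ⟨⟨x, ⟨_, h1, by simp⟩, hx⟩, ⟨x', ⟨_, h2, by simp⟩, hx'⟩⟩

theorem setOf_chain_subset (e : X ≃ᵢ Y) (L : ℕ) (x y : X) :
    {n : ℕ | ∃ c : Fin n → Set X, IsLChain L c ∧ ∀ i, Separates (c i) {x} {y}}
      ⊆ {n : ℕ | ∃ c : Fin n → Set Y, IsLChain L c ∧ ∀ i, Separates (c i) {e x} {e y}} := by
  rintro n ⟨c, ⟨hc, hL⟩, hs⟩
  refine ⟨fun i => e '' c i, ⟨hc.image e, fun i j hij => (hL i j hij).image e⟩, fun i => ?_⟩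
  have := (hs i).image e
  rwa [image_singleton, image_singleton] at this

theorem dL_isometryEquiv (e : X ≃ᵢ Y) (L : ℕ) (x y : X) : dL L (e x) (e y) = dL L x y := by
  have k2 := setOf_chain_subset e.symm L (e x) (e y)
  simp only [IsometryEquiv.symm_apply_apply] at k2
  unfold dL
  rw [subset_antisymm k2 (setOf_chain_subset e L x y)]
  congr 1
  exact propext e.injective.eq_iff

end Curtains

/-! ## Separated chains in the parking lot with rays -/

theorem LSeparated.symm {X : Type*} [MetricSpace X] {L : ℕ} {h h' : Set X} (hs : LSeparated L h h') :
    LSeparated L h' h :=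
  ⟨hs.1.symm, fun n c hc hm => hs.2 n c hc fun i => (hm i).symm⟩

theorem isLChain_curtain {X : Type*} [MetricSpace X] (hX : CN X) {I : Set ℝ} {α : ℝ → X}
    (hα : IsGeodesicOn I α) {r D : ℝ} (hD : 2 ≤ D) {n L : ℕ}
    (hr : ∀ j : Fin n, Icc (r + D * (j : ℕ) - 1 / 2) (r + D * (j : ℕ) + 1 / 2) ⊆ interior I)
    (hL : ∀ j k : Fin n, r + D * (j : ℕ) + D ≤ r + D * (k : ℕ) →
      LSeparated L (curtain I α (r + D * (j : ℕ))) (curtain I α (r + D * (k : ℕ)))) :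
    IsLChain L (fun j : Fin n => curtain I α (r + D * (j : ℕ))) := by
  refine ⟨isCurtainChain_curtain hX hα hD hr, ?_⟩
  have lt : ∀ i j : Fin n, i < j → r + D * ((i : ℕ) : ℝ) + D ≤ r + D * ((j : ℕ) : ℝ) := by
    intro i j hij
    have : ((i : ℕ) : ℝ) + 1 ≤ ((j : ℕ) : ℝ) := by exact_mod_cast hij
    nlinarith
  intro i j hij
  rcases lt_or_gt_of_ne hij with h | h
  · exact hL i j (lt i j h)
  · exact (hL j i (lt j i h)).symm

namespace AttachRays

section General

variable {X ι : Type*} {p : ι → X}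

open Classical in
/-- The position of the projection to the `i`-th ray. -/
def rayHeight (i : ι) : AttachRays p → ℝ
  | base _ => 0
  | ray j t _ => if j = i then t else 0

theorem rayHeight_ray (i : ι) (t : ℝ) (ht : 0 < t) : rayHeight i (ray i t ht : AttachRays p) = t := by
  simp [rayHeight]

theorem rayHeight_of_ne {i : ι} {u : AttachRays p} (h : ∀ t ht, u ≠ ray i t ht) :
    rayHeight i u = 0 := by
  rcases u with x | ⟨j, t, ht⟩
  · rfl
  · simp only [rayHeight]
    rw [if_neg]
    rintro rfl
    exact h t ht rfl

theorem exists_ray_or_ne (i : ι) (u : AttachRays p) :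
    (∃ t ht, u = ray i t ht) ∨ ∀ t ht, u ≠ ray i t ht := by
  by_cases h : ∃ t ht, u = ray i t ht
  · exact Or.inl h
  · exact Or.inr fun t ht e => h ⟨t, ht, e⟩

theorem rayHeight_nonneg (i : ι) (u : AttachRays p) : 0 ≤ rayHeight i u := by
  rcases exists_ray_or_ne i u with ⟨t, ht, rfl⟩ | h
  · rw [rayHeight_ray]; exact ht.le
  · rw [rayHeight_of_ne h]

theorem eq_pt_of_rayHeight_pos {i : ι} {u : AttachRays p} (h : 0 < rayHeight i u) :
    u = pt p i (rayHeight i u) := by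
  rcases exists_ray_or_ne i u with ⟨t, ht, rfl⟩ | h'
  · rw [rayHeight_ray, pt_of_pos]
  · rw [rayHeight_of_ne h'] at h
    exact absurd h (lt_irrefl _)

theorem rayHeight_pt (i : ι) {t : ℝ} (ht : 0 ≤ t) : rayHeight i (pt p i t) = t := by
  rcases ht.eq_or_lt with rfl | h
  · rw [pt_zero]; rfl
  · rw [pt_of_pos i h, rayHeight_ray]

variable [MetricSpace X]

theorem dist_pt_of_ne {i : ι} {u : AttachRays p} (h : ∀ t ht, u ≠ ray i t ht) {s : ℝ} (hs : 0 ≤ s) :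
    dist (pt p i s) u = s + dist (base (p i)) u := by
  rcases hs.eq_or_lt with rfl | h'
  · rw [pt_zero, zero_add]
  · rw [pt_of_pos i h', dist_ray_of_ne h]

theorem isGeodesicOn_pt (p : ι → X) (i : ι) : IsGeodesicOn (Ici 0) (pt p i) :=
  ⟨isClosed_Ici, ordConnected_Ici, fun _ hs _ ht => dist_pt_pt i hs ht⟩

theorem isProj_pt (i : ι) (u : AttachRays p) : IsProj (Ici 0) (pt p i) u (rayHeight i u) := by
  refine ⟨rayHeight_nonneg i u, fun t ht => ?_⟩
  rcases exists_ray_or_ne i u with ⟨s, hs, rfl⟩ | h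
  · rw [rayHeight_ray, pt_of_pos i hs, dist_self]; exact dist_nonneg
  · rw [rayHeight_of_ne h, dist_comm, dist_comm u, dist_pt_of_ne h le_rfl, dist_pt_of_ne h ht]
    have : (0 : ℝ) ≤ t := ht
    linarith

theorem dist_add_pt {i : ι} {G w : ℝ} (hG : 0 ≤ G) (hw : G ≤ w) {b : AttachRays p}
    (hb : rayHeight i b ≤ G) :
    dist (pt p i w) (pt p i G) + dist (pt p i G) b = dist (pt p i w) b := by
  rcases exists_ray_or_ne i b with ⟨t, ht, rfl⟩ | h
  · rw [rayHeight_ray] at hb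
    rw [← pt_of_pos i ht, dist_pt_pt i (hG.trans hw) hG, dist_pt_pt i hG ht.le,
      dist_pt_pt i (hG.trans hw) ht.le, abs_of_nonneg (by linarith), abs_of_nonneg (by linarith),
      abs_of_nonneg (by linarith)]
    ring
  · rw [dist_pt_pt i (hG.trans hw) hG, dist_pt_of_ne h hG, dist_pt_of_ne h (hG.trans hw),
      abs_of_nonneg (by linarith)]
    ring

theorem pt_mem_curtain (hW : CN (AttachRays p)) {h : Set (AttachRays p)} (hc : IsCurtain h) {i : ι}
    {G w : ℝ} (hG : 0 ≤ G) (hw : G ≤ w) (hwh : pt p i w ∈ h) {b : AttachRays p} (hbh : b ∈ h)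
    (hb : rayHeight i b ≤ G) : pt p i G ∈ h := by
  refine hc.mem_of_cut hW (A := {v | ∃ w, G ≤ w ∧ v = pt p i w}) (B := {v | rayHeight i v ≤ G})
    ?_ ?_ ⟨_, hwh, w, hw, rfl⟩ ⟨b, hbh, hb⟩
  · refine eq_univ_of_forall fun v => ?_
    rcases le_or_gt (rayHeight i v) G with h | h
    · exact Or.inr h
    · exact Or.inl ⟨_, h.le, eq_pt_of_rayHeight_pos (hG.trans_lt h)⟩
  · rintro _ ⟨w, hw, rfl⟩ b hb
    exact dist_add_pt hG hw hb

/-- The point at height `A + 1` lies between the two curtains and is a cut point, so it belongs to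
every curtain meeting both. Members of a chain are disjoint, hence at most one of them meets both.
-/
theorem lSeparated_ray (hW : CN (AttachRays p)) (i : ι) {A B : ℝ} (hA : 0 ≤ A) (hAB : A + 2 ≤ B) :
    LSeparated 2 (curtain (Ici 0) (pt p i) A) (curtain (Ici 0) (pt p i) B) := by
  have hmem : ∀ {A : ℝ} {z : AttachRays p}, z ∈ curtain (Ici 0) (pt p i) A →
      rayHeight i z ∈ Icc (A - 1 / 2) (A + 1 / 2) := by
    intro A z hz
    obtain ⟨s, hs, hp⟩ := mem_projPreimage.1 hz
    rwa [(isProj_pt i z).unique hW (isGeodesicOn_pt p i) hp]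
  refine ⟨disjoint_curtain hW (isGeodesicOn_pt p i) ?_, fun n c hc hm => ?_⟩
  · rw [abs_sub_comm, abs_of_nonneg (by linarith)]; linarith
  · have key : ∀ k, pt p i (A + 1) ∈ c k := by
      intro k
      obtain ⟨⟨z, hz, hz1⟩, ⟨z', hz', hz1'⟩⟩ := hm k
      have h1 := hmem hz1
      have h2 := hmem hz1'
      refine pt_mem_curtain hW (hc.1 k) (by linarith) (w := rayHeight i z') (by linarith [h2.1]) ?_ hz
        (by linarith [h1.2])
      rwa [← eq_pt_of_rayHeight_pos (by linarith [h2.1])]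
    by_contra! hn
    exact disjoint_left.1 (hc.2.1 ⟨0, by omega⟩ ⟨1, by omega⟩ (by simp)) (key _) (key _)

theorem rayHeight_sub_le_dL (hW : CN (AttachRays p)) (i : ι) {x y : AttachRays p} {B : ℝ}
    (hB : ChainBound 2 x y B) : (rayHeight i y - rayHeight i x) / 2 ≤ dL 2 x y := by
  rcases le_or_gt (rayHeight i y) (rayHeight i x) with hle | hlt
  · exact le_trans (by linarith) (dL_nonneg 2 x y)
  have hx := rayHeight_nonneg i x
  have hne : x ≠ y := by rintro rfl; exact lt_irrefl _ hlt
  set n := ⌊(rayHeight i y - rayHeight i x) / 2⌋₊ with hn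
  have hn1 : (n : ℝ) ≤ (rayHeight i y - rayHeight i x) / 2 := Nat.floor_le (by linarith)
  have hn2 : (rayHeight i y - rayHeight i x) / 2 < n + 1 := Nat.lt_floor_add_one _
  have hj : ∀ j : Fin n, ((j : ℕ) : ℝ) + 1 ≤ n := fun j => by exact_mod_cast j.2
  have hr : ∀ j : Fin n, Icc (rayHeight i x + 1 + 2 * ((j : ℕ) : ℝ) - 1 / 2)
      (rayHeight i x + 1 + 2 * ((j : ℕ) : ℝ) + 1 / 2) ⊆ interior (Ici (0 : ℝ)) := fun j s hs => by
    rw [interior_Ici, mem_Ioi]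
    have : (0 : ℝ) ≤ ((j : ℕ) : ℝ) := by positivity
    linarith [hs.1]
  -- The offset 1 and the spacing 2 leave room for the half-width `1 / 2` of the curtains at both
  -- ends.
  have hch : IsLChain 2
      (fun j : Fin n => curtain (Ici 0) (pt p i) (rayHeight i x + 1 + 2 * ((j : ℕ) : ℝ))) :=
    isLChain_curtain hW (isGeodesicOn_pt p i) le_rfl hr
      (fun j k h => lSeparated_ray hW i (by positivity) h)
  have := hB.le_dL hne hch fun j => ⟨_, _, _, isCurtainAt_curtain (isGeodesicOn_pt p i) (hr j), ?_, ?_⟩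
  · linarith
  · have : (0 : ℝ) ≤ ((j : ℕ) : ℝ) := by positivity
    rw [singleton_subset_iff]
    exact mem_projPreimage.2 ⟨_, by rw [mem_Iio]; linarith, isProj_pt i x⟩
  · rw [singleton_subset_iff]
    exact mem_projPreimage.2 ⟨_, by rw [mem_Ioi]; linarith [hj j], isProj_pt i y⟩

end General

/-! ### Separated chains along the boundary circle -/

variable {ι : Type*} {p : ι → ParkingLot}

theorem cn_parkingLot (p : ι → ParkingLot) : CN (AttachRays p) :=
  (hasLogMaps ParkingLot.hasLogMaps).cn

theorem isCAT0_parkingLot (p : ι → ParkingLot) : IsCAT0 (AttachRays p) :=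
  (cn_parkingLot p).isCAT0 (exists_geodesic ParkingLot.exists_geodesic)

/-- The angular coordinate of the foot. -/
def ang (u : AttachRays p) : ℝ := u.foot.angle

theorem abs_ang_sub_le (u v : AttachRays p) : |u.ang - v.ang| ≤ dist u v := by
  by_cases h : OnSameRay u v
  · obtain ⟨i, s, t, hs, ht, rfl, rfl⟩ := h
    simp [ang, foot]
  · rw [dist_eq_of_not_sameRay h]
    linarith [ParkingLot.abs_angle_sub_le u.foot v.foot, u.height_nonneg, v.height_nonneg,
      show |u.ang - v.ang| = |u.foot.angle - v.foot.angle| from rfl]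

/-- The boundary circle. -/
def circle (p : ι → ParkingLot) (s : ℝ) : AttachRays p := base (ParkingLot.circ s)

theorem isGeodesicOn_circle (p : ι → ParkingLot) : IsGeodesicOn univ (circle p) :=
  ⟨isClosed_univ, ordConnected_univ, fun s _ t _ => ParkingLot.dist_circ s t⟩

theorem isProj_circle (u : AttachRays p) : IsProj univ (circle p) u u.ang := by
  refine ⟨mem_univ _, fun t _ => ?_⟩
  rw [dist_comm, dist_comm u, circle, circle, dist_base, dist_base,
    ParkingLot.dist_eq_of_angle_eq (x := ParkingLot.circ u.ang) (y := u.foot) rfl]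
  exact add_le_add_left (ParkingLot.abs_radius_sub_le (ParkingLot.circ t) u.foot) _

theorem dist_add_circle {u v : AttachRays p} {T : ℝ} (hu : u.ang + Real.pi / 2 ≤ T)
    (hv : T + Real.pi / 2 ≤ v.ang) : dist u (circle p T) + dist (circle p T) v = dist u v := by
  have hns : ¬ OnSameRay u v := by
    rintro ⟨i, s, t, hs, ht, rfl, rfl⟩
    have := Real.pi_pos
    simp only [ang, foot] at hu hv
    linarith
  rw [dist_eq_of_not_sameRay hns, dist_comm u, circle, dist_base, dist_base,
    ← ParkingLot.dist_add_circ hu hv, dist_comm u.foot]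
  ring

/-- A point of the circle is not a cut point of the whole space; it blocks only geodesics between
points at least `π / 2 < 2` away in angle on either side. As the pole has length 1, it must be far
in angle from `z` or from `z'`, and each alternative supplies its own point of the circle. -/
theorem circle_mem_of_meets {h : Set (AttachRays p)} (hc : IsCurtain h) {A : ℝ} {z z' : AttachRays p}
    (hz : z ∈ h) (hz' : z' ∈ h) (hA : z.ang ≤ A + 1 / 2) (hA' : A + 39 / 2 ≤ z'.ang) :
    circle p (A + 5 / 2) ∈ h ∨ circle p (A + 10) ∈ h := by
  obtain ⟨I, α, r, hc⟩ := hc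
  obtain ⟨s, hs, hp⟩ := hc.mem_iff.1 hz
  obtain ⟨s', hs', hp'⟩ := hc.mem_iff.1 hz'
  have hpi := Real.pi_lt_four
  -- In the first case the angle `A + 5 / 2` is at least 2 away from both `z` and its projection. In
  -- the second the projection of `z'` has angle at most `A + 11 / 2`, and `A + 10` separates it
  -- from `z'` with room to spare.
  rcases le_or_gt (A + 9 / 2) (α s).ang with h1 | h1
  · exact Or.inl (hc.mem_iff.2 ⟨s, hs, hp.of_between (dist_add_circle (by linarith) (by linarith))⟩)
  · have h2 := abs_ang_sub_le (α s) (α s')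
    rw [hc.1.2.2 s (hc.Icc_subset hs) s' (hc.Icc_subset hs')] at h2
    have h3 : |s - s'| ≤ 1 := abs_le.2 ⟨by linarith [hs.1, hs'.2], by linarith [hs.2, hs'.1]⟩
    have h4 := (abs_le.1 (h2.trans h3)).1
    refine Or.inr (hc.mem_iff.2 ⟨s', hs', hp'.of_between ?_⟩)
    rw [dist_comm z' (circle p _), dist_comm (circle p _) (α s'), dist_comm z' (α s'), add_comm]
    exact dist_add_circle (by linarith) (by linarith)

/-- Each member of a chain meeting both curtains contains one of two fixed points of the circle, and
disjoint members cannot share one. The gap 20, less the two half-widths, leaves the angle `39 / 2 -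
1 / 2` required by `circle_mem_of_meets`. -/
theorem lSeparated_circle {A B : ℝ} (hAB : A + 20 ≤ B) :
    LSeparated 2 (curtain univ (circle p) A) (curtain univ (circle p) B) := by
  have hmem : ∀ {A : ℝ} {z : AttachRays p}, z ∈ curtain univ (circle p) A →
      z.ang ∈ Icc (A - 1 / 2) (A + 1 / 2) := by
    intro A z hz
    obtain ⟨s, hs, hp⟩ := mem_projPreimage.1 hz
    rwa [(isProj_circle z).unique (cn_parkingLot p) (isGeodesicOn_circle p) hp]
  refine ⟨disjoint_curtain (cn_parkingLot p) (isGeodesicOn_circle p) ?_, fun n c hc hm => ?_⟩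
  · rw [abs_sub_comm, abs_of_nonneg (by linarith)]; linarith
  · have key : ∀ k, ∃ b : Bool, circle p (if b then A + 5 / 2 else A + 10) ∈ c k := by
      intro k
      obtain ⟨⟨z, hz, hz1⟩, ⟨z', hz', hz1'⟩⟩ := hm k
      rcases circle_mem_of_meets (hc.1 k) hz hz' (hmem hz1).2 (by linarith [(hmem hz1').1]) with h | h
      · exact ⟨true, by simpa using h⟩
      · exact ⟨false, by simpa using h⟩
    choose f hf using key
    have hinj : Function.Injective f := by
      intro i j hij
      by_contra hne
      have := hf j
      rw [← hij] at this
      exact disjoint_left.1 (hc.2.1 i j hne) (hf i) this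
    simpa using Fintype.card_le_of_injective f hinj

theorem ang_sub_le_dL {x y : AttachRays p} {B : ℝ} (hB : ChainBound 2 x y B) :
    (y.ang - x.ang) / 20 ≤ dL 2 x y := by
  rcases le_or_gt y.ang x.ang with hle | hlt
  · exact le_trans (by linarith) (dL_nonneg 2 x y)
  have hne : x ≠ y := by rintro rfl; exact lt_irrefl _ hlt
  set n := ⌊(y.ang - x.ang) / 20⌋₊ with hn
  have hn1 : (n : ℝ) ≤ (y.ang - x.ang) / 20 := Nat.floor_le (by linarith)
  have hn2 : (y.ang - x.ang) / 20 < n + 1 := Nat.lt_floor_add_one _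
  have hj : ∀ j : Fin n, ((j : ℕ) : ℝ) + 1 ≤ n := fun j => by exact_mod_cast j.2
  have hr : ∀ j : Fin n, Icc (x.ang + 10 + 20 * ((j : ℕ) : ℝ) - 1 / 2)
      (x.ang + 10 + 20 * ((j : ℕ) : ℝ) + 1 / 2) ⊆ interior (univ : Set ℝ) := fun j s _ => by
    rw [interior_univ]; trivial
  have hch : IsLChain 2
      (fun j : Fin n => curtain univ (circle p) (x.ang + 10 + 20 * ((j : ℕ) : ℝ))) :=
    isLChain_curtain (cn_parkingLot p) (isGeodesicOn_circle p) (by norm_num) hr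
      (fun j k h => lSeparated_circle h)
  have := hB.le_dL hne hch fun j => ⟨_, _, _, isCurtainAt_curtain (isGeodesicOn_circle p) (hr j), ?_, ?_⟩
  · linarith
  · have : (0 : ℝ) ≤ ((j : ℕ) : ℝ) := by positivity
    rw [singleton_subset_iff]
    exact mem_projPreimage.2 ⟨_, by rw [mem_Iio]; linarith, isProj_circle x⟩
  · rw [singleton_subset_iff]
    exact mem_projPreimage.2 ⟨_, by rw [mem_Ioi]; linarith [hj j], isProj_circle y⟩

end AttachRays

/-! ## Upper bounds for separated chains -/

namespace ParkingLot

theorem abs_angle_sub_le_tang {x : ParkingLot} {β : ℝ} (h1 : |x.angle - β| < Real.pi / 2)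
    (h2 : 1 ≤ x.radius * Real.cos (x.angle - β)) : |x.angle - β| ≤ x.tang := by
  by_contra! h
  have := Real.cos_lt_cos_of_nonneg_of_le_pi x.tang_nonneg (by linarith [Real.pi_pos]) h
  rw [Real.cos_abs] at this
  have := mul_lt_mul_of_pos_left this x.radius_pos
  rw [radius_mul_cos_tang] at this
  linarith

theorem sq_dist_pos_of_re {x y : ParkingLot} {ρ : ℝ}
    (h : x.radius * Real.cos (x.angle - y.angle) = ρ) :
    dist x.pos y.pos ^ 2 = x.radius ^ 2 - ρ ^ 2 + (y.radius - ρ) ^ 2 := by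
  rw [sq_dist_pos, Real.sin_sq_eq_half_sub, mul_div_cancel₀ _ two_ne_zero, ← h]
  ring

/-- The point of radius `1 + s` on the radial geodesic ray at the angle `k`. -/
def radialPt (k s : ℝ) : ParkingLot := ⟨k, 1 + max s 0, by linarith [le_max_right s 0]⟩

theorem radialPt_angle (k s : ℝ) : (radialPt k s).angle = k := rfl

theorem radialPt_radius (k : ℝ) {s : ℝ} (hs : 0 ≤ s) : (radialPt k s).radius = 1 + s := by
  change 1 + max s 0 = 1 + s
  rw [max_eq_left hs]

theorem abs_lt_of_cos_pos {x : ℝ} (h : |x| ≤ Real.pi + Real.pi / 2) (hc : 0 < Real.cos x) :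
    |x| < Real.pi / 2 := by
  by_contra! h'
  have := Real.cos_nonpos_of_pi_div_two_le_of_le h' h
  rw [Real.cos_abs] at this
  linarith

/-- If the segment around `q = β r` is geodesic then there is a direction `n` at `q`, pointing away
from the disc, such that the points in this direction project to `q`. -/
theorem exists_normal {β : ℝ → ParkingLot} {r : ℝ}
    (hβ : ∀ s ∈ Icc (r - 1 / 2) (r + 1 / 2), ∀ t ∈ Icc (r - 1 / 2) (r + 1 / 2),
      dist (β s) (β t) = |s - t|) :
    ∃ n : ℂ, ‖n‖ = 1 ∧ 0 ≤ n.re ∧ ∀ τ : ℝ, 0 ≤ τ → ∀ z : ParkingLot, logAt (β r) z = τ * n →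
      ∀ s ∈ Icc (r - 1 / 2) (r + 1 / 2), dist z (β r) ≤ dist z (β s) := by
  have m0 : r ∈ Icc (r - 1 / 2) (r + 1 / 2) := ⟨by linarith, by linarith⟩
  have m1 : r - 1 / 2 ∈ Icc (r - 1 / 2) (r + 1 / 2) := ⟨by linarith, by linarith⟩
  have m2 : r + 1 / 2 ∈ Icc (r - 1 / 2) (r + 1 / 2) := ⟨by linarith, by linarith⟩
  -- Points of the segment on the two sides of `q` have opposite logarithms, since `logAt` keeps
  -- their distance. Comparing with the two endpoints puts the logarithm of the whole segment on the
  -- line through `v`.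
  have anti : ∀ s ∈ Icc (r - 1 / 2) (r + 1 / 2), ∀ t ∈ Icc (r - 1 / 2) (r + 1 / 2), s ≤ r → r ≤ t →
      ∃ v : ℂ, ‖v‖ = 1 ∧ logAt (β r) (β s) = -(((r - s : ℝ) : ℂ) * v) ∧
        logAt (β r) (β t) = ((t - r : ℝ) : ℂ) * v := by
    intro s hs t ht h1 h2
    have e1 := hβ s hs r m0
    have e2 := hβ r m0 t ht
    have e3 := hβ s hs t ht
    rw [abs_sub_comm, abs_of_nonneg (by linarith)] at e1 e2 e3
    have e4 := dist_logAt_of_between (x := β s) (z := β r) (y := β t) (by linarith)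
    obtain ⟨v, hv, a1, a2⟩ := exists_unit_of_norm_sub_eq (A := logAt (β r) (β s))
      (B := logAt (β r) (β t)) (by rw [← dist_eq_norm, e4, norm_logAt, norm_logAt, dist_comm (β r)]; linarith)
    refine ⟨v, hv, ?_, ?_⟩
    · rwa [norm_logAt, dist_comm, e1] at a1
    · rwa [norm_logAt, e2] at a2
  obtain ⟨v, hv, a1, a2⟩ := anti _ m1 _ m2 (by linarith) (by linarith)
  have hlin : ∀ s ∈ Icc (r - 1 / 2) (r + 1 / 2), ∃ c : ℝ, logAt (β r) (β s) = c * v := by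
    intro s hs
    rcases le_total s r with h | h
    · obtain ⟨v', -, b1, b2⟩ := anti s hs _ m2 h (by linarith)
      refine ⟨-(r - s), ?_⟩
      have : v' = v := by
        rw [a2] at b2
        exact (mul_left_cancel₀ (by simp) b2).symm
      rw [b1, this]; push_cast; ring
    · obtain ⟨v', -, b1, b2⟩ := anti _ m1 s hs (by linarith) h
      refine ⟨s - r, ?_⟩
      have : v' = v := by
        rw [a1] at b1
        exact (mul_left_cancel₀ (by simp) (neg_injective b1)).symm
      rw [b2, this]
  -- If the logarithm of `z` is orthogonal to that line, the origin is the closest point of the line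
  -- in the plane. The distance from `z` to `q` is exact and all others can only be larger than in
  -- the plane.
  have perp : ∀ (n : ℂ), n = Complex.I * v ∨ n = -(Complex.I * v) → ∀ τ : ℝ, 0 ≤ τ →
      ∀ z : ParkingLot, logAt (β r) z = τ * n →
      ∀ s ∈ Icc (r - 1 / 2) (r + 1 / 2), dist z (β r) ≤ dist z (β s) := by
    intro n hn τ hτ z hz s hs
    obtain ⟨c, hc⟩ := hlin s hs
    have e1 : dist z (β r) = τ := by
      rw [dist_comm, ← norm_logAt, hz, norm_mul, Complex.norm_real, Real.norm_of_nonneg hτ]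
      rcases hn with rfl | rfl <;> simp [hv]
    refine le_trans ?_ (dist_logAt_le (β r) z (β s))
    rw [e1, hz, hc, dist_eq_norm]
    rcases hn with rfl | rfl
    · rw [show (τ : ℂ) * (Complex.I * v) - c * v = (-c + τ * Complex.I) * v by ring, norm_mul, hv,
        mul_one]
      refine le_trans ?_ (Complex.abs_im_le_norm _)
      simp [le_abs_self]
    · rw [show (τ : ℂ) * -(Complex.I * v) - c * v = -((c + τ * Complex.I) * v) by ring, norm_neg,
        norm_mul, hv, mul_one]
      refine le_trans ?_ (Complex.abs_im_le_norm _)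
      simp [le_abs_self]
  -- One of the two unit normals does not point into the disc; the straight ray in that direction
  -- stays in the half-plane beyond the tangent line.
  rcases le_total 0 (Complex.I * v).re with h | h
  · exact ⟨_, by simp [hv], h, perp _ (Or.inl rfl)⟩
  · exact ⟨-(Complex.I * v), by simp [hv], by rw [Complex.neg_re]; linarith, perp _ (Or.inr rfl)⟩

theorem logAt_ofHalfPlane (q : ParkingLot) (w : ℂ) (hw : 1 ≤ w.re) :
    logAt q (ofHalfPlane q.angle w hw) = w - q.radius := by
  have h := abs_angle_sub_le_tang_ofHalfPlane q.angle w hw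
  rw [logAt_visible (h.trans (by linarith [q.tang_nonneg])), pos_ofHalfPlane, pos_eq,
    mul_comm (q.radius : ℂ), ← mul_sub, ← mul_assoc, ← Complex.exp_add, neg_mul, neg_add_cancel,
    Complex.exp_zero, one_mul]

theorem radius_mul_cos_ofHalfPlane (β k : ℝ) (w : ℂ) (hw : 1 ≤ w.re) :
    (ofHalfPlane β w hw).radius * Real.cos ((ofHalfPlane β w hw).angle - k)
      = w.re * Real.cos (k - β) + w.im * Real.sin (k - β) := by
  simp only [ofHalfPlane]
  rw [show β + w.arg - k = w.arg - (k - β) by ring, Real.cos_sub]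
  have h1 := Complex.norm_mul_cos_arg w
  have h2 := Complex.norm_mul_sin_arg w
  rw [mul_add, ← mul_assoc, ← mul_assoc, h1, h2]

end ParkingLot

/-! ### Curtains going to infinity -/

namespace AttachRays

variable {ι : Type*} {p : ι → ParkingLot}

/-- The set `h` goes to infinity in the direction of the angle `k`: it meets every line far out
which is orthogonal to this direction. -/
def HasEnd (h : Set (AttachRays p)) (k : ℤ) : Prop :=
  ∃ ρ₀ : ℝ, ∀ ρ ≥ ρ₀, ∃ z : ParkingLot, base z ∈ h ∧ |z.angle - k| < Real.pi / 2 ∧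
    z.radius * Real.cos (z.angle - k) = ρ

/-- The radial geodesic ray at the angle `k`. -/
def radial (p : ι → ParkingLot) (k s : ℝ) : AttachRays p := base (ParkingLot.radialPt k s)

theorem isGeodesicOn_radial (p : ι → ParkingLot) (k : ℝ) : IsGeodesicOn (Ici 0) (radial p k) := by
  refine ⟨isClosed_Ici, ordConnected_Ici, fun s hs t ht => ?_⟩
  rw [radial, radial, dist_base_base, ParkingLot.dist_eq_of_angle_eq
    (x := ParkingLot.radialPt k s) (y := ParkingLot.radialPt k t) rfl,
    ParkingLot.radialPt_radius k hs, ParkingLot.radialPt_radius k ht, add_sub_add_left_eq_sub]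

theorem isProj_radial {k s : ℝ} (hs : 0 ≤ s) {z : ParkingLot} (h1 : |z.angle - k| < Real.pi / 2)
    (h2 : z.radius * Real.cos (z.angle - k) = 1 + s) :
    IsProj (Ici 0) (radial p k) (base z) s := by
  refine ⟨hs, fun t ht => ?_⟩
  rw [radial, radial, dist_base_base, dist_base_base]
  refine le_trans ?_ (ParkingLot.dist_pos_le _ _)
  have hz := ParkingLot.abs_angle_sub_le_tang h1 (by linarith)
  rw [ParkingLot.dist_eq_of_halfPlane (β := k) hz
    (by rw [ParkingLot.radialPt_angle, sub_self, abs_zero]; exact ParkingLot.tang_nonneg _)]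
  apply le_of_sq_le_sq _ dist_nonneg
  rw [ParkingLot.sq_dist_pos_of_re (x := z) (y := ParkingLot.radialPt k s) h2,
    ParkingLot.sq_dist_pos_of_re (x := z) (y := ParkingLot.radialPt k t) h2,
    ParkingLot.radialPt_radius k hs]
  nlinarith [sq_nonneg ((ParkingLot.radialPt k t).radius - (1 + s))]

/-- Far out, the curtains dual to the radial ray at the angle `k` contain the lines orthogonal to
it, and both `h` and `h'` meet all of these. So `L + 1` such curtains at spacing 2 form a chain
crossing both. The parameter on the radial ray is the radius minus 1. -/
theorem HasEnd.not_lSeparated {h h' : Set (AttachRays p)} {k : ℤ} (hk : HasEnd h k)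
    (hk' : HasEnd h' k) (L : ℕ) : ¬ LSeparated L h h' := by
  rintro ⟨-, hs⟩
  obtain ⟨ρ₀, hρ⟩ := hk
  obtain ⟨ρ₁, hρ'⟩ := hk'
  set r := max 1 (max ρ₀ ρ₁) with hr
  have r1 : 1 ≤ r := le_max_left _ _
  have r2 : ρ₀ ≤ r := (le_max_left _ _).trans (le_max_right _ _)
  have r3 : ρ₁ ≤ r := (le_max_right _ _).trans (le_max_right _ _)
  have hch : IsCurtainChain
      (fun j : Fin (L + 1) => curtain (Ici 0) (radial p k) (r + 2 * ((j : ℕ) : ℝ))) := by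
    refine isCurtainChain_curtain (cn_parkingLot p) (isGeodesicOn_radial p k) le_rfl fun j s hs => ?_
    have : (0 : ℝ) ≤ ((j : ℕ) : ℝ) := by positivity
    rw [interior_Ici, mem_Ioi]
    linarith [hs.1]
  have := hs _ _ hch fun j => ?_
  · omega
  have hj : (0 : ℝ) ≤ ((j : ℕ) : ℝ) := by positivity
  have meet : ∀ z : ParkingLot, |z.angle - k| < Real.pi / 2 →
      z.radius * Real.cos (z.angle - k) = 1 + (r + 2 * ((j : ℕ) : ℝ)) →
      (base z : AttachRays p) ∈ curtain (Ici 0) (radial p k) (r + 2 * ((j : ℕ) : ℝ)) :=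
    fun z h1 h2 => mem_projPreimage.2 ⟨_, ⟨by linarith, by linarith⟩,
      isProj_radial (by linarith) h1 h2⟩
  obtain ⟨z, hz, h1, h2⟩ := hρ (1 + (r + 2 * ((j : ℕ) : ℝ))) (by linarith)
  obtain ⟨z', hz', h1', h2'⟩ := hρ' (1 + (r + 2 * ((j : ℕ) : ℝ))) (by linarith)
  exact ⟨⟨_, meet z h1 h2, hz⟩, ⟨_, meet z' h1' h2', hz'⟩⟩

/-- The outward straight ray from the middle of the pole at a right angle to it projects to that
middle point, so it lies in the curtain, and it has a positive component in a nearby integral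
direction. -/
theorem exists_hasEnd {h : Set (AttachRays p)} {I : Set ℝ} {α : ℝ → AttachRays p} {r : ℝ}
    (hc : IsCurtainAt h I α r) {β : ℝ → ParkingLot}
    (hβ : ∀ s ∈ Icc (r - 1 / 2) (r + 1 / 2), α s = base (β s)) :
    ∃ k : ℤ, HasEnd h k ∧ |(k : ℝ) - (β r).angle| ≤ 3 := by
  have m0 : r ∈ Icc (r - 1 / 2) (r + 1 / 2) := ⟨by linarith, by linarith⟩
  obtain ⟨n, hn, hre, hproj⟩ := ParkingLot.exists_normal (β := β) (r := r) (by
    intro s hs t ht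
    rw [← dist_base_base (p := p), ← hβ s hs, ← hβ t ht,
      hc.1.2.2 s (hc.Icc_subset hs) t (hc.Icc_subset ht)])
  set q := β r with hq
  have hw : ∀ τ : ℝ, 0 ≤ τ → 1 ≤ ((q.radius : ℂ) + τ * n).re := fun τ hτ => by
    rw [Complex.add_re, Complex.ofReal_re, Complex.re_ofReal_mul]
    linarith [q.one_le_radius, mul_nonneg hτ hre]
  have hmem : ∀ (τ : ℝ) (hτ : 0 ≤ τ),
      (base (ParkingLot.ofHalfPlane q.angle _ (hw τ hτ)) : AttachRays p) ∈ h := fun τ hτ => by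
    refine hc.mem_iff.2 ⟨r, m0, isProj_of_local (cn_parkingLot p) hc.1 (by norm_num : (0 : ℝ) < 1 / 2)
      (hc.Icc_subset m0) fun s hs => ?_⟩
    rw [hβ r m0, hβ s hs, dist_base_base, dist_base_base]
    exact hproj τ hτ _ (by rw [ParkingLot.logAt_ofHalfPlane, add_sub_cancel_left]) s hs
  have harg := Complex.abs_arg_le_pi_div_two_iff.2 hre
  -- Rounding the direction of the normal leaves an angle of at most `1 / 2`, so its component along
  -- `k` is positive. Integral directions are what make the later count finite.
  set k : ℤ := round (q.angle + n.arg) with hk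
  have hround : |q.angle + n.arg - k| ≤ 1 / 2 := abs_sub_round _
  have hpi := Real.pi_gt_three
  have hpi4 := Real.pi_lt_four
  have hkq : |(k : ℝ) - q.angle| ≤ Real.pi / 2 + 1 / 2 := by
    have h1 := abs_le.1 harg
    have h2 := abs_le.1 hround
    exact abs_le.2 ⟨by linarith, by linarith⟩
  refine ⟨k, ?_, hkq.trans (by linarith)⟩
  set b := Real.cos (q.angle + n.arg - k) with hb
  have hb0 : 0 < b := by
    have h2 := abs_le.1 hround
    exact Real.cos_pos_of_mem_Ioo ⟨by linarith, by linarith⟩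
  set a := q.radius * Real.cos (k - q.angle) with ha
  refine ⟨max a 1, fun ρ hρ => ?_⟩
  have hρa : a ≤ ρ := (le_max_left _ _).trans hρ
  have hρ1 : 1 ≤ ρ := (le_max_right _ _).trans hρ
  have hτ : 0 ≤ (ρ - a) / b := div_nonneg (by linarith) hb0.le
  -- The component of `q + τ n` in the direction `k` is `a + τ b`; solve for `ρ`.
  set τ := (ρ - a) / b with hτd
  have hval : (ParkingLot.ofHalfPlane q.angle _ (hw τ hτ)).radius
      * Real.cos ((ParkingLot.ofHalfPlane q.angle _ (hw τ hτ)).angle - k) = ρ := by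
    rw [ParkingLot.radius_mul_cos_ofHalfPlane]
    have e1 : n.re * Real.cos (k - q.angle) + n.im * Real.sin (k - q.angle) = b := by
      rw [hb, show q.angle + n.arg - k = n.arg - (k - q.angle) by ring, Real.cos_sub n.arg]
      have h1 := Complex.norm_mul_cos_arg n
      have h2 := Complex.norm_mul_sin_arg n
      rw [hn, one_mul] at h1 h2
      rw [h1, h2]
    simp only [Complex.add_re, Complex.add_im, Complex.ofReal_re, Complex.ofReal_im,
      Complex.re_ofReal_mul, Complex.im_ofReal_mul]
    have e2 : τ * b = ρ - a := by rw [hτd]; field_simp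
    rw [ha] at e2
    linear_combination τ * e1 + e2
  refine ⟨_, hmem τ hτ, ?_, hval⟩
  refine ParkingLot.abs_lt_of_cos_pos ?_ ?_
  · have h3 := ParkingLot.abs_angle_sub_le_tang_ofHalfPlane q.angle _ (hw τ hτ)
    have h4 := (ParkingLot.ofHalfPlane q.angle _ (hw τ hτ)).tang_lt
    have h5 := abs_le.1 (h3.trans h4.le)
    have h6 := abs_le.1 hkq
    exact abs_le.2 ⟨by linarith, by linarith⟩
  · have h3 := (ParkingLot.ofHalfPlane q.angle _ (hw τ hτ)).radius_pos
    by_contra! h4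
    linarith [mul_nonpos_of_nonneg_of_nonpos h3.le h4]

/-- An angular distance of `4 > π` puts the points in each other's shadow, and there the
contribution of `b` to the distance does not depend on the other point, so it cancels. The closeness
of `b` and `b'` rules out their being on opposite sides. -/
theorem dist_sub_eq_of_shadow {x y b : ParkingLot}
    (h : (x.angle + 4 ≤ b.angle ∧ y.angle + 4 ≤ b.angle) ∨
      (b.angle + 4 ≤ x.angle ∧ b.angle + 4 ≤ y.angle)) {b' : ParkingLot}
    (h' : (x.angle + 4 ≤ b'.angle ∧ y.angle + 4 ≤ b'.angle) ∨
      (b'.angle + 4 ≤ x.angle ∧ b'.angle + 4 ≤ y.angle)) (hbb : |b.angle - b'.angle| ≤ 1) :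
    dist x b - dist y b = dist x b' - dist y b' := by
  have hpi := Real.pi_lt_four
  have hx := x.tang_lt
  have hy := y.tang_lt
  have hb := b.tang_lt
  have hb' := b'.tang_lt
  have hbb' := abs_le.1 hbb
  rcases h with ⟨h1, h2⟩ | ⟨h1, h2⟩ <;> rcases h' with ⟨h3, h4⟩ | ⟨h3, h4⟩
  · rw [ParkingLot.dist_eq_of_shadow (x := x) (y := b) (by linarith),
      ParkingLot.dist_eq_of_shadow (x := y) (y := b) (by linarith),
      ParkingLot.dist_eq_of_shadow (x := x) (y := b') (by linarith),
      ParkingLot.dist_eq_of_shadow (x := y) (y := b') (by linarith)]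
    ring
  · linarith
  · linarith
  · rw [dist_comm x b, dist_comm y b, dist_comm x b', dist_comm y b',
      ParkingLot.dist_eq_of_shadow (x := b) (y := x) (by linarith),
      ParkingLot.dist_eq_of_shadow (x := b) (y := y) (by linarith),
      ParkingLot.dist_eq_of_shadow (x := b') (y := x) (by linarith),
      ParkingLot.dist_eq_of_shadow (x := b') (y := y) (by linarith)]
    ring

/-- If the pole lay far outside the range of angles of `x` and `y`, two of its points would have the
same difference of distances to `x` and `y`. Half of the pole changes the angle by at most `1 / 2`,
so the margin 5 exceeds the required 4. -/
theorem angle_mem_of_injOn {I : Set ℝ} {α : ℝ → AttachRays p} {r : ℝ} {h : Set (AttachRays p)}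
    (hc : IsCurtainAt h I α r) {x y : AttachRays p}
    (hinj : InjOn (fun s => dist x (α s) - dist y (α s)) (Icc (r - 1 / 2) (r + 1 / 2)))
    {β : ℝ → ParkingLot} (hβ : ∀ s ∈ Icc (r - 1 / 2) (r + 1 / 2), α s = base (β s)) :
    (β r).angle ∈ Icc (min x.ang y.ang - 5) (max x.ang y.ang + 5) := by
  have m0 : r ∈ Icc (r - 1 / 2) (r + 1 / 2) := ⟨by linarith, by linarith⟩
  have m2 : r + 1 / 2 ∈ Icc (r - 1 / 2) (r + 1 / 2) := ⟨by linarith, by linarith⟩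
  have hd : dist (β r) (β (r + 1 / 2)) = 1 / 2 := by
    rw [← dist_base_base (p := p), ← hβ _ m0, ← hβ _ m2,
      hc.1.2.2 _ (hc.Icc_subset m0) _ (hc.Icc_subset m2)]
    norm_num
  have hl := ParkingLot.abs_angle_sub_le (β r) (β (r + 1 / 2))
  rw [hd] at hl
  have hl' := abs_le.1 hl
  have dx : ∀ (u : AttachRays p) (s : ℝ), s ∈ Icc (r - 1 / 2) (r + 1 / 2) →
      dist u (α s) = dist u.foot (β s) + u.height := fun u s hs => by
    rw [hβ s hs, dist_comm, dist_base, dist_comm]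
  have contra : dist x.foot (β r) - dist y.foot (β r)
      ≠ dist x.foot (β (r + 1 / 2)) - dist y.foot (β (r + 1 / 2)) := by
    intro e
    have := hinj m0 m2 (by
      simp only
      rw [dx x r m0, dx y r m0, dx x _ m2, dx y _ m2]; linarith)
    linarith
  have hmx : x.foot.angle ≤ max x.ang y.ang := le_max_left _ _
  have hmy : y.foot.angle ≤ max x.ang y.ang := le_max_right _ _
  have hnx : min x.ang y.ang ≤ x.foot.angle := min_le_left _ _
  have hny : min x.ang y.ang ≤ y.foot.angle := min_le_right _ _
  constructor
  · by_contra! hlt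
    exact contra (dist_sub_eq_of_shadow (Or.inr ⟨by linarith, by linarith⟩)
      (Or.inr ⟨by linarith, by linarith⟩) (hl.trans (by norm_num)))
  · by_contra! hlt
    exact contra (dist_sub_eq_of_shadow (Or.inl ⟨by linarith, by linarith⟩)
      (Or.inl ⟨by linarith, by linarith⟩) (hl.trans (by norm_num)))

theorem exists_dist_pt_eq (i : ι) (v : AttachRays p) :
    ∃ C : ℝ, ∀ w, rayHeight i v ≤ w → dist v (pt p i w) = w + C := by
  refine ⟨dist v (pt p i (rayHeight i v)) - rayHeight i v, fun w hw => ?_⟩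
  have h0 := rayHeight_nonneg i v
  have := dist_add_pt h0 hw (le_refl (rayHeight i v))
  rw [dist_pt_pt i (h0.trans hw) h0, abs_of_nonneg (by linarith)] at this
  rw [dist_comm v, dist_comm v]; linarith

/-- Above both `x` and `y` on a ray, the two distances grow at the same rate, so their difference
would be constant near this point of the pole. -/
theorem height_le_of_injOn {I : Set ℝ} {α : ℝ → AttachRays p} {r : ℝ} {h : Set (AttachRays p)}
    (hc : IsCurtainAt h I α r) {x y : AttachRays p}
    (hinj : InjOn (fun s => dist x (α s) - dist y (α s)) (Icc (r - 1 / 2) (r + 1 / 2)))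
    {s : ℝ} (hs : s ∈ Icc (r - 1 / 2) (r + 1 / 2)) {i : ι} {w : ℝ} {hw : 0 < w}
    (e : α s = ray i w hw) : w ≤ rayHeight i x ∨ w ≤ rayHeight i y := by
  by_contra! hlt
  obtain ⟨h1, h2⟩ := hlt
  obtain ⟨Cx, hCx⟩ := exists_dist_pt_eq i x
  obtain ⟨Cy, hCy⟩ := exists_dist_pt_eq i y
  -- A step of length `ε / 2` along the pole stays on the ray and above both `x` and `y`; the
  -- direction of the step is chosen so as not to leave the pole.
  set ε := min (1 / 2) (min (w - rayHeight i x) (w - rayHeight i y)) with hε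
  have hε0 : 0 < ε := lt_min (by norm_num) (lt_min (by linarith) (by linarith))
  have hε1 : ε ≤ 1 / 2 := min_le_left _ _
  have hε2 : ε ≤ w - rayHeight i x := (min_le_right _ _).trans (min_le_left _ _)
  have hε3 : ε ≤ w - rayHeight i y := (min_le_right _ _).trans (min_le_right _ _)
  obtain ⟨s', hs', hd⟩ : ∃ s' ∈ Icc (r - 1 / 2) (r + 1 / 2), |s - s'| = ε / 2 := by
    rcases le_total s r with h | h
    · exact ⟨s + ε / 2, ⟨by linarith [hs.1], by linarith⟩, by
        rw [sub_add_cancel_left, abs_neg, abs_of_pos (by linarith)]⟩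
    · exact ⟨s - ε / 2, ⟨by linarith, by linarith [hs.2]⟩, by
        rw [sub_sub_cancel, abs_of_pos (by linarith)]⟩
  have hdist := hc.1.2.2 s (hc.Icc_subset hs) s' (hc.Icc_subset hs')
  rw [hd, e] at hdist
  obtain ⟨w', hw', e'⟩ : ∃ w' hw', α s' = ray i w' hw' := by
    rcases exists_ray_or_ne i (α s') with h | h
    · exact h
    · rw [dist_ray_of_ne h] at hdist
      linarith [dist_nonneg (x := base (p i)) (y := α s'), rayHeight_nonneg i x]
  rw [e', dist_ray_same] at hdist
  have hww : w - ε / 2 ≤ w' := by linarith [(abs_le.1 hdist.le).2]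
  have := hinj hs hs' (by
    simp only
    rw [e, e', ← pt_of_pos i hw, ← pt_of_pos i hw', hCx w h1.le, hCx w' (by linarith), hCy w h2.le,
      hCy w' (by linarith)]
    ring)
  rw [this, sub_self, abs_zero] at hd
  linarith

/-- By `pt_mem_curtain` a curtain meets a ray in an interval, which reaches the origin of the ray if
an end of the pole is not on the open ray. Otherwise the ends of the pole are two points of the ray
at distance 1, one of them is at least `1 / 2` away from `v`, and the interval between contains a
half-integer within `1 / 2` of `v`. -/
theorem exists_half_integer_mem {h : Set (AttachRays p)} (hc : IsCurtain h) {i : ι} {v : ℝ}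
    (hv : 0 ≤ v) (hvh : pt p i v ∈ h) :
    pt p i 0 ∈ h ∨ ∃ m : ℕ, |(m : ℝ) / 2 - v| ≤ 1 / 2 ∧ pt p i ((m : ℝ) / 2) ∈ h := by
  obtain ⟨I, α, r, hcα⟩ := id hc
  have m1 : r - 1 / 2 ∈ Icc (r - 1 / 2) (r + 1 / 2) := ⟨by linarith, by linarith⟩
  have m2 : r + 1 / 2 ∈ Icc (r - 1 / 2) (r + 1 / 2) := ⟨by linarith, by linarith⟩
  have q1 := hcα.apply_mem m1
  have q2 := hcα.apply_mem m2
  have hd := hcα.1.2.2 _ (hcα.Icc_subset m1) _ (hcα.Icc_subset m2)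
  have n1 := rayHeight_nonneg i (α (r - 1 / 2))
  have n2 := rayHeight_nonneg i (α (r + 1 / 2))
  have hW := cn_parkingLot p
  rcases n1.eq_or_lt with z1 | p1
  · exact Or.inl (pt_mem_curtain hW hc le_rfl hv hvh q1 z1.symm.le)
  rcases n2.eq_or_lt with z2 | p2
  · exact Or.inl (pt_mem_curtain hW hc le_rfl hv hvh q2 z2.symm.le)
  rw [eq_pt_of_rayHeight_pos p1, eq_pt_of_rayHeight_pos p2, dist_pt_pt i n1 n2,
    show |r - 1 / 2 - (r + 1 / 2)| = 1 by
      rw [show r - 1 / 2 - (r + 1 / 2) = -1 by ring]; norm_num] at hd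
  obtain ⟨w, hw, hwh, hwv⟩ : ∃ w, 0 ≤ w ∧ pt p i w ∈ h ∧ 1 / 2 ≤ |w - v| := by
    rcases le_or_gt (1 / 2) |rayHeight i (α (r - 1 / 2)) - v| with h1 | h1
    · exact ⟨_, n1, by rwa [← eq_pt_of_rayHeight_pos p1], h1⟩
    · refine ⟨_, n2, by rwa [← eq_pt_of_rayHeight_pos p2], ?_⟩
      have := abs_sub_le (rayHeight i (α (r - 1 / 2))) v (rayHeight i (α (r + 1 / 2)))
      rw [abs_sub_comm v] at this
      linarith
  right
  rcases le_abs.1 hwv with h1 | h1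
  · refine ⟨⌈2 * v⌉₊, ?_, ?_⟩
    · have a1 := Nat.le_ceil (2 * v)
      have a2 := Nat.ceil_lt_add_one (by linarith : 0 ≤ 2 * v)
      exact abs_le.2 ⟨by linarith, by linarith⟩
    · have a1 := Nat.le_ceil (2 * v)
      have a2 := Nat.ceil_lt_add_one (by linarith : 0 ≤ 2 * v)
      exact pt_mem_curtain hW hc (by positivity) (w := w) (by linarith) hwh hvh
        (by rw [rayHeight_pt i hv]; linarith)
  · refine ⟨⌊2 * v⌋₊, ?_, ?_⟩
    · have a1 := Nat.floor_le (by linarith : 0 ≤ 2 * v)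
      have a2 := Nat.lt_floor_add_one (2 * v)
      exact abs_le.2 ⟨by linarith, by linarith⟩
    · have a1 := Nat.floor_le (by linarith : 0 ≤ 2 * v)
      have a2 := Nat.lt_floor_add_one (2 * v)
      exact pt_mem_curtain hW hc (by positivity) (w := v) (by linarith) hvh hwh
        (by rw [rayHeight_pt i hw]; linarith)

/-- Pigeonhole: two members cannot share a point because they are disjoint, nor an end because they
are `L`-separated. No dependence on `L` remains. -/
theorem IsLChain.card_le {L n : ℕ} {c : Fin n → Set (AttachRays p)} (hc : IsLChain L c)
    (S : Finset (AttachRays p)) (E : Finset ℤ)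
    (h : ∀ a, (∃ z ∈ S, z ∈ c a) ∨ ∃ k ∈ E, HasEnd (c a) k) : n ≤ S.card + E.card := by
  classical
  have key : ∀ a, ∃ f : AttachRays p ⊕ ℤ, f ∈ S.disjSum E ∧
      Sum.elim (fun z => z ∈ c a) (fun k => HasEnd (c a) k) f := by
    intro a
    rcases h a with ⟨z, hz, hm⟩ | ⟨k, hk, hm⟩
    · exact ⟨Sum.inl z, by simpa using hz, hm⟩
    · exact ⟨Sum.inr k, by simpa using hk, hm⟩
  choose f hf1 hf2 using key
  have hinj : Function.Injective f := by
    intro a b hab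
    by_contra hne
    have h1 := hf2 a
    have h2 := hf2 b
    rw [← hab] at h2
    rcases hfa : f a with z | k
    · rw [hfa] at h1 h2
      exact disjoint_left.1 (hc.1.2.1 a b hne) h1 h2
    · rw [hfa] at h1 h2
      exact HasEnd.not_lSeparated h1 h2 L (hc.2 a b hne)
  have := Finset.card_le_card_of_injOn (s := Finset.univ) (t := S.disjSum E) f
    (fun a _ => hf1 a) hinj.injOn
  simpa using this

open Classical in
/-- The points at half-integral height on the ray of `x`, up to slightly above `x`. -/
def rayMarks : AttachRays p → Finset (AttachRays p)
  | base _ => ∅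
  | ray i u _ => (Finset.range (⌊2 * u⌋₊ + 2)).image fun m : ℕ => pt p i ((m : ℝ) / 2)

theorem card_rayMarks_le (x : AttachRays p) : ((rayMarks x).card : ℝ) ≤ 2 * x.height + 2 := by
  classical
  rcases x with x | ⟨i, u, hu⟩
  · simp [rayMarks, height]
  · have h1 : (rayMarks (ray i u hu : AttachRays p)).card ≤ ⌊2 * u⌋₊ + 2 := by
      simp only [rayMarks]
      exact Finset.card_image_le.trans (by simp)
    have h2 := Nat.floor_le (by linarith : 0 ≤ 2 * u)
    calc ((rayMarks (ray i u hu : AttachRays p)).card : ℝ) ≤ ((⌊2 * u⌋₊ + 2 : ℕ) : ℝ) := by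
          exact_mod_cast h1
      _ ≤ 2 * u + 2 := by push_cast; linarith

theorem exists_rayMark_mem {h : Set (AttachRays p)} (hc : IsCurtain h) {i : ι} {w : ℝ} (hw : 0 < w)
    (hwh : pt p i w ∈ h) {x : AttachRays p} (hx : w ≤ rayHeight i x) : ∃ z ∈ rayMarks x, z ∈ h := by
  rcases exists_ray_or_ne i x with ⟨u, hu, rfl⟩ | hne
  · rw [rayHeight_ray] at hx
    rcases exists_half_integer_mem hc hw.le hwh with h0 | ⟨m, hm, hmh⟩
    · refine ⟨_, ?_, h0⟩
      simp only [rayMarks, Finset.mem_image, Finset.mem_range]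
      exact ⟨0, by omega, by simp⟩
    · refine ⟨_, ?_, hmh⟩
      simp only [rayMarks, Finset.mem_image, Finset.mem_range]
      refine ⟨m, ?_, rfl⟩
      have h1 := (abs_le.1 hm).2
      have h2 := Nat.lt_floor_add_one (2 * u)
      have h3 : (m : ℝ) < ((⌊2 * u⌋₊ + 2 : ℕ) : ℝ) := by push_cast; linarith
      exact_mod_cast h3
  · rw [rayHeight_of_ne hne] at hx
    linarith

theorem chainBound (L : ℕ) (x y : AttachRays p) :
    ChainBound L x y (2 * x.height + 2 * y.height + |x.ang - y.ang| + 21) := by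
  classical
  intro n c hc hs
  -- The margin 8 is the 5 of `angle_mem_of_injOn` plus the 3 of `exists_hasEnd`.
  have hE := IsLChain.card_le hc (rayMarks x ∪ rayMarks y)
    (Finset.Icc ⌈min x.ang y.ang - 8⌉ ⌊max x.ang y.ang + 8⌋) fun a => ?_
  · have h1 : ((rayMarks x ∪ rayMarks y).card : ℝ) ≤ (2 * x.height + 2) + (2 * y.height + 2) := by
      refine le_trans ?_ (add_le_add (card_rayMarks_le x) (card_rayMarks_le y))
      exact_mod_cast Finset.card_union_le _ _
    have h2 : ((Finset.Icc ⌈min x.ang y.ang - 8⌉ ⌊max x.ang y.ang + 8⌋).card : ℝ)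
        ≤ |x.ang - y.ang| + 17 := by
      rw [Int.card_Icc]
      have a1 := Int.floor_le (max x.ang y.ang + 8)
      have a2 := Int.le_ceil (min x.ang y.ang - 8)
      have a3 := max_sub_min_eq_abs x.ang y.ang
      rw [abs_sub_comm] at a3
      have a4 : (((⌊max x.ang y.ang + 8⌋ + 1 - ⌈min x.ang y.ang - 8⌉).toNat : ℤ) : ℝ)
          ≤ |x.ang - y.ang| + 17 := by
        rw [Int.toNat_eq_max]
        push_cast
        exact max_le (by linarith) (by linarith [abs_nonneg (x.ang - y.ang)])
      exact_mod_cast a4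
    have h3 : (n : ℝ) ≤ ((rayMarks x ∪ rayMarks y).card : ℝ)
        + ((Finset.Icc ⌈min x.ang y.ang - 8⌉ ⌊max x.ang y.ang + 8⌋).card : ℝ) := by
      exact_mod_cast hE
    linarith
  · obtain ⟨I, α, r, hcα, hinj⟩ := (hs a).exists_injOn (cn_parkingLot p)
    by_cases hray : ∃ s ∈ Icc (r - 1 / 2) (r + 1 / 2), ∃ i w hw, α s = ray i w hw
    · left
      obtain ⟨s, hsI, i, w, hw, e⟩ := hray
      have hmem := hcα.apply_mem hsI
      rw [e, ← pt_of_pos i hw] at hmem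
      rcases height_le_of_injOn hcα hinj hsI e with h | h
      · obtain ⟨z, hz, hzm⟩ := exists_rayMark_mem (hc.1.1 a) hw hmem h
        exact ⟨z, Finset.mem_union_left _ hz, hzm⟩
      · obtain ⟨z, hz, hzm⟩ := exists_rayMark_mem (hc.1.1 a) hw hmem h
        exact ⟨z, Finset.mem_union_right _ hz, hzm⟩
    · right
      have hβ : ∀ s ∈ Icc (r - 1 / 2) (r + 1 / 2), α s = base (α s).foot := by
        intro s hsI
        rcases e : α s with z | ⟨i, w, hw⟩
        · rfl
        · exact absurd ⟨s, hsI, i, w, hw, e⟩ hray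
      obtain ⟨k, hk, hkr⟩ := exists_hasEnd hcα hβ
      have hang := angle_mem_of_injOn hcα hinj hβ
      have hkr' := abs_le.1 hkr
      refine ⟨k, Finset.mem_Icc.2 ⟨Int.ceil_le.2 ?_, Int.le_floor.2 ?_⟩, hk⟩
      · linarith [hang.1]
      · linarith [hang.2]

/-- For two points of one ray, `chainBound` is too weak: it involves the sum of the heights instead
of their difference. -/
theorem chainBound_ray (L : ℕ) (i : ι) {u v : ℝ} (hu : 0 < u) (huv : u ≤ v) (hv : 0 < v) :
    ChainBound L (ray i u hu : AttachRays p) (ray i v hv) (2 * (v - u) + 4) := by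
  classical
  intro n c hc hs
  have hE := IsLChain.card_le hc (((insert 0 (Finset.Icc ⌈2 * u - 1⌉₊ ⌊2 * v + 1⌋₊)).image
    fun m : ℕ => pt p i ((m : ℝ) / 2))) ∅ fun a => ?_
  · rw [Finset.card_empty, add_zero] at hE
    have h1 : n ≤ (⌊2 * v + 1⌋₊ + 1 - ⌈2 * u - 1⌉₊) + 1 :=
      hE.trans (Finset.card_image_le.trans ((Finset.card_insert_le _ _).trans
        (by rw [Nat.card_Icc])))
    have a1 := Nat.floor_le (by linarith : 0 ≤ 2 * v + 1)
    have a2 := Nat.le_ceil (2 * u - 1)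
    have a3 : ⌈2 * u - 1⌉₊ ≤ ⌊2 * v + 1⌋₊ + 1 := by
      apply Nat.ceil_le.2
      push_cast
      linarith [Nat.lt_floor_add_one (2 * v + 1)]
    have h2 : (n : ℝ) ≤ ((⌊2 * v + 1⌋₊ + 1 - ⌈2 * u - 1⌉₊ : ℕ) : ℝ) + 1 := by exact_mod_cast h1
    rw [Nat.cast_sub a3] at h2
    push_cast at h2
    linarith
  · left
    obtain ⟨I, α, r, hcα, hinj⟩ := (hs a).exists_injOn (cn_parkingLot p)
    have low : ∀ b : AttachRays p, rayHeight i b ≤ u →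
        dist (ray i u hu) b - dist (ray i v hv) b = u - v := by
      intro b hb
      have := dist_add_pt hu.le huv hb
      rw [dist_pt_pt i hv.le hu.le, pt_of_pos i hu, pt_of_pos i hv, abs_of_nonneg (by linarith)] at this
      linarith
    have high : ∀ b : AttachRays p, v ≤ rayHeight i b →
        dist (ray i u hu) b - dist (ray i v hv) b = v - u := by
      intro b hb
      rw [eq_pt_of_rayHeight_pos (hv.trans_le hb), ← pt_of_pos i hu, ← pt_of_pos i hv,
        dist_pt_pt i hu.le (hv.le.trans hb), dist_pt_pt i hv.le (hv.le.trans hb),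
        abs_of_nonpos (by linarith), abs_of_nonpos (by linarith)]
      ring
    -- Outside heights between `u` and `v` the difference of distances takes only the values `u - v`
    -- and `v - u`. Three points of a pole avoiding these heights would contradict injectivity.
    obtain ⟨s, hsI, h1, h2⟩ : ∃ s ∈ Icc (r - 1 / 2) (r + 1 / 2), u ≤ rayHeight i (α s) ∧
        rayHeight i (α s) ≤ v := by
      by_contra! hno
      have m0 : r ∈ Icc (r - 1 / 2) (r + 1 / 2) := ⟨by linarith, by linarith⟩
      have m1 : r - 1 / 2 ∈ Icc (r - 1 / 2) (r + 1 / 2) := ⟨by linarith, by linarith⟩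
      have m2 : r + 1 / 2 ∈ Icc (r - 1 / 2) (r + 1 / 2) := ⟨by linarith, by linarith⟩
      have two : ∀ s ∈ Icc (r - 1 / 2) (r + 1 / 2),
          dist (ray i u hu) (α s) - dist (ray i v hv) (α s) = u - v ∨
          dist (ray i u hu) (α s) - dist (ray i v hv) (α s) = v - u := by
        intro s hs
        rcases le_or_gt u (rayHeight i (α s)) with h | h
        · exact Or.inr (high _ (hno s hs h).le)
        · exact Or.inl (low _ h.le)
      have d01 := fun e => hinj m0 m1 e
      have d02 := fun e => hinj m0 m2 e
      have d12 := fun e => hinj m1 m2 e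
      simp only at d01 d02 d12
      rcases two _ m0 with e0 | e0 <;> rcases two _ m1 with e1 | e1 <;> rcases two _ m2 with e2 | e2
      · linarith [d01 (e0.trans e1.symm)]
      · linarith [d01 (e0.trans e1.symm)]
      · linarith [d02 (e0.trans e2.symm)]
      · linarith [d12 (e1.trans e2.symm)]
      · linarith [d12 (e1.trans e2.symm)]
      · linarith [d02 (e0.trans e2.symm)]
      · linarith [d01 (e0.trans e1.symm)]
      · linarith [d01 (e0.trans e1.symm)]
    have hmem := hcα.apply_mem hsI
    rw [eq_pt_of_rayHeight_pos (hu.trans_le h1)] at hmem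
    rcases exists_half_integer_mem (hc.1.1 a) (hu.le.trans h1) hmem with h0 | ⟨m, hm, hmh⟩
    · exact ⟨_, Finset.mem_image.2 ⟨0, Finset.mem_insert_self _ _, rfl⟩, by simpa using h0⟩
    · have hm' := abs_le.1 hm
      refine ⟨_, Finset.mem_image.2 ⟨m, Finset.mem_insert_of_mem (Finset.mem_Icc.2
        ⟨Nat.ceil_le.2 (by linarith), Nat.le_floor (by linarith)⟩), rfl⟩, hmh⟩

end AttachRays

/-! ## The curtain models -/

theorem IsWeight.summable {lam : ℕ+ → ℝ} (h : IsWeight lam) : Summable lam := by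
  refine Summable.of_nonneg_of_le (fun L => (h.1 L).1.le) (fun L => ?_) h.2.1
  have h1 : (1 : ℝ) ≤ (L : ℝ) ^ 2 := one_le_pow₀ (Nat.one_le_cast.2 L.pos)
  nlinarith [(h.1 L).1]

/-- The upper estimate uses a bound common to all `L` and the finite sum of the weights; the lower
one keeps only the term `L = 2`, since both families of long chains are 2-chains. -/
theorem IsWeight.dist_le {lam : ℕ+ → ℝ} (h : IsWeight lam) {X : Type*} [MetricSpace X]
    {x y : CurtainModel lam X} {B : ℝ} (hB : ∀ L : ℕ, dL L x.point y.point ≤ B) :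
    dist x y ≤ (∑' L, lam L) * B ∧ lam 2 * dL 2 x.point y.point ≤ dist x y := by
  have hle : ∀ L : ℕ+, lam L * dL (L : ℕ) x.point y.point ≤ lam L * B := fun L =>
    mul_le_mul_of_nonneg_left (hB L) (h.1 L).1.le
  have h0 : ∀ L : ℕ+, 0 ≤ lam L * dL (L : ℕ) x.point y.point := fun L =>
    mul_nonneg (h.1 L).1.le (dL_nonneg _ _ _)
  have hs : Summable fun L : ℕ+ => lam L * dL (L : ℕ) x.point y.point :=
    Summable.of_nonneg_of_le h0 hle (h.summable.mul_right B)
  refine ⟨?_, hs.le_tsum 2 fun L _ => h0 L⟩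
  rw [← tsum_mul_right]
  exact hs.tsum_le_tsum hle (h.summable.mul_right B)

/-- A quasi-isometric embedding, in symmetric form. -/
def IsQIEmbedding {X Y : Type*} [Dist X] [Dist Y] (f : X → Y) : Prop :=
  ∃ K C : ℝ, 1 ≤ K ∧ 0 ≤ C ∧ ∀ x x' : X, dist (f x) (f x') ≤ K * dist x x' + C ∧
    dist x x' ≤ K * dist (f x) (f x') + C

theorem IsQuasiIsometry.isQIEmbedding {X Y : Type*} [Dist X] [Dist Y] {f : X → Y}
    (h : IsQuasiIsometry f) : IsQIEmbedding f := by
  obtain ⟨K, C, hK, hC, h, -⟩ := h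
  refine ⟨K, K * C, hK, by positivity, fun x x' => ⟨(h x x').2.trans ?_, ?_⟩⟩
  · nlinarith
  · have h1 := (h x x').1
    have hK0 : 0 < K := by linarith
    have h2 := mul_le_mul_of_nonneg_left h1 hK0.le
    rw [mul_sub, ← mul_assoc, mul_inv_cancel₀ hK0.ne', one_mul] at h2
    linarith

theorem IsQIEmbedding.isQuasiIsometry {X Y : Type*} [Dist X] [MetricSpace Y] {f : X → Y}
    (h : IsQIEmbedding f) (hs : Function.Surjective f) : IsQuasiIsometry f := by
  obtain ⟨K, C, hK, hC, h⟩ := h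
  refine ⟨K, C, hK, hC, fun x x' => ⟨?_, (h x x').1⟩, fun y => ?_⟩
  · have h1 := (h x x').2
    have hK0 : 0 < K := by linarith
    have h2 : K⁻¹ * dist x x' ≤ dist (f x) (f x') + K⁻¹ * C := by
      rw [inv_mul_le_iff₀ hK0, mul_add, ← mul_assoc, mul_inv_cancel₀ hK0.ne', one_mul]
      exact h1
    have h3 : K⁻¹ * C ≤ C := mul_le_of_le_one_left hC (inv_le_one_of_one_le₀ hK)
    linarith
  · obtain ⟨x, rfl⟩ := hs y
    exact ⟨x, by rwa [dist_self]⟩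

theorem IsQIEmbedding.comp {X Y Z : Type*} [Dist X] [Dist Y] [Dist Z] {g : Y → Z} {f : X → Y}
    (hg : IsQIEmbedding g) (hf : IsQIEmbedding f) : IsQIEmbedding (g ∘ f) := by
  obtain ⟨K, C, hK, hC, hf⟩ := hf
  obtain ⟨K', C', hK', hC', hg⟩ := hg
  have hK0 : 0 ≤ K := by linarith
  have hK0' : 0 ≤ K' := by linarith
  refine ⟨K * K', K' * C + C' + (K * C' + C), by nlinarith, by positivity, fun x x' => ?_⟩
  have h1 := hf x x'
  have h2 := hg (f x) (f x')
  have h3 := mul_le_mul_of_nonneg_left h1.1 hK0'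
  have h4 := mul_le_mul_of_nonneg_left h2.2 hK0
  have n1 : 0 ≤ K * C' := by positivity
  have n2 : 0 ≤ K' * C := by positivity
  simp only [Function.comp_apply]
  constructor
  · linarith [h2.1]
  · linarith [h1.2]

theorem IsQIEmbedding.of_rightInverse {X Y : Type*} [Dist X] [Dist Y] {f : X → Y} {g : Y → X}
    (h : IsQIEmbedding f) (hg : Function.RightInverse g f) : IsQIEmbedding g := by
  obtain ⟨K, C, hK, hC, h⟩ := h
  refine ⟨K, C, hK, hC, fun y y' => ?_⟩
  have := h (g y) (g y')
  rw [hg y, hg y'] at this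
  exact ⟨this.2, this.1⟩

/-! ### Comparison of the curtain distance with the collapsed tree -/

namespace AttachRays

section TreeDist

variable {ι : Type*} {p : ι → ParkingLot}

open Classical in
/-- The distance after the parking lot has been collapsed to the line of angles. -/
def treeDist (u v : AttachRays p) : ℝ :=
  if OnSameRay u v then |u.height - v.height| else u.height + v.height + |u.ang - v.ang|

theorem treeDist_base_base (x y : ParkingLot) :
    treeDist (base x : AttachRays p) (base y) = |x.angle - y.angle| := by
  rw [treeDist, if_neg (by rintro ⟨i, s, t, hs, ht, h, -⟩; cases h)]
  simp [height, ang, foot]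

theorem treeDist_base_ray (x : ParkingLot) (i : ι) (s : ℝ) (hs : 0 < s) :
    treeDist (base x : AttachRays p) (ray i s hs) = s + |x.angle - (p i).angle| := by
  rw [treeDist, if_neg (by rintro ⟨i, s, t, hs, ht, h, -⟩; cases h)]
  simp [height, ang, foot]

theorem treeDist_ray_base (x : ParkingLot) (i : ι) (s : ℝ) (hs : 0 < s) :
    treeDist (ray i s hs : AttachRays p) (base x) = s + |(p i).angle - x.angle| := by
  rw [treeDist, if_neg (by rintro ⟨i, s, t, hs, ht, -, h⟩; cases h)]
  simp [height, ang, foot]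

theorem treeDist_ray_same (i : ι) (s t : ℝ) (hs : 0 < s) (ht : 0 < t) :
    treeDist (ray i s hs : AttachRays p) (ray i t ht) = |s - t| := by
  rw [treeDist, if_pos ⟨i, s, t, hs, ht, rfl, rfl⟩]
  rfl

theorem treeDist_ray_ray {i j : ι} (hij : i ≠ j) (s t : ℝ) (hs : 0 < s) (ht : 0 < t) :
    treeDist (ray i s hs : AttachRays p) (ray j t ht) = s + t + |(p i).angle - (p j).angle| := by
  rw [treeDist, if_neg]
  · rfl
  · rintro ⟨k, s, t, hs, ht, h, h'⟩
    cases h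
    cases h'
    exact hij rfl

theorem treeDist_nonneg (u v : AttachRays p) : 0 ≤ treeDist u v := by
  unfold treeDist
  split_ifs
  · exact abs_nonneg _
  · linarith [u.height_nonneg, v.height_nonneg, abs_nonneg (u.ang - v.ang)]

theorem dL_le_treeDist (L : ℕ) (x y : AttachRays p) : dL L x y ≤ 2 * treeDist x y + 22 := by
  have n1 := x.height_nonneg
  have n2 := y.height_nonneg
  by_cases h : OnSameRay x y
  · obtain ⟨i, s, t, hs, ht, rfl, rfl⟩ := h
    rw [treeDist_ray_same]
    wlog hst : s ≤ t generalizing s t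
    · rw [dL_comm, abs_sub_comm]; exact this t s ht hs n2 n1 (by linarith)
    have := (chainBound_ray (p := p) L i hs hst ht).dL_le (by linarith)
    rw [abs_sub_comm, abs_of_nonneg (by linarith)]
    linarith
  · have := (chainBound L x y).dL_le (by positivity)
    rw [treeDist, if_neg h]
    have := abs_nonneg (x.ang - y.ang)
    linarith

/-- The change of angle costs a factor 20 and each of the two heights a factor 2. -/
theorem treeDist_le_dL (x y : AttachRays p) : treeDist x y ≤ 24 * dL 2 x y := by
  have hang : |x.ang - y.ang| ≤ 20 * dL 2 x y := by
    have h1 := ang_sub_le_dL (chainBound 2 x y)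
    have h2 := ang_sub_le_dL (chainBound 2 y x)
    rw [dL_comm] at h2
    exact abs_le.2 ⟨by linarith, by linarith⟩
  have hray : ∀ i, |rayHeight i x - rayHeight i y| ≤ 2 * dL 2 x y := fun i => by
    have h1 := rayHeight_sub_le_dL (cn_parkingLot p) i (chainBound 2 x y)
    have h2 := rayHeight_sub_le_dL (cn_parkingLot p) i (chainBound 2 y x)
    rw [dL_comm] at h2
    exact abs_le.2 ⟨by linarith, by linarith⟩
  have hd := dL_nonneg 2 x y
  by_cases h : OnSameRay x y
  · obtain ⟨i, s, t, hs, ht, rfl, rfl⟩ := h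
    have := hray i
    rw [rayHeight_ray, rayHeight_ray] at this
    rw [treeDist_ray_same]
    linarith
  · rw [treeDist, if_neg h]
    have hx : x.height ≤ 2 * dL 2 x y := by
      rcases x with x | ⟨i, s, hs⟩
      · simp only [height]; linarith
      · have := hray i
        rw [rayHeight_ray, rayHeight_of_ne fun t ht e => h ⟨i, s, t, hs, ht, rfl, e⟩, sub_zero,
          abs_of_pos hs] at this
        exact this
    have hy : y.height ≤ 2 * dL 2 x y := by
      rcases y with y | ⟨i, s, hs⟩
      · simp only [height]; linarith
      · have := hray i
        rw [rayHeight_ray, rayHeight_of_ne fun t ht e => h ⟨i, t, s, ht, hs, e, rfl⟩, zero_sub,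
          abs_neg, abs_of_pos hs] at this
        exact this
    linarith

theorem exists_dist_bounds {lam : ℕ+ → ℝ} (hlam : IsWeight lam) (p : ι → ParkingLot) :
    ∃ K C : ℝ, 1 ≤ K ∧ 0 ≤ C ∧ ∀ x y : CurtainModel lam (AttachRays p),
      dist x y ≤ K * treeDist x.point y.point + C ∧ treeDist x.point y.point ≤ K * dist x y := by
  have hl2 := hlam.1 2
  have hS : 0 ≤ ∑' L, lam L := tsum_nonneg fun L => (hlam.1 L).1.le
  have h24 : 1 ≤ 24 / lam 2 := by rw [le_div_iff₀ hl2.1]; linarith [hl2.2]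
  refine ⟨2 * (∑' L, lam L) + 24 / lam 2, 22 * ∑' L, lam L, by linarith, by positivity,
    fun x y => ?_⟩
  have ht := treeDist_nonneg x.point y.point
  obtain ⟨h1, h2⟩ := hlam.dist_le (x := x) (y := y) fun L => dL_le_treeDist L x.point y.point
  have h0 : 0 ≤ dist x y := le_trans (mul_nonneg hl2.1.le (dL_nonneg _ _ _)) h2
  constructor
  · have : 0 ≤ 24 / lam 2 * treeDist x.point y.point := by positivity
    linarith
  · have h3 := treeDist_le_dL x.point y.point
    have h4 : 24 * dL 2 x.point y.point ≤ 24 / lam 2 * dist x y := by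
      rw [div_mul_eq_mul_div, le_div_iff₀ hl2.1]; linarith
    have : 0 ≤ 2 * (∑' L, lam L) * dist x y := by positivity
    linarith

theorem isQIEmbedding_of_treeDist {lam : ℕ+ → ℝ} (hlam : IsWeight lam) {Y : Type*} [MetricSpace Y]
    {f : AttachRays p → Y} {A : ℝ} (hf : ∀ u v, |dist (f u) (f v) - treeDist u v| ≤ A) :
    IsQIEmbedding fun x : CurtainModel lam (AttachRays p) => f x.point := by
  obtain ⟨K, C, hK, hC, h⟩ := exists_dist_bounds hlam p
  refine ⟨K, C + K * |A|, hK, by positivity, fun x x' => ?_⟩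
  have h1 := abs_le.1 ((hf x.point x'.point).trans (le_abs_self A))
  have h2 := h x x'
  have h3 : |A| ≤ K * |A| := by nlinarith [abs_nonneg A]
  constructor
  · linarith
  · have := mul_le_mul_of_nonneg_left h1.1 (by linarith : 0 ≤ K)
    nlinarith [h2.1]

end TreeDist

theorem dist_pt_pt_ne {X ι : Type*} [MetricSpace X] {p : ι → X} {i j : ι} (hij : i ≠ j) {s t : ℝ}
    (hs : 0 ≤ s) (ht : 0 ≤ t) : dist (pt p i s) (pt p j t) = s + dist (p i) (p j) + t := by
  rw [dist_pt_of_ne _ hs, dist_base]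
  · rcases ht.eq_or_lt with rfl | ht'
    · rw [pt_zero]; simp [foot, height]
    · rw [pt_of_pos j ht']; simp [foot, height, add_assoc]
  · intro w hw e
    rcases ht.eq_or_lt with rfl | ht'
    · rw [pt_zero] at e; cases e
    · rw [pt_of_pos j ht'] at e
      cases e
      exact hij rfl

end AttachRays

open AttachRays

/-- The map which collapses the parking lot to the line of angles. -/
def collapseW : SpaceW → LineWithRays
  | base x => base x.angle
  | ray i s hs => ray i.succPNat s hs

/-- The ray at the angle `i` is moved to the positive integer `i + 1`. This costs at most 1 for a
ray and a base point, and nothing for two rays. -/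
theorem abs_dist_collapseW_sub_le (u v : SpaceW) :
    |dist (collapseW u) (collapseW v) - treeDist u v| ≤ 1 := by
  have key : ∀ t a : ℝ, |t - (a + 1)| - |t - a| ∈ Icc (-1 : ℝ) 1 := fun t a => by
    have h1 := abs_sub_abs_le_abs_sub (t - (a + 1)) (t - a)
    have h2 := abs_sub_abs_le_abs_sub (t - a) (t - (a + 1))
    rw [show t - (a + 1) - (t - a) = -1 by ring] at h1
    rw [show t - a - (t - (a + 1)) = 1 by ring] at h2
    norm_num at h1 h2
    exact ⟨by linarith, by linarith⟩
  rcases u with x | ⟨i, s, hs⟩ <;> rcases v with y | ⟨j, t, ht⟩ <;> simp only [collapseW]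
  · rw [dist_base_base, treeDist_base_base, Real.dist_eq, sub_self, abs_zero]; norm_num
  · rw [dist_base_ray, treeDist_base_ray, Real.dist_eq]
    have := key x.angle j
    simp only [Nat.succPNat_coe, Nat.succ_eq_add_one, Nat.cast_add, Nat.cast_one]
    exact abs_le.2 ⟨by linarith [this.1], by linarith [this.2]⟩
  · rw [dist_ray_base, treeDist_ray_base, Real.dist_eq]
    have := key y.angle i
    simp only [Nat.succPNat_coe, Nat.succ_eq_add_one, Nat.cast_add, Nat.cast_one]
    rw [abs_sub_comm _ y.angle, abs_sub_comm _ y.angle]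
    exact abs_le.2 ⟨by linarith [this.1], by linarith [this.2]⟩
  · by_cases hij : i = j
    · subst hij
      rw [dist_ray_same, treeDist_ray_same, sub_self, abs_zero]; norm_num
    · rw [dist_ray_ray (fun h => hij (Nat.succPNat_injective h)), treeDist_ray_ray hij, Real.dist_eq]
      simp only [Nat.succPNat_coe, Nat.succ_eq_add_one, Nat.cast_add, Nat.cast_one,
        add_sub_add_right_eq_sub]
      rw [show ∀ a : ℝ, s + a + t - (s + t + a) = 0 from fun a => by ring, abs_zero]
      norm_num

theorem collapseW_surjective : Function.Surjective collapseW := by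
  rintro (t | ⟨n, s, hs⟩)
  · exact ⟨base (ParkingLot.circ t), rfl⟩
  · exact ⟨ray n.natPred s hs, by simp [collapseW]⟩

/-- The map which collapses the parking lot to the line of angles, cut into two rays. -/
def collapseZ : SpaceZ → WedgeOfRays
  | base x => if 0 ≤ x.angle then pt _ 0 x.angle else pt _ 1 (-x.angle)
  | ray i s hs => ray (i + 2) s hs

/-- There is no error here: all rays are glued at the angle 0, which becomes the wedge point. The
two halves of the line of angles take the indices 0 and 1, and the glued rays are shifted by 2. -/
theorem dist_collapseZ (u v : SpaceZ) : dist (collapseZ u) (collapseZ v) = treeDist u v := by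
  have mixed : ∀ (x : ParkingLot) (j : ℕ) (t : ℝ) (ht : 0 < t),
      dist (collapseZ (base x)) (collapseZ (ray j t ht)) = t + |x.angle| := by
    intro x j t ht
    simp only [collapseZ]
    rw [← pt_of_pos (j + 2) ht]
    split_ifs with h
    · rw [dist_pt_pt_ne (by omega) h ht.le, dist_self, abs_of_nonneg h]; ring
    · rw [dist_pt_pt_ne (by omega) (by linarith) ht.le, dist_self, abs_of_neg (by linarith)]; ring
  rcases u with x | ⟨i, s, hs⟩ <;> rcases v with y | ⟨j, t, ht⟩
  · rw [treeDist_base_base]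
    simp only [collapseZ]
    split_ifs with h1 h2 h2
    · rw [dist_pt_pt 0 h1 h2]
    · rw [dist_pt_pt_ne zero_ne_one h1 (by linarith), dist_self, abs_of_nonneg (by linarith)]; ring
    · rw [dist_pt_pt_ne one_ne_zero (by linarith) h2, dist_self, abs_of_nonpos (by linarith)]; ring
    · rw [dist_pt_pt 1 (by linarith) (by linarith), abs_sub_comm]; congr 1; ring
  · rw [mixed, treeDist_base_ray]; simp
  · rw [dist_comm, mixed, treeDist_ray_base]; simp
  · by_cases hij : i = j
    · subst hij
      simp only [collapseZ]
      rw [dist_ray_same, treeDist_ray_same]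
    · simp only [collapseZ]
      rw [dist_ray_ray (by omega), treeDist_ray_ray hij]
      simp

theorem collapseZ_surjective : Function.Surjective collapseZ := by
  rintro (t | ⟨n, s, hs⟩)
  · refine ⟨base (ParkingLot.circ 0), ?_⟩
    simp [collapseZ, pt_zero]
  · match n with
    | 0 => exact ⟨base (ParkingLot.circ s), by simp [collapseZ, hs.le, pt_of_pos _ hs]⟩
    | 1 => exact ⟨base (ParkingLot.circ (-s)), by simp [collapseZ, not_le.2 hs, pt_of_pos _ hs]⟩
    | n + 2 => exact ⟨ray n s hs, rfl⟩

theorem CurtainModel.point_surjective (lam : ℕ+ → ℝ) (X : Type*) :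
    Function.Surjective (CurtainModel.point : CurtainModel lam X → X) := fun x => ⟨⟨x⟩, rfl⟩

section

variable {lam : ℕ+ → ℝ}

theorem isQIEmbedding_collapseW (hlam : IsWeight lam) :
    IsQIEmbedding fun x : CurtainModel lam SpaceW => collapseW x.point :=
  isQIEmbedding_of_treeDist hlam abs_dist_collapseW_sub_le

theorem isQIEmbedding_collapseZ (hlam : IsWeight lam) :
    IsQIEmbedding fun x : CurtainModel lam SpaceZ => collapseZ x.point :=
  isQIEmbedding_of_treeDist hlam (A := 0) fun u v => by rw [dist_collapseZ, sub_self, abs_zero]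

theorem quasiIsometric_curtainModel_spaceW (hlam : IsWeight lam) :
    QuasiIsometric (CurtainModel lam SpaceW) LineWithRays :=
  ⟨_, (isQIEmbedding_collapseW hlam).isQuasiIsometry
    (collapseW_surjective.comp (CurtainModel.point_surjective lam SpaceW))⟩

theorem quasiIsometric_curtainModel_spaceZ (hlam : IsWeight lam) :
    QuasiIsometric (CurtainModel lam SpaceZ) WedgeOfRays :=
  ⟨_, (isQIEmbedding_collapseZ hlam).isQuasiIsometry
    (collapseZ_surjective.comp (CurtainModel.point_surjective lam SpaceZ))⟩

end

/-! ## The line with rays does not embed in the wedge -/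

/-- The coordinate on the wedge which is positive on the `j`-th ray and negative elsewhere. -/
def wedgeCoord (j : ℕ) (u : WedgeOfRays) : ℝ := 2 * rayHeight j u - u.height

theorem wedgeCoord_ray (j : ℕ) (s : ℝ) (hs : 0 < s) :
    wedgeCoord j (ray j s hs : WedgeOfRays) = s := by
  rw [wedgeCoord, rayHeight_ray, height]; ring

theorem wedgeCoord_of_ne {j : ℕ} {u : WedgeOfRays} (h : ∀ t ht, u ≠ ray j t ht) :
    wedgeCoord j u = -u.height := by
  rw [wedgeCoord, rayHeight_of_ne h]; ring

theorem exists_ray_of_wedgeCoord_pos {j : ℕ} {u : WedgeOfRays} (h : 0 < wedgeCoord j u) :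
    ∃ t ht, u = ray j t ht := by
  rcases exists_ray_or_ne j u with h' | h'
  · exact h'
  · rw [wedgeCoord_of_ne h'] at h
    linarith [u.height_nonneg]

theorem dist_eq_of_wedgeCoord_pos {j : ℕ} {u v : WedgeOfRays} (hu : 0 < wedgeCoord j u)
    (hv : 0 < wedgeCoord j v) : dist u v = |wedgeCoord j u - wedgeCoord j v| := by
  obtain ⟨s, hs, rfl⟩ := exists_ray_of_wedgeCoord_pos hu
  obtain ⟨t, ht, rfl⟩ := exists_ray_of_wedgeCoord_pos hv
  rw [dist_ray_same, wedgeCoord_ray, wedgeCoord_ray]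

theorem abs_wedgeCoord_sub_le (j : ℕ) (u v : WedgeOfRays) :
    |wedgeCoord j u - wedgeCoord j v| ≤ dist u v := by
  have mixed : ∀ (s : ℝ) (hs : 0 < s) (v : WedgeOfRays), (∀ t ht, v ≠ ray j t ht) →
      |wedgeCoord j (ray j s hs) - wedgeCoord j v| ≤ dist (ray j s hs) v := by
    intro s hs v hv
    rw [wedgeCoord_ray, wedgeCoord_of_ne hv, dist_ray_of_ne hv, dist_base, dist_self,
      abs_of_nonneg (by linarith [v.height_nonneg])]
    linarith
  rcases exists_ray_or_ne j u with ⟨s, hs, rfl⟩ | hu <;>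
    rcases exists_ray_or_ne j v with ⟨t, ht, rfl⟩ | hv
  · rw [wedgeCoord_ray, wedgeCoord_ray, dist_ray_same]
  · exact mixed s hs v hv
  · rw [abs_sub_comm, dist_comm]; exact mixed t ht u hu
  · rw [wedgeCoord_of_ne hu, wedgeCoord_of_ne hv]
    by_cases h : OnSameRay u v
    · obtain ⟨i, s, t, hs, ht, rfl, rfl⟩ := h
      rw [dist_ray_same, ← abs_neg]
      simp only [height]
      exact le_of_eq (congrArg _ (by ring))
    · rw [dist_eq_of_not_sameRay h, dist_self]
      have := u.height_nonneg
      have := v.height_nonneg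
      exact abs_le.2 ⟨by linarith, by linarith⟩

/-- The three legs at the branch point `n`. -/
def leg (n : ℕ+) (a : Fin 3) (k : ℝ) : LineWithRays :=
  if a = 0 then base (n - k) else if a = 1 then base (n + k) else pt _ n k

theorem leg_zero (n : ℕ+) (a : Fin 3) : leg n a 0 = base (n : ℝ) := by
  unfold leg
  split_ifs <;> simp [pt_zero]

theorem dist_leg_same (n : ℕ+) (a : Fin 3) {k l : ℝ} (hk : 0 ≤ k) (hl : 0 ≤ l) :
    dist (leg n a k) (leg n a l) = |k - l| := by
  unfold leg
  split_ifs
  · rw [dist_base_base, Real.dist_eq, abs_sub_comm]; congr 1; ring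
  · rw [dist_base_base, Real.dist_eq]; congr 1; ring
  · exact dist_pt_pt n hk hl

theorem dist_leg_ne (n : ℕ+) {a b : Fin 3} (hab : a ≠ b) {k l : ℝ} (hk : 0 ≤ k) (hl : 0 ≤ l) :
    dist (leg n a k) (leg n b l) = k + l := by
  wlog h : a < b generalizing a b k l
  · rw [dist_comm, add_comm]
    exact this hab.symm hl hk (lt_of_le_of_ne (not_lt.1 h) hab.symm)
  have hpt : ∀ x : ℝ, dist (base x : LineWithRays) (pt _ n l) = |x - n| + l := fun x => by
    rw [dist_comm, dist_pt_of_ne (by rintro t ht ⟨⟩) hl, dist_base_base, Real.dist_eq, abs_sub_comm,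
      add_comm]
  fin_cases a <;> fin_cases b <;> simp [leg] at h ⊢
  · rw [dist_base_base, Real.dist_eq, abs_of_nonpos (by linarith)]; ring
  · rw [hpt, show (n : ℝ) - k - n = -k by ring, abs_neg, abs_of_nonneg hk]
  · rw [hpt, show (n : ℝ) + k - n = k by ring, abs_of_nonneg hk]

/-- Suppose a branch point goes far out on the `j`-th ray of the wedge. Follow its three legs until
their images are at distance about `R` from its own image, still on that ray. A ray leaves only two
sides, so two legs exit on the same side with nearby images, although the exit points are far apart.
Hence all branch points have images near the wedge point, which is impossible because they are
unbounded. -/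
theorem not_isQIEmbedding_line_wedge (F : LineWithRays → WedgeOfRays) : ¬ IsQIEmbedding F := by
  rintro ⟨K, C, hK, hC, hF⟩
  -- `J` bounds the jump of the image over a unit step. `R` is chosen so that leaving the
  -- `R`-neighbourhood takes at least `K * J + C + 1` steps; exit points on different legs are then
  -- too far apart for images at distance `J`.
  set J := K + C with hJ
  set R := C + K * (K * J + C + 1) with hR
  have hJ1 : 1 ≤ J := by linarith
  have hKJ : 0 ≤ K * J := by positivity
  have hR1 : 1 ≤ R := by nlinarith
  have hbound : ∀ n : ℕ+, (F (base (n : ℝ))).height < R + J + 1 := by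
    intro n
    by_contra! hH
    obtain ⟨j, H, hH0, eF⟩ : ∃ j H hH, F (base (n : ℝ)) = ray j H hH := by
      rcases e : F (base (n : ℝ)) with x | ⟨j, s, hs⟩
      · rw [e] at hH
        simp only [height] at hH
        linarith
      · exact ⟨j, s, hs, rfl⟩
    rw [eF] at hH
    simp only [height] at hH
    have g0 : wedgeCoord j (F (base (n : ℝ))) = H := by rw [eF, wedgeCoord_ray]
    have near : ∀ u : LineWithRays, |wedgeCoord j (F u) - H| < R + J →
        0 < wedgeCoord j (F u) ∧ dist (F u) (F (base (n : ℝ))) = |wedgeCoord j (F u) - H| := by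
      intro u hu
      have hp : 0 < wedgeCoord j (F u) := by linarith [(abs_lt.1 hu).1]
      exact ⟨hp, by rw [dist_eq_of_wedgeCoord_pos hp (by rw [g0]; exact hH0), g0]⟩
    -- Take the first integral time at which the coordinate has moved by `R`; by minimality it has
    -- moved by less than `R + J`, so the image is still on the `j`-th ray.
    have exit : ∀ a : Fin 3, ∃ k : ℕ, R ≤ |wedgeCoord j (F (leg n a k)) - H| ∧
        |wedgeCoord j (F (leg n a k)) - H| < R + J := by
      intro a
      have hex : ∃ k : ℕ, R ≤ |wedgeCoord j (F (leg n a k)) - H| := by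
        obtain ⟨k, hk⟩ := exists_nat_gt (K * R + C)
        refine ⟨k, ?_⟩
        by_contra! hlt
        have h1 := (near _ (hlt.trans (by linarith))).2
        have h2 := (hF (leg n a k) (leg n a 0)).2
        rw [dist_leg_same n a (Nat.cast_nonneg k) le_rfl, sub_zero, abs_of_nonneg (Nat.cast_nonneg k),
          leg_zero, h1] at h2
        have := mul_le_mul_of_nonneg_left hlt.le (by linarith : 0 ≤ K)
        linarith
      classical
      refine ⟨Nat.find hex, Nat.find_spec hex, ?_⟩
      have hpos : Nat.find hex ≠ 0 := by
        intro h0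
        have := Nat.find_spec hex
        rw [h0, Nat.cast_zero, leg_zero, g0, sub_self, abs_zero] at this
        linarith
      obtain ⟨m, hm⟩ := Nat.exists_eq_succ_of_ne_zero hpos
      have h1 := Nat.find_min hex (m := m) (by omega)
      rw [not_le] at h1
      rw [hm]
      have h2 := abs_wedgeCoord_sub_le j (F (leg n a (m.succ : ℕ))) (F (leg n a m))
      have h3 := (hF (leg n a (m.succ : ℕ)) (leg n a m)).1
      rw [dist_leg_same n a (Nat.cast_nonneg _) (Nat.cast_nonneg _)] at h3
      rw [show |((m.succ : ℕ) : ℝ) - m| = 1 by push_cast; rw [add_sub_cancel_left, abs_one]] at h3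
      have h4 := abs_sub_le (wedgeCoord j (F (leg n a (m.succ : ℕ)))) (wedgeCoord j (F (leg n a m))) H
      linarith
    choose k hk1 hk2 using exit
    have far : ∀ a, K * J + C + 1 ≤ (k a : ℝ) := by
      intro a
      have h1 := (near _ (hk2 a)).2
      have h2 := (hF (leg n a (k a)) (leg n a 0)).1
      rw [dist_leg_same n a (Nat.cast_nonneg _) le_rfl, sub_zero, abs_of_nonneg (Nat.cast_nonneg _),
        leg_zero, h1] at h2
      have h3 : K * (K * J + C + 1) ≤ K * (k a : ℝ) := by linarith [hk1 a]
      exact le_of_mul_le_mul_left h3 (by linarith)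
    obtain ⟨a, b, hab, hside⟩ := Fintype.exists_ne_map_eq_of_card_lt
      (fun a : Fin 3 => decide (0 ≤ wedgeCoord j (F (leg n a (k a))) - H)) (by simp)
    have hclose : |wedgeCoord j (F (leg n a (k a))) - wedgeCoord j (F (leg n b (k b)))| ≤ J := by
      have a1 := hk1 a
      have a2 := hk2 a
      have b1 := hk1 b
      have b2 := hk2 b
      by_cases ha : 0 ≤ wedgeCoord j (F (leg n a (k a))) - H
      · have hb : 0 ≤ wedgeCoord j (F (leg n b (k b))) - H := by
          simpa [ha] using hside
        rw [abs_of_nonneg ha] at a1 a2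
        rw [abs_of_nonneg hb] at b1 b2
        exact abs_le.2 ⟨by linarith, by linarith⟩
      · have hb : ¬ 0 ≤ wedgeCoord j (F (leg n b (k b))) - H := by
          intro hb
          simp [ha, hb] at hside
        rw [abs_of_neg (not_le.1 ha)] at a1 a2
        rw [abs_of_neg (not_le.1 hb)] at b1 b2
        exact abs_le.2 ⟨by linarith, by linarith⟩
    have h1 := dist_eq_of_wedgeCoord_pos (near _ (hk2 a)).1 (near _ (hk2 b)).1
    have h2 := (hF (leg n a (k a)) (leg n b (k b))).2
    rw [dist_leg_ne n hab (Nat.cast_nonneg _) (Nat.cast_nonneg _), h1] at h2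
    have h3 := mul_le_mul_of_nonneg_left hclose (by linarith : 0 ≤ K)
    linarith [far a, far b]
  obtain ⟨N, hN⟩ := exists_nat_gt (K * (2 * (R + J + 1)) + C)
  have h1 := (hF (base ((N.succPNat : ℕ+) : ℝ)) (base ((1 : ℕ+) : ℝ))).2
  have h2 : dist (F (base ((N.succPNat : ℕ+) : ℝ))) (F (base ((1 : ℕ+) : ℝ))) ≤ 2 * (R + J + 1) := by
    have t := dist_triangle (F (base ((N.succPNat : ℕ+) : ℝ))) (base PUnit.unit)
      (F (base ((1 : ℕ+) : ℝ)))
    rw [dist_comm _ (base PUnit.unit), dist_base, dist_base] at t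
    have e : ∀ u : PUnit, dist PUnit.unit u = 0 := fun u => dist_self _
    linarith [hbound N.succPNat, hbound 1, e (foot (F (base ((N.succPNat : ℕ+) : ℝ)))),
      e (foot (F (base ((1 : ℕ+) : ℝ))))]
  rw [dist_base_base, Real.dist_eq] at h1
  have h3 : |((N.succPNat : ℕ+) : ℝ) - ((1 : ℕ+) : ℝ)| = N := by
    simp [Nat.succPNat_coe]
  rw [h3] at h1
  have h4 := mul_le_mul_of_nonneg_left h2 (by linarith : 0 ≤ K)
  linarith

/-- A section of the collapse of `SpaceW`, a supposed quasi-isometry of the models and the collapse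
of `SpaceZ` would compose to an embedding of the line with rays into the wedge. -/
theorem not_quasiIsometric_curtainModels {lam : ℕ+ → ℝ} (hlam : IsWeight lam) :
    ¬ QuasiIsometric (CurtainModel lam SpaceW) (CurtainModel lam SpaceZ) := by
  rintro ⟨g, hg⟩
  have hs : Function.Surjective fun x : CurtainModel lam SpaceW => collapseW x.point :=
    collapseW_surjective.comp (CurtainModel.point_surjective lam SpaceW)
  exact not_isQIEmbedding_line_wedge _ ((isQIEmbedding_collapseZ hlam).comp
    (hg.isQIEmbedding.comp ((isQIEmbedding_collapseW hlam).of_rightInverse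
      (Function.rightInverse_surjInv hs))))

/-! ## The spiral map on the curtain model of the parking lot -/

/-- The parking lot with no rays attached. -/
def noRays : ParkingLot ≃ᵢ AttachRays (Empty.elim : Empty → ParkingLot) where
  toFun := base
  invFun u := u.foot
  left_inv _ := rfl
  right_inv u := by
    rcases u with x | ⟨i, _, _⟩
    · rfl
    · exact i.elim
  isometry_toFun := Isometry.of_dist_eq fun _ _ => rfl

theorem exists_dist_bounds_parkingLot {lam : ℕ+ → ℝ} (hlam : IsWeight lam) :
    ∃ K C : ℝ, 1 ≤ K ∧ 0 ≤ C ∧ ∀ x y : CurtainModel lam ParkingLot,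
      dist x y ≤ K * |x.point.angle - y.point.angle| + C ∧
        |x.point.angle - y.point.angle| ≤ K * dist x y := by
  obtain ⟨K, C, hK, hC, h⟩ := exists_dist_bounds hlam (Empty.elim : Empty → ParkingLot)
  refine ⟨K, C, hK, hC, fun x y => ?_⟩
  have := h ⟨noRays x.point⟩ ⟨noRays y.point⟩
  have e : dist (⟨noRays x.point⟩ : CurtainModel lam (AttachRays (Empty.elim : Empty → ParkingLot)))
      ⟨noRays y.point⟩ = dist x y := by
    refine tsum_congr fun L => ?_
    rw [dL_isometryEquiv]
  rw [e] at this
  simp only [show ∀ z, noRays z = base z from fun _ => rfl, treeDist_base_base] at this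
  exact this

/-- The points `(0, 1)` and `(0, 2 ^ N)` have equal angles, so their curtain distance is bounded
independently of `N`, while the angles of their images differ by `N`. -/
theorem not_isQuasiIsometry_curtainModelMap_spiralMap {lam : ℕ+ → ℝ} (hlam : IsWeight lam) :
    ¬ IsQuasiIsometry (curtainModelMap lam spiralMap) := by
  rintro ⟨K', C', hK', hC', h', -⟩
  obtain ⟨K, C, hK, hC, h⟩ := exists_dist_bounds_parkingLot hlam
  obtain ⟨N, hN⟩ := exists_nat_gt (K * (K' * C + C'))
  let x : CurtainModel lam ParkingLot := ⟨ParkingLot.circ 0⟩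
  let y : CurtainModel lam ParkingLot := ⟨⟨0, 2 ^ N, one_le_pow₀ one_le_two⟩⟩
  have h1 : dist x y ≤ C := by simpa [x, y] using (h x y).1
  have h2 := (h (curtainModelMap lam spiralMap x) (curtainModelMap lam spiralMap y)).2
  have h3 := (h' x y).2
  have e : |(curtainModelMap lam spiralMap x).point.angle
      - (curtainModelMap lam spiralMap y).point.angle| = N := by
    simp [curtainModelMap, spiralMap, x, y, ParkingLot.circ, Real.logb_pow]
  rw [e] at h2
  have h4 : K * dist (curtainModelMap lam spiralMap x) (curtainModelMap lam spiralMap y)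
      ≤ K * (K' * C + C') := by
    refine mul_le_mul_of_nonneg_left (h3.trans ?_) (by linarith)
    have := mul_le_mul_of_nonneg_left h1 (by linarith : 0 ≤ K')
    linarith
  linarith

end CurtainModels

end

open CurtainModels in
theorem theorem1 (lam : ℕ+ → ℝ) (hlam : IsWeight lam) :
    (IsCAT0 ParkingLot ∧ IsQuasiIsometry spiralMap ∧
      ¬ IsQuasiIsometry (curtainModelMap lam spiralMap)) ∧
    (IsCAT0 SpaceW ∧ IsCAT0 SpaceZ ∧ QuasiIsometric SpaceW SpaceZ ∧
      ¬ QuasiIsometric (CurtainModel lam SpaceW) (CurtainModel lam SpaceZ)) ∧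
    QuasiIsometric (CurtainModel lam SpaceW) LineWithRays ∧
    QuasiIsometric (CurtainModel lam SpaceZ) WedgeOfRays :=
  ⟨⟨ParkingLot.isCAT0, isQuasiIsometry_spiralMap,
      not_isQuasiIsometry_curtainModelMap_spiralMap hlam⟩,
    ⟨AttachRays.isCAT0_parkingLot _, AttachRays.isCAT0_parkingLot _, quasiIsometric_spaceW_spaceZ,
      not_quasiIsometric_curtainModels hlam⟩,
    quasiIsometric_curtainModel_spaceW hlam, quasiIsometric_curtainModel_spaceZ hlam⟩
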